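/- **Theorem (FRW PIU/FIU with $\bar\lambda=+\infty$).** Let $2\le n\le\infty$, let $I\subseteq\mathbb R$ be a nonempty open interval, $a:I\to(0,\infty)$ a function of class $C^n$, and $(S,d\sigma^2)$ a connected (Hausdorff, second countable) Riemannian 3-manifold of constant curvature $k\in\{-1,0,1\}$, i.e. locally $d\sigma^2=\frac{dr^2}{1-kr^2}+r^2(d\theta^2+\sin^2\theta\,d\phi^2)$. Consider the FRW model $\mathcal M=I\times S$ with metric $g=-dt^2+a(t)^2d\sigma^2$, time-oriented by the fluid flow $u=\partial_t$. *Definition.* The model *admits an FIU (Future Isotropic Universe) with limit $\bar\lambda\in[-\infty,+\infty]$ at which the fluid flow is regular* if there are a spacetime $(\bar{\mathcal M},\bar g)$ (a connected, Hausdorff, second countable smooth 4-manifold with a continuous time-oriented Lorentzian metric), a smooth cosmic time function $\bar T:\bar{\mathcal M}\to\mathbb R$ (strictly increasing along every future-directed causal curve) whose zero set $\{\bar T=0\}$ is nonempty and on which $d\bar T\ne0$, and a function $\bar\Omega$ of $\bar T$ such that 1. $\mathcal M$ is identified, by a time-orientation preserving $C^{n+1}$ diffeomorphism, with the open submanifold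 $\{\bar T<0\}$, on which $\bar\Omega(\bar T)>0$ and $g=\bar\Omega(\bar T)^2\bar g$; and $\bar g$ is $C^2$ on an open neighbourhood of $\{\bar T=0\}$; 2. $\bar\Omega(\bar T)\to+\infty$ as $\bar T\to0^-$, and for some $c>0$ the function $\bar\Omega$ is $C^2$, positive and strictly increasing on $[-c,0)$; 3. $\bar L=\frac{\bar\Omega''}{\bar\Omega}\left(\frac{\bar\Omega}{\bar\Omega'}\right)^2$ is defined and continuous on $[-c,0)$, $\bar L\to\bar\lambda$ as $\bar T\to0^-$, and $\bar\lambda\ne1,2$; 4. there is a unit timelike vector field $\bar u$ on $\bar{\mathcal M}$ with $\bar u=\bar\Omega u$ on $\mathcal M$ that is $C^2$ on an open neighbourhood of $\{\bar T=0\}$. A *PIU (Past Isotropic Universe)* is defined in the same way with $\{\bar T>0\}$ in place of $\{\bar T<0\}$, $\bar T\to0^+$ in place of $\bar T\to0^-$, $(0,c]$ in place of $[-c,0)$, and $\bar\Omega$ strictly decreasing. *Claim.* The model admits an FIU with $\bar\lambda=+\infty$ at which the fluid flow is regular if and only if $$\frac{\ddot a\,a}{\dot a^2}\to+\infty\quad\text{and}\quad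 a(t)\to+\infty\qquad\text{as } t\to\sup I,$$ and it admits a PIU with $\bar\lambda=+\infty$ at which the fluid flow is regular if and only if the same two limits hold as $t\to\inf I$. -/

import Mathlib

open Set Filter Topology Bundle
open scoped Manifold ContDiff

universe u

noncomputable section

namespace FRW

/-- The model space of 3-manifolds. -/
abbrev E3 : Type := EuclideanSpace ℝ (Fin 3)

/-- The model space of 4-manifolds. -/
abbrev E4 : Type := ℝ × E3

/-- A smooth Riemannian metric on a 3-manifold. -/
abbrev RiemannMetric (S : Type*) [TopologicalSpace S] [ChartedSpace E3 S]
    [IsManifold 𝓘(ℝ, E3) ∞ S] :=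
  ContMDiffRiemannianMetric 𝓘(ℝ, E3) ∞ E3 (fun x : S => TangentSpace 𝓘(ℝ, E3) x)

/-- The Riemannian metric `σ` has constant curvature `k`, in the Friedmann-Robertson-Walker
normal form: near every point there are smooth coordinates `x ∈ ℝ³` with `k |x|² < 1` and
`dσ² = |dx|² + k (x · dx)² / (1 - k |x|²)`.
With `x = r n`, `r = |x|`, `|n| = 1`, the right-hand side is
`dr² / (1 - k r²) + r² (dθ² + sin² θ dφ²)`. -/
def HasConstantCurvature {S : Type*} [TopologicalSpace S] [ChartedSpace E3 S]
    [IsManifold 𝓘(ℝ, E3) ∞ S] (σ : RiemannMetric S) (k : ℝ) : Prop :=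
  ∀ p : S, ∃ e ∈ IsManifold.maximalAtlas 𝓘(ℝ, E3) ∞ S, p ∈ e.source ∧
    ∀ q ∈ e.source, k * ‖e q‖ ^ 2 < 1 ∧
      ∀ v w : TangentSpace 𝓘(ℝ, E3) q,
        let v' : E3 := mfderiv 𝓘(ℝ, E3) 𝓘(ℝ, E3) e q v
        let w' : E3 := mfderiv 𝓘(ℝ, E3) 𝓘(ℝ, E3) e q w
        σ.inner q v w =
          inner ℝ v' w' + k * (inner ℝ (e q) v' * inner ℝ (e q) w') / (1 - k * ‖e q‖ ^ 2)

/-- A Friedmann-Robertson-Walker model of class `C^n`: the manifold `I × S` with the metric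
`-dt² + a(t)² dσ²`, where `I` is a nonempty open interval, `a` is a positive `C^n` function on
`I` and `(S, dσ²)` is a 3-manifold of constant curvature `k ∈ {-1, 0, 1}`.
The values of `a` outside `I` play no role. -/
structure Model (n : ℕ∞) (S : Type*) [TopologicalSpace S] [ChartedSpace E3 S]
    [IsManifold 𝓘(ℝ, E3) ∞ S] where
  I : Set ℝ
  isOpen_I : IsOpen I
  ordConnected_I : I.OrdConnected
  nonempty_I : I.Nonempty
  a : ℝ → ℝ
  contDiffOn_a : ContDiffOn ℝ n a I
  a_pos : ∀ t ∈ I, 0 < a t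
  k : ℝ
  k_mem : k = -1 ∨ k = 0 ∨ k = 1
  σ : RiemannMetric S
  curvature : HasConstantCurvature σ k

/-- Tangent vectors of `ℝ × S` at `p`; a vector is a pair (time component, spatial component). -/
abbrev TanProd {S : Type*} [TopologicalSpace S] [ChartedSpace E3 S] (p : ℝ × S) : Type :=
  TangentSpace (𝓘(ℝ, ℝ).prod 𝓘(ℝ, E3)) p

namespace Model

variable {n : ℕ∞} {S : Type*} [TopologicalSpace S] [ChartedSpace E3 S]
    [IsManifold 𝓘(ℝ, E3) ∞ S]

/-- The FRW metric `-dt² + a(t)² dσ²`. -/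
def metric (F : Model n S) (p : ℝ × S) (v w : TanProd p) : ℝ :=
  let v' : ℝ × TangentSpace 𝓘(ℝ, E3) p.2 := v
  let w' : ℝ × TangentSpace 𝓘(ℝ, E3) p.2 := w
  F.a p.1 ^ 2 * F.σ.inner p.2 v'.2 w'.2 - v'.1 * w'.1

/-- The fluid flow `u = ∂/∂t`. -/
def fluid (p : ℝ × S) : TanProd p :=
  ((1, 0) : ℝ × TangentSpace 𝓘(ℝ, E3) p.2)

/-- The function `ä a / ȧ²`. -/
def ratio (F : Model n S) (t : ℝ) : ℝ :=
  deriv (deriv F.a) t * F.a t / deriv F.a t ^ 2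

end Model

/-- A spacetime structure on a 4-manifold `X`: a continuous Lorentzian metric of signature
`(-,+,+,+)` with a time orientation, given by a continuous timelike vector field. -/
structure Spacetime (X : Type*) [TopologicalSpace X] [ChartedSpace E4 X]
    [IsManifold 𝓘(ℝ, E4) ∞ X] where
  g : ∀ p : X, TangentSpace 𝓘(ℝ, E4) p →L[ℝ] TangentSpace 𝓘(ℝ, E4) p →L[ℝ] ℝ
  symm : ∀ (p : X) (v w : TangentSpace 𝓘(ℝ, E4) p), g p v w = g p w v
  /-- Signature `(-,+,+,+)`: there is a timelike vector with positive definite complement. -/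
  lorentzian : ∀ p : X, ∃ v : TangentSpace 𝓘(ℝ, E4) p, g p v v < 0 ∧
    ∀ w : TangentSpace 𝓘(ℝ, E4) p, g p v w = 0 → w ≠ 0 → 0 < g p w w
  continuous_g : ContMDiff 𝓘(ℝ, E4) (𝓘(ℝ, E4).prod 𝓘(ℝ, E4 →L[ℝ] E4 →L[ℝ] ℝ)) 0
    (fun p : X => TotalSpace.mk' (E4 →L[ℝ] E4 →L[ℝ] ℝ)
      (E := fun p : X => TangentSpace 𝓘(ℝ, E4) p →L[ℝ] TangentSpace 𝓘(ℝ, E4) p →L[ℝ] ℝ)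
      p (g p))
  timeDir : ∀ p : X, TangentSpace 𝓘(ℝ, E4) p
  continuous_timeDir : ContMDiff 𝓘(ℝ, E4) (𝓘(ℝ, E4).prod 𝓘(ℝ, E4)) 0
    (fun p : X => TotalSpace.mk' E4 (E := fun p : X => TangentSpace 𝓘(ℝ, E4) p) p (timeDir p))
  timelike_timeDir : ∀ p : X, g p (timeDir p) (timeDir p) < 0

namespace Spacetime

variable {X : Type*} [TopologicalSpace X] [ChartedSpace E4 X] [IsManifold 𝓘(ℝ, E4) ∞ X]

/-- The metric is of class `C^2` on `U`. -/
def MetricC2On (G : Spacetime X) (U : Set X) : Prop :=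
  ContMDiffOn 𝓘(ℝ, E4) (𝓘(ℝ, E4).prod 𝓘(ℝ, E4 →L[ℝ] E4 →L[ℝ] ℝ)) 2
    (fun p : X => TotalSpace.mk' (E4 →L[ℝ] E4 →L[ℝ] ℝ)
      (E := fun p : X => TangentSpace 𝓘(ℝ, E4) p →L[ℝ] TangentSpace 𝓘(ℝ, E4) p →L[ℝ] ℝ)
      p (G.g p)) U

/-- Future-directed causal tangent vectors. -/
def FutureCausal (G : Spacetime X) (p : X) (v : TangentSpace 𝓘(ℝ, E4) p) : Prop :=
  v ≠ 0 ∧ G.g p v v ≤ 0 ∧ G.g p v (G.timeDir p) < 0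

/-- Future-directed causal curves, defined on an open interval. -/
def IsFutureCausalCurve (G : Spacetime X) (γ : ℝ → X) (α β : ℝ) : Prop :=
  ContMDiffOn 𝓘(ℝ, ℝ) 𝓘(ℝ, E4) 1 γ (Ioo α β) ∧
    ∀ s ∈ Ioo α β, G.FutureCausal (γ s) (mfderiv 𝓘(ℝ, ℝ) 𝓘(ℝ, E4) γ s (1 : ℝ))

/-- A smooth cosmic time function: it increases along every future-directed causal curve. -/
def IsSmoothCosmicTime (G : Spacetime X) (T : X → ℝ) : Prop :=
  ContMDiff 𝓘(ℝ, E4) 𝓘(ℝ, ℝ) ∞ T ∧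
    ∀ (γ : ℝ → X) (α β : ℝ), G.IsFutureCausalCurve γ α β → StrictMonoOn (T ∘ γ) (Ioo α β)

end Spacetime

/-- The function `L = (Ω'' / Ω) (Ω / Ω')²`. -/
def bigL (Ω : ℝ → ℝ) (T : ℝ) : ℝ :=
  deriv (deriv Ω) T / Ω T * (Ω T / deriv Ω T) ^ 2

/-- The conditions on the conformal factor at a Future Isotropic Universe with
`λ = lim L` (possibly infinite). -/
def FutureFactor (Ω : ℝ → ℝ) (lam : EReal) : Prop :=
  Tendsto Ω (𝓝[<] 0) atTop ∧
  (∃ c > 0, ContDiffOn ℝ 2 Ω (Ico (-c) 0) ∧ StrictMonoOn Ω (Ico (-c) 0) ∧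
    (∀ T ∈ Ico (-c) 0, 0 < Ω T) ∧
    (∀ T ∈ Ico (-c) 0, deriv Ω T ≠ 0) ∧ ContinuousOn (bigL Ω) (Ico (-c) 0)) ∧
  Tendsto (fun T => (bigL Ω T : EReal)) (𝓝[<] 0) (𝓝 lam) ∧ lam ≠ 1 ∧ lam ≠ 2

/-- The conditions on the conformal factor at a Past Isotropic Universe with
`λ = lim L` (possibly infinite). -/
def PastFactor (Ω : ℝ → ℝ) (lam : EReal) : Prop :=
  Tendsto Ω (𝓝[>] 0) atTop ∧
  (∃ c > 0, ContDiffOn ℝ 2 Ω (Ioc 0 c) ∧ StrictAntiOn Ω (Ioc 0 c) ∧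
    (∀ T ∈ Ioc 0 c, 0 < Ω T) ∧
    (∀ T ∈ Ioc 0 c, deriv Ω T ≠ 0) ∧ ContinuousOn (bigL Ω) (Ioc 0 c)) ∧
  Tendsto (fun T => (bigL Ω T : EReal)) (𝓝[>] 0) (𝓝 lam) ∧ lam ≠ 1 ∧ lam ≠ 2

section Conformal

variable {n : ℕ∞} {S : Type*} [TopologicalSpace S] [ChartedSpace E3 S]
    [IsManifold 𝓘(ℝ, E3) ∞ S]

/-- The unphysical spacetime `(X, ḡ)`, with cosmic time function `T` and conformal factor `Ω(T)`,
extends the FRW model conformally: the model is identified with the open submanifold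
`{p | T p ∈ D}` (where `D` is `Iio 0` or `Ioi 0`), on which `g = Ω(T)² ḡ`. -/
structure ConformalExtension (F : Model n S) (D : Set ℝ) (X : Type*) [TopologicalSpace X]
    [ChartedSpace E4 X] [IsManifold 𝓘(ℝ, E4) ∞ X] extends Spacetime X where
  T : X → ℝ
  cosmicTime : toSpacetime.IsSmoothCosmicTime T
  /-- `T = 0` is a nonempty regular hypersurface. -/
  nonempty_zero : ∃ p, T p = 0
  regular_zero : ∀ p, T p = 0 → mfderiv 𝓘(ℝ, E4) 𝓘(ℝ, ℝ) T p ≠ 0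
  /-- The identification of the model with `{p | T p ∈ D}`. -/
  φ : OpenPartialHomeomorph (ℝ × S) X
  source_φ : φ.source = F.I ×ˢ (univ : Set S)
  target_φ : φ.target = {p | T p ∈ D}
  contMDiffOn_φ : ContMDiffOn (𝓘(ℝ, ℝ).prod 𝓘(ℝ, E3)) 𝓘(ℝ, E4) ((n + 1 : ℕ∞) : WithTop ℕ∞)
    φ φ.source
  contMDiffOn_φ_symm : ContMDiffOn 𝓘(ℝ, E4) (𝓘(ℝ, ℝ).prod 𝓘(ℝ, E3))
    ((n + 1 : ℕ∞) : WithTop ℕ∞) φ.symm φ.target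
  /-- The time orientations agree: `∂/∂t` is future-directed. -/
  future_φ : ∀ p ∈ φ.source, toSpacetime.FutureCausal (φ p)
    (mfderiv (𝓘(ℝ, ℝ).prod 𝓘(ℝ, E3)) 𝓘(ℝ, E4) φ p (Model.fluid p))
  Ω : ℝ → ℝ
  Ω_pos : ∀ p, T p ∈ D → 0 < Ω (T p)
  conformal : ∀ p ∈ φ.source, ∀ v w : TanProd p,
    F.metric p v w = Ω (T (φ p)) ^ 2 *
      g (φ p) (mfderiv (𝓘(ℝ, ℝ).prod 𝓘(ℝ, E3)) 𝓘(ℝ, E4) φ p v)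
        (mfderiv (𝓘(ℝ, ℝ).prod 𝓘(ℝ, E3)) 𝓘(ℝ, E4) φ p w)
  /-- The unphysical metric is `C^2` on an open neighbourhood of `T = 0`. -/
  regular_g : ∃ U : Set X, IsOpen U ∧ {p | T p = 0} ⊆ U ∧ toSpacetime.MetricC2On U

/-- The fluid flow is regular at `T = 0`: there is a unit timelike vector field `ū` on the
unphysical spacetime, equal to `Ω u` on the FRW model, that is of class `C^2` on an open
neighbourhood of `T = 0`. -/
def ConformalExtension.FluidRegular {F : Model n S} {D : Set ℝ} {X : Type*} [TopologicalSpace X]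
    [ChartedSpace E4 X] [IsManifold 𝓘(ℝ, E4) ∞ X] (C : ConformalExtension F D X) : Prop :=
  ∃ ubar : ∀ p : X, TangentSpace 𝓘(ℝ, E4) p,
    (∀ p, C.g p (ubar p) (ubar p) = -1) ∧
    (∀ p ∈ C.φ.source, ubar (C.φ p) = C.Ω (C.T (C.φ p)) •
      mfderiv (𝓘(ℝ, ℝ).prod 𝓘(ℝ, E3)) 𝓘(ℝ, E4) C.φ p (Model.fluid p)) ∧
    ∃ U : Set X, IsOpen U ∧ {p | C.T p = 0} ⊆ U ∧
      ContMDiffOn 𝓘(ℝ, E4) (𝓘(ℝ, E4).prod 𝓘(ℝ, E4)) 2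
        (fun p : X => TotalSpace.mk' E4 (E := fun p : X => TangentSpace 𝓘(ℝ, E4) p) p (ubar p)) U

end Conformal

/-- The FRW model admits a Future Isotropic Universe with limit `lam` of `L`, at which the fluid
flow is regular. The unphysical spacetime is a connected, Hausdorff, second countable smooth
4-manifold. -/
def Model.AdmitsFIU {n : ℕ∞} {S : Type u} [TopologicalSpace S] [ChartedSpace E3 S]
    [IsManifold 𝓘(ℝ, E3) ∞ S] (F : Model n S) (lam : EReal) : Prop :=
  ∃ (X : Type u) (_ : TopologicalSpace X) (_ : T2Space X) (_ : SecondCountableTopology X)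
    (_ : ConnectedSpace X) (_ : ChartedSpace E4 X) (_ : IsManifold 𝓘(ℝ, E4) ∞ X)
    (C : ConformalExtension F (Iio 0) X), FutureFactor C.Ω lam ∧ C.FluidRegular

/-- The FRW model admits a Past Isotropic Universe with limit `lam` of `L`, at which the fluid
flow is regular. -/
def Model.AdmitsPIU {n : ℕ∞} {S : Type u} [TopologicalSpace S] [ChartedSpace E3 S]
    [IsManifold 𝓘(ℝ, E3) ∞ S] (F : Model n S) (lam : EReal) : Prop :=
  ∃ (X : Type u) (_ : TopologicalSpace X) (_ : T2Space X) (_ : SecondCountableTopology X)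
    (_ : ConnectedSpace X) (_ : ChartedSpace E4 X) (_ : IsManifold 𝓘(ℝ, E4) ∞ X)
    (C : ConformalExtension F (Ioi 0) X), PastFactor C.Ω lam ∧ C.FluidRegular

end FRW

end

/-! Everything happens along one fluid line, since the scale factor depends on `t` alone.

Suppose an extension exists and let p be a point with T = 0. The field ū is C² near p and unit
timelike. It is future-directed at p as a limit of future-directed vectors, so dT(ū) > 0 because dT
≠ 0 there. Hence the integral curve of ū ending at p comes from T < 0, where it is a fluid line with
dt/ds = Ω(T), s being unphysical proper time. Its time t runs to sup I, for otherwise the curve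
would end inside the model. Let W be a comoving vector orthogonal to ū and G = ḡ(W, W). Conformality
says Ω² G = c a² with c constant, so with H = ȧ/a, R = Ω'/Ω and P = dT/ds logarithmic
differentiation gives HΩ = RP + G'/(2G). A second differentiation expresses ä a/ȧ² = 1 + Ḣ/H²
through L, R, P and G.

Two facts finish this direction. First, R → +∞: R' = R²(L - 1) makes R increasing near 0, and R is
the derivative of log Ω, which blows up in finite time (`FutureFactor.tendsto_logDeriv`). Second,
G'/G and G''/G stay bounded although W is a priori defined only for T < 0: orthogonality to ū turns
the evolution of W into a linear equation with C¹ coefficients near p (`hasDerivAt_comovingGen`), so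
G' and G'' are continuous quadratic forms in W, and G itself is uniformly positive definite on the
complement of ū (`eventually_le_of_orthogonal`). The term w² L with w = RP then dominates, so ä a/ȧ²
→ +∞, while a² = Ω² G/c → +∞ because G is bounded away from 0.

Conversely, let η be conformal time, dη = dt/a. Eventually ȧ > 0 and ä a ≥ ȧ², so η + 1/ȧ is
nonincreasing and η is bounded above; normalize sup η = 0. With Ω = a as a function of η one
computes L = ä a/ȧ² + 1 → +∞, and the metric -dη² + dσ² extends smoothly across η = 0
(`Cylinder.extension`).

The statement about the past follows by time reversal (`Model.admitsPIU_iff_rev`). -/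

/-! ### Growth of the conformal factor and of the scale factor along a fluid line -/

/-- A function whose derivative is bounded by a constant below `0` cannot blow up at `0`. -/
theorem exists_lt_deriv_of_tendsto_atTop {f f' : ℝ → ℝ} {c : ℝ} (hc : c < 0)
    (hf : ∀ x ∈ Ioo c 0, HasDerivAt f (f' x) x) (htop : Tendsto f (𝓝[<] 0) atTop) (M : ℝ) :
    ∃ x ∈ Ioo c 0, M < f' x := by
  by_contra! hM
  obtain ⟨x₀, hx₀⟩ : (Ioo c 0).Nonempty := nonempty_Ioo.2 hc
  -- The slope |M| instead of M is nonnegative, which makes the bound uniform in x.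
  have hbd : ∀ x ∈ Ioo x₀ 0, f x ≤ f x₀ + |M| * |x₀| := by
    intro x hx
    have hsub : Icc x₀ x ⊆ Ioo c 0 := fun z hz => ⟨hx₀.1.trans_le hz.1, hz.2.trans_lt hx.2⟩
    have := Convex.image_sub_le_mul_sub_of_deriv_le (convex_Icc x₀ x)
      (fun z hz => (hf z (hsub hz)).continuousAt.continuousWithinAt)
      (fun z hz => (hf z (hsub (interior_subset hz))).differentiableAt.differentiableWithinAt)
      (C := |M|) (fun z hz => by
        rw [(hf z (hsub (interior_subset hz))).deriv]
        exact (hM z (hsub (interior_subset hz))).trans (le_abs_self M))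
      x₀ (left_mem_Icc.2 hx.1.le) x (right_mem_Icc.2 hx.1.le) hx.1.le
    have h2 : x - x₀ ≤ |x₀| := by rw [abs_of_neg hx₀.2]; linarith [hx.2]
    nlinarith [abs_nonneg M]
  have h1 : ∀ᶠ x in 𝓝[<] (0 : ℝ), x ∈ Ioo x₀ 0 := Ioo_mem_nhdsLT hx₀.2
  obtain ⟨x, hx, hx'⟩ := (h1.and (htop.eventually_gt_atTop (f x₀ + |M| * |x₀|))).exists
  exact absurd (hbd x hx) (not_le.2 hx')

namespace FRW

/-- Monotonicity only gives Ω' ≥ 0; strictness comes from Ω' ≠ 0, which is part of L being defined.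
The left endpoint is dropped so that differentiability holds in a full neighbourhood. -/
theorem FutureFactor.regular {Ω : ℝ → ℝ} {lam : EReal} (h : FutureFactor Ω lam) :
    ∃ c < 0, ∀ T ∈ Ioo c 0, ContDiffAt ℝ 2 Ω T ∧ 0 < Ω T ∧ 0 < deriv Ω T := by
  obtain ⟨-, ⟨c, hc, hsm, hmono, hpos, hne, -⟩, -⟩ := h
  refine ⟨-c, by linarith, fun T hT => ⟨hsm.contDiffAt (Ico_mem_nhds hT.1 hT.2),
    hpos T ⟨hT.1.le, hT.2⟩, lt_of_le_of_ne ?_ (hne T ⟨hT.1.le, hT.2⟩).symm⟩⟩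
  rw [← derivWithin_of_mem_nhds (Ico_mem_nhds hT.1 hT.2)]
  exact hmono.monotoneOn.derivWithin_nonneg

/-- Riccati equation for R = Ω'/Ω: R' = Ω''/Ω - R², and Ω''/Ω = R² L by definition of L. -/
theorem hasDerivAt_logDeriv {Ω : ℝ → ℝ} {T : ℝ} (h : ContDiffAt ℝ 2 Ω T) (h0 : 0 < Ω T)
    (h1 : 0 < deriv Ω T) :
    HasDerivAt (fun x => deriv Ω x / Ω x) ((deriv Ω T / Ω T) ^ 2 * (bigL Ω T - 1)) T := by
  have hd : DifferentiableAt ℝ (deriv Ω) T := by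
    exact (h.derivWithin (m := 1) (by norm_num)).differentiableAt (by norm_num)
  refine (hd.hasDerivAt.div (h.differentiableAt (by norm_num)).hasDerivAt h0.ne').congr_deriv ?_
  rw [bigL]
  field_simp

/-- Once L > 1 the Riccati equation makes R monotone, so it is enough that R is unbounded near 0. It
is, being the derivative of log Ω, which tends to +∞ on a bounded interval. -/
theorem FutureFactor.tendsto_logDeriv {Ω : ℝ → ℝ} (h : FutureFactor Ω ⊤) :
    Tendsto (fun T => deriv Ω T / Ω T) (𝓝[<] 0) atTop := by
  obtain ⟨c, hc, hreg⟩ := h.regular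
  have hL : ∀ᶠ T in 𝓝[<] (0 : ℝ), 1 < bigL Ω T :=
    ((EReal.tendsto_coe_nhds_top_iff.1 h.2.2.1).eventually_gt_atTop 1)
  obtain ⟨c', hc', hL'⟩ := mem_nhdsLT_iff_exists_Ioo_subset.1 hL
  set d := max c c' with hd
  have hd0 : d < 0 := max_lt hc hc'
  have hsub : ∀ T ∈ Ioo d 0, (ContDiffAt ℝ 2 Ω T ∧ 0 < Ω T ∧ 0 < deriv Ω T) ∧ 1 < bigL Ω T :=
    fun T hT => ⟨hreg T ⟨(le_max_left _ _).trans_lt hT.1, hT.2⟩,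
      hL' ⟨(le_max_right _ _).trans_lt hT.1, hT.2⟩⟩
  have hmono : MonotoneOn (fun T => deriv Ω T / Ω T) (Ioo d 0) := by
    have hder : ∀ T ∈ Ioo d 0, HasDerivAt (fun x => deriv Ω x / Ω x)
        ((deriv Ω T / Ω T) ^ 2 * (bigL Ω T - 1)) T := fun T hT =>
      hasDerivAt_logDeriv (hsub T hT).1.1 (hsub T hT).1.2.1 (hsub T hT).1.2.2
    apply monotoneOn_of_deriv_nonneg (convex_Ioo _ _)
      (fun T hT => (hder T hT).continuousAt.continuousWithinAt)
      (fun T hT => (hder T (interior_subset hT)).differentiableAt.differentiableWithinAt)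
    intro T hT
    rw [(hder T (interior_subset hT)).deriv]
    have := (hsub T (interior_subset hT)).2
    exact mul_nonneg (sq_nonneg _) (by linarith)
  rw [tendsto_atTop]
  intro M
  obtain ⟨x, hx, hMx⟩ := exists_lt_deriv_of_tendsto_atTop (f := fun T => Real.log (Ω T)) hd0
    (fun T hT => ((hsub T hT).1.1.differentiableAt (by norm_num)).hasDerivAt.log
      (hsub T hT).1.2.1.ne') (Real.tendsto_log_atTop.comp h.1) M
  filter_upwards [Ioo_mem_nhdsLT hx.2] with y hy
  exact hMx.le.trans (hmono hx ⟨hx.1.trans hy.1, hy.2⟩ hy.1.le)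

/-- The asymptotics of the deceleration quotient in terms of the conformal factor. -/
theorem tendsto_ratio_asymptotics {α : Type*} {l : Filter α} {v Λ κ b b' : α → ℝ} {C : ℝ}
    (hw₀ : Tendsto v l atTop) (hΛ : Tendsto Λ l atTop) (hκ : ∀ᶠ x in l, |κ x| ≤ C)
    (hb : ∀ᶠ x in l, |b x| ≤ C) (hb' : ∀ᶠ x in l, |b' x| ≤ C) :
    Tendsto (fun x => 1 + (v x ^ 2 * (Λ x - 1) + v x * κ x + b' x - (v x + b x) * v x) /
      (v x + b x) ^ 2) l atTop := by
  rw [tendsto_atTop]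
  intro M
  -- The first threshold gives w ≥ 1 and 0 < w + b ≤ 2w, hence M (w + b)² ≤ 4 |M| w². The second
  -- lets w² Λ absorb this and the remaining terms, each bounded by a constant multiple of w².
  filter_upwards [hκ, hb, hb', hw₀.eventually_ge_atTop (|C| + 1),
    hΛ.eventually_ge_atTop (4 * (|M| + 10 * (|C| + 1) ^ 2 + 10))] with x h1 h2 h3 h4 h5
  set D := |C| with hD
  have hCD : C ≤ D := le_abs_self C
  have hD0 : 0 ≤ D := abs_nonneg C
  rw [abs_le] at h1 h2 h3
  set w := v x
  have hs : 0 < w + b x := by linarith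
  have hs2 : w + b x ≤ 2 * w := by linarith
  have hw : 1 ≤ w := by linarith
  have key : M * (w + b x) ^ 2 ≤ |M| * (4 * w ^ 2) := by
    have : (w + b x) ^ 2 ≤ 4 * w ^ 2 := by nlinarith
    calc M * (w + b x) ^ 2 ≤ |M| * (w + b x) ^ 2 := by
          gcongr; exact le_abs_self M
      _ ≤ _ := by gcongr
  rw [← sub_le_iff_le_add', le_div_iff₀ (by positivity)]
  have hww : w ≤ w ^ 2 := by nlinarith
  have e1 : -(D * w ^ 2) ≤ w * κ x := by
    have h6 : D * w ≤ D * w ^ 2 := by gcongr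
    have h7 : w * -D ≤ w * κ x := by gcongr; linarith
    linarith
  have e2 : -(D * w ^ 2) ≤ b' x := by
    have h6 : D * 1 ≤ D * w ^ 2 := by gcongr; linarith
    linarith
  have e3 : (w + b x) * w ≤ 2 * w ^ 2 := by nlinarith
  have e4 : w ^ 2 * (4 * (|M| + 10 * (D + 1) ^ 2 + 10) - 1) ≤ w ^ 2 * (Λ x - 1) := by gcongr
  have e5 : 0 ≤ (w + b x) ^ 2 := by positivity
  have e6 : D * w ^ 2 ≤ (D + 1) ^ 2 * w ^ 2 := by gcongr; nlinarith
  have e7 : 0 ≤ w ^ 2 := by positivity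
  have e8 : 0 ≤ (D + 1) ^ 2 * w ^ 2 := by positivity
  nlinarith

/-- The scale factor and the deceleration quotient along a fluid line, parametrised by the
unphysical proper time; `G` is the square of the unphysical length of a comoving vector. -/
theorem FutureFactor.tendsto_along_curve {Ω : ℝ → ℝ} (hΩ : FutureFactor Ω ⊤) {I : Set ℝ}
    (hI : IsOpen I) {a : ℝ → ℝ} (ha : ContDiffOn ℝ 2 a I) (ha0 : ∀ t ∈ I, 0 < a t)
    {t x P P' G G' G'' : ℝ → ℝ} {ε C c p₀ : ℝ} (hε : ε < 0) (hc : 0 < c) (hp₀ : 0 < p₀)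
    (htI : ∀ s ∈ Ioo ε 0, t s ∈ I) (ht : ∀ s ∈ Ioo ε 0, HasDerivAt t (Ω (x s)) s)
    (hx : ∀ s ∈ Ioo ε 0, HasDerivAt x (P s) s) (hx0 : ∀ s ∈ Ioo ε 0, x s < 0)
    (hxlim : Tendsto x (𝓝[<] 0) (𝓝 0))
    (hP : ∀ s ∈ Ioo ε 0, HasDerivAt P (P' s) s) (hPlow : ∀ s ∈ Ioo ε 0, p₀ ≤ P s)
    (hP' : ∀ s ∈ Ioo ε 0, |P' s| ≤ C)
    (hG : ∀ s ∈ Ioo ε 0, HasDerivAt G (G' s) s) (hG' : ∀ s ∈ Ioo ε 0, HasDerivAt G' (G'' s) s)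
    (hG0 : ∀ s ∈ Ioo ε 0, 0 < G s) (hGb : ∀ s ∈ Ioo ε 0, |G' s| ≤ C * G s)
    (hGb' : ∀ s ∈ Ioo ε 0, |G'' s| ≤ C * G s)
    (hrel : ∀ s ∈ Ioo ε 0, Ω (x s) ^ 2 * G s = c * a (t s) ^ 2) :
    Tendsto (fun s => a (t s)) (𝓝[<] 0) atTop ∧
      Tendsto (fun s => deriv (deriv a) (t s) * a (t s) / deriv a (t s) ^ 2) (𝓝[<] 0) atTop := by
  obtain ⟨d, hd, hreg⟩ := hΩ.regular
  have hxlt : Tendsto x (𝓝[<] 0) (𝓝[<] 0) := tendsto_nhdsWithin_iff.2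
    ⟨hxlim, by filter_upwards [Ioo_mem_nhdsLT hε] with s hs using hx0 s hs⟩
  obtain ⟨ε', hε', hsub⟩ := mem_nhdsLT_iff_exists_Ioo_subset.1
    (hxlt.eventually (Ioo_mem_nhdsLT hd))
  set e := max ε ε' with he
  have he0 : e < 0 := max_lt hε hε'
  have hin : ∀ s ∈ Ioo e 0, s ∈ Ioo ε 0 := fun s hs => ⟨(le_max_left _ _).trans_lt hs.1, hs.2⟩
  have hxr : ∀ s ∈ Ioo e 0, ContDiffAt ℝ 2 Ω (x s) ∧ 0 < Ω (x s) ∧ 0 < deriv Ω (x s) :=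
    fun s hs => hreg _ (hsub ⟨(le_max_right _ _).trans_lt hs.1, hs.2⟩)
  have hat : ∀ s ∈ Ioo e 0, ContDiffAt ℝ 2 a (t s) := fun s hs =>
    ha.contDiffAt (hI.mem_nhds (htI s (hin s hs)))
  set R : ℝ → ℝ := fun T => deriv Ω T / Ω T with hR
  set w : ℝ → ℝ := fun s => R (x s) * P s with hw
  set b : ℝ → ℝ := fun s => G' s / (2 * G s) with hb
  set h : ℝ → ℝ := fun s => deriv a s / a s with hh
  have hC : 0 ≤ C := by
    obtain ⟨s, hs⟩ : (Ioo ε 0).Nonempty := nonempty_Ioo.2 hε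
    exact (abs_nonneg _).trans (hP' s hs)
  have hRtop : Tendsto (fun s => R (x s)) (𝓝[<] 0) atTop := hΩ.tendsto_logDeriv.comp hxlt
  have hΩtop : Tendsto (fun s => Ω (x s)) (𝓝[<] 0) atTop := hΩ.1.comp hxlt
  have hLtop : Tendsto (fun s => bigL Ω (x s)) (𝓝[<] 0) atTop :=
    (EReal.tendsto_coe_nhds_top_iff.1 hΩ.2.2.1).comp hxlt
  have hwtop : Tendsto w (𝓝[<] 0) atTop := by
    refine tendsto_atTop_mono' _ ?_ (hRtop.atTop_mul_const hp₀)
    filter_upwards [Ioo_mem_nhdsLT he0] with s hs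
    have := (hxr s hs).2
    exact mul_le_mul_of_nonneg_left (hPlow s (hin s hs)) (div_pos this.2 this.1).le
  -- Half the logarithmic derivative of Ω² G = c a² in s; on the right, dt/ds = Ω turns ȧ/a into HΩ.
  -- Substituting for c from the relation itself removes the constant.
  have hlin : ∀ s ∈ Ioo e 0, h (t s) * Ω (x s) = w s + b s := by
    intro s hs
    have h0 := (hxr s hs).2.1
    have hG0' := hG0 s (hin s hs)
    have ha0' := ha0 _ (htI s (hin s hs))
    have d1 : HasDerivAt (fun s => Ω (x s) ^ 2 * G s) _ s :=
      ((((hxr s hs).1.differentiableAt (by norm_num)).hasDerivAt.comp s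
        (hx s (hin s hs))).pow 2).mul (hG s (hin s hs))
    have d2 : HasDerivAt (fun s => c * a (t s) ^ 2) _ s :=
      ((((hat s hs).differentiableAt (by norm_num)).hasDerivAt.comp s
        (ht s (hin s hs))).pow 2).const_mul c
    have heq : (fun s => Ω (x s) ^ 2 * G s) =ᶠ[𝓝 s] fun s => c * a (t s) ^ 2 := by
      filter_upwards [Ioo_mem_nhds hs.1 hs.2] with y hy using hrel y (hin y hy)
    have := d1.unique (d2.congr_of_eventuallyEq heq)
    have hr := hrel s (hin s hs)
    simp only [Function.comp_apply, Pi.pow_apply, Nat.cast_ofNat, Nat.add_one_sub_one, pow_one]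
      at this
    simp only [hh, hw, hb, hR]
    have hcc : c = Ω (x s) ^ 2 * G s / a (t s) ^ 2 := by
      rw [eq_div_iff (by positivity), hr]
    rw [hcc] at this
    field_simp at this ⊢
    linear_combination -this
  have hderR : ∀ s ∈ Ioo e 0,
      HasDerivAt (fun s => R (x s)) (R (x s) ^ 2 * (bigL Ω (x s) - 1) * P s) s := fun s hs =>
    (hasDerivAt_logDeriv (hxr s hs).1 (hxr s hs).2.1 (hxr s hs).2.2).comp s (hx s (hin s hs))
  set b' : ℝ → ℝ := fun s => (G'' s * (2 * G s) - G' s * (2 * G' s)) / (2 * G s) ^ 2 with hb'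
  have hderb : ∀ s ∈ Ioo e 0, HasDerivAt b (b' s) s := fun s hs =>
    (hG' s (hin s hs)).div ((hG s (hin s hs)).const_mul 2)
      (mul_pos two_pos (hG0 s (hin s hs))).ne'
  have hbb : ∀ s ∈ Ioo e 0, |b s| ≤ C := by
    intro s hs
    have hG0' := hG0 s (hin s hs)
    rw [hb, abs_div, div_le_iff₀ (by positivity), abs_of_pos (by positivity : 0 < 2 * G s)]
    nlinarith [hGb s (hin s hs)]
  -- Since b = G'/(2G), its derivative is G''/(2G) - 2b², and both terms are controlled by the
  -- bounds relative to G.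
  have hbb' : ∀ s ∈ Ioo e 0, |b' s| ≤ C + C ^ 2 := by
    intro s hs
    have hG0' := hG0 s (hin s hs)
    have : b' s = G'' s / (2 * G s) - 2 * b s ^ 2 := by
      simp only [hb', hb]; field_simp
    have h1 : |G'' s / (2 * G s)| ≤ C := by
      rw [abs_div, div_le_iff₀ (by positivity), abs_of_pos (by positivity : 0 < 2 * G s)]
      nlinarith [hGb' s (hin s hs)]
    have h2 := sq_le_sq' (abs_le.1 (hbb s hs)).1 (abs_le.1 (hbb s hs)).2
    have h3 : |b s| ≤ C / 2 := by
      rw [hb, abs_div, div_le_iff₀ (by positivity), abs_of_pos (by positivity : 0 < 2 * G s)]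
      linarith [hGb s (hin s hs)]
    have h4 := sq_le_sq' (abs_le.1 h3).1 (abs_le.1 h3).2
    rw [this, abs_le]
    rw [abs_le] at h1
    constructor <;> nlinarith [sq_nonneg (b s)]
  -- Differentiate HΩ = w + b once more. The left side gives Ḣ Ω² + (HΩ) w, the right side w²(L - 1)
  -- + w P'/P + b' by the Riccati equation. Dividing by (HΩ)² leaves Ḣ/H² = ä a/ȧ² - 1.
  have hratio : ∀ s ∈ Ioo e 0, 0 < w s + b s →
      deriv (deriv a) (t s) * a (t s) / deriv a (t s) ^ 2 =
      1 + (w s ^ 2 * (bigL Ω (x s) - 1) + w s * (P' s / P s) + b' s - (w s + b s) * w s) /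
        (w s + b s) ^ 2 := by
    intro s hs hwb
    have h0 := (hxr s hs).2.1
    have hP0 : 0 < P s := hp₀.trans_le (hPlow s (hin s hs))
    have ha0' := ha0 _ (htI s (hin s hs))
    have d1 : HasDerivAt (fun s => h (t s) * Ω (x s)) _ s :=
      ((((((hat s hs).derivWithin (m := 1) (by norm_num)).differentiableAt
        (by norm_num)).hasDerivAt.div ((hat s hs).differentiableAt (by norm_num)).hasDerivAt
          ha0'.ne').comp s (ht s (hin s hs)))).mul
        (((hxr s hs).1.differentiableAt (by norm_num)).hasDerivAt.comp s (hx s (hin s hs)))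
    have d2 : HasDerivAt (fun s => w s + b s) _ s :=
      ((hderR s hs).mul (hP s (hin s hs))).add (hderb s hs)
    have heq : (fun s => h (t s) * Ω (x s)) =ᶠ[𝓝 s] fun s => w s + b s := by
      filter_upwards [Ioo_mem_nhds hs.1 hs.2] with y hy using hlin y hy
    have := d1.unique (d2.congr_of_eventuallyEq heq)
    have hl := hlin s hs
    have hda : deriv a (t s) ≠ 0 := by
      intro h0
      simp only [hh, h0] at hl
      rw [zero_div, zero_mul] at hl
      exact hwb.ne hl
    have hdΩ : deriv Ω (x s) = R (x s) * Ω (x s) := by simp only [hR]; field_simp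
    simp only [Function.comp_apply, Pi.div_apply] at this
    rw [← sub_eq_iff_eq_add', eq_div_iff (by positivity), ← hl]
    simp only [hh, hw] at this ⊢
    rw [hdΩ] at this
    field_simp at this ⊢
    linear_combination this
  constructor
  -- Grönwall: G' ≥ -CG makes G exp(Cs) nondecreasing, so G ≥ m > 0 near 0 and a ≥ Ω √(m/c).
  · have hmono : MonotoneOn (fun s => G s * Real.exp (C * s)) (Ioo e 0) := by
      have hder : ∀ s ∈ Ioo e 0, HasDerivAt (fun s => G s * Real.exp (C * s))
          ((G' s + C * G s) * Real.exp (C * s)) s := fun s hs => by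
        refine ((hG s (hin s hs)).mul ((hasDerivAt_id s).const_mul C).exp).congr_deriv ?_
        simp only [id]; ring
      refine monotoneOn_of_deriv_nonneg (convex_Ioo _ _)
        (fun s hs => (hder s hs).continuousAt.continuousWithinAt)
        (fun s hs => (hder s (interior_subset hs)).differentiableAt.differentiableWithinAt)
        fun s hs => ?_
      rw [(hder s (interior_subset hs)).deriv]
      have := (abs_le.1 (hGb s (hin s (interior_subset hs)))).1
      exact mul_nonneg (by linarith) (Real.exp_pos _).le
    obtain ⟨s₀, hs₀⟩ : (Ioo e 0).Nonempty := nonempty_Ioo.2 he0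
    set m := G s₀ * Real.exp (C * s₀) with hm
    have hm0 : 0 < m := mul_pos (hG0 _ (hin _ hs₀)) (Real.exp_pos _)
    refine tendsto_atTop_mono' _ ?_ (hΩtop.atTop_mul_const (Real.sqrt_pos.2 (div_pos hm0 hc)))
    filter_upwards [Ioo_mem_nhdsLT hs₀.2] with s hs
    have hs' : s ∈ Ioo e 0 := ⟨hs₀.1.trans hs.1, hs.2⟩
    have h1 : m ≤ G s := by
      refine (hmono hs₀ hs' hs.1.le).trans ?_
      have : Real.exp (C * s) ≤ 1 := Real.exp_le_one_iff.2 (by nlinarith [hs.2])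
      nlinarith [hG0 s (hin s hs')]
    refine (pow_le_pow_iff_left₀ (mul_pos (hxr s hs').2.1 (Real.sqrt_pos.2 (div_pos hm0 hc))).le
      (ha0 _ (htI s (hin s hs'))).le two_ne_zero).1 ?_
    rw [mul_pow, Real.sq_sqrt (div_pos hm0 hc).le, mul_div_assoc', div_le_iff₀ hc,
      mul_comm (a (t s) ^ 2), ← hrel s (hin s hs')]
    gcongr
  -- One constant serving for P'/P (bounded by C/p₀), for b (by C) and for b' (by C + C²).
  · refine (tendsto_ratio_asymptotics (C := C / p₀ + C + C ^ 2) hwtop hLtop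
      (κ := fun s => P' s / P s) (b := b) (b' := b') ?_ ?_ ?_).congr' ?_
    · filter_upwards [Ioo_mem_nhdsLT he0] with s hs
      have h1 := hPlow s (hin s hs)
      have : |P' s / P s| ≤ C / p₀ := by
        rw [abs_div, abs_of_pos (hp₀.trans_le h1)]
        exact div_le_div₀ hC (hP' s (hin s hs)) hp₀ h1
      nlinarith
    · filter_upwards [Ioo_mem_nhdsLT he0] with s hs
      have := hbb s hs
      have : 0 ≤ C / p₀ := by positivity
      nlinarith
    · filter_upwards [Ioo_mem_nhdsLT he0] with s hs
      have := hbb' s hs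
      have : 0 ≤ C / p₀ := by positivity
      nlinarith
    · filter_upwards [Ioo_mem_nhdsLT he0, hwtop.eventually_gt_atTop C] with s hs hs'
      refine (hratio s hs ?_).symm
      have := (abs_le.1 (hbb s hs)).1
      linarith

/-- A limit along a continuous curve that runs to the upper end of an interval is a limit at that
end. -/
theorem tendsto_atTop_of_tendsto_comp {I : Set ℝ} {t f : ℝ → ℝ} {e : ℝ} (he : e < 0)
    (htI : ∀ s ∈ Ioo e 0, t s ∈ I) (htc : ContinuousOn t (Ioo e 0))
    (htm : MonotoneOn t (Ioo e 0)) (hub : ∀ r ∈ I, ∃ s ∈ Ioo e 0, r ≤ t s)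
    (hf : Tendsto (fun s => f (t s)) (𝓝[<] 0) atTop) :
    Tendsto (fun r : I => f r) atTop atTop := by
  rw [tendsto_atTop]
  intro M
  obtain ⟨e', he', hM⟩ := mem_nhdsLT_iff_exists_Ioo_subset.1 (hf.eventually_ge_atTop M)
  obtain ⟨s₀, hs₀⟩ := nonempty_Ioo.2 (max_lt he he' : max e e' < 0)
  have hs₀' : s₀ ∈ Ioo e 0 := ⟨(le_max_left _ _).trans_lt hs₀.1, hs₀.2⟩
  filter_upwards [eventually_ge_atTop (⟨t s₀, htI _ hs₀'⟩ : I)] with r hr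
  obtain ⟨s₁, hs₁, hr₁⟩ := hub r r.2
  have hr' : t s₀ ≤ r := hr
  rcases le_total s₁ s₀ with h | h
  · rw [le_antisymm (hr₁.trans (htm hs₁ hs₀' h)) hr']
    exact hM ⟨(le_max_right _ _).trans_lt hs₀.1, hs₀.2⟩
  · have hsub : Icc s₀ s₁ ⊆ Ioo e 0 := fun z hz => ⟨hs₀'.1.trans_le hz.1, hz.2.trans_lt hs₁.2⟩
    obtain ⟨s, hs, hsr⟩ := intermediate_value_Icc h (htc.mono hsub) ⟨hr', hr₁⟩
    rw [← hsr]
    exact hM ⟨((le_max_right _ _).trans_lt hs₀.1).trans_le hs.1, (hsub hs).2⟩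

/-! ### Evolution of bilinear forms and comoving vectors along a flow -/

section Drag

variable {E V W : Type*} [NormedAddCommGroup E] [NormedSpace ℝ E] [NormedAddCommGroup V]
  [NormedSpace ℝ V] [NormedAddCommGroup W] [NormedSpace ℝ W]

theorem hasDerivAt_comp_flow {Q : E → V} {u : E → E} {y : ℝ → E} {s : ℝ}
    (hQ : DifferentiableAt ℝ Q (y s)) (hy : HasDerivAt y (u (y s)) s) :
    HasDerivAt (fun s => Q (y s)) (fderiv ℝ Q (y s) (u (y s))) s :=
  hQ.hasFDerivAt.comp_hasDerivAt s hy

theorem contDiffAt_fderiv_apply {Q : E → V} {u : E → E} {y : E} {k m : WithTop ℕ∞}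
    (hkm : k + 1 ≤ m) (hQ : ContDiffAt ℝ m Q y) (hu : ContDiffAt ℝ k u y) :
    ContDiffAt ℝ k (fun x => fderiv ℝ Q x (u x)) y :=
  (hQ.fderiv_right hkm).clm_apply hu

theorem hasDerivAt_apply {Q : ℝ → E →L[ℝ] V} {u : ℝ → E} {u' : E} {A : E →L[ℝ] V} {s : ℝ}
    (hQ : HasDerivAt Q A s) (hu : HasDerivAt u u' s) :
    HasDerivAt (fun s => Q s (u s)) (A (u s) + Q s u') s :=
  hQ.clm_apply hu

theorem contDiffAt_apply {Q : E → E →L[ℝ] V} {u : E → E} {y : E} {k : WithTop ℕ∞}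
    (hQ : ContDiffAt ℝ k Q y) (hu : ContDiffAt ℝ k u y) :
    ContDiffAt ℝ k (fun x => Q x (u x)) y :=
  hQ.clm_apply hu

theorem contDiffAt_compL {Q : E → E →L[ℝ] V} {K : E → E →L[ℝ] E} {y : E} {k : WithTop ℕ∞}
    (hQ : ContDiffAt ℝ k Q y) (hK : ContDiffAt ℝ k K y) :
    ContDiffAt ℝ k (fun x => (Q x).comp (K x)) y :=
  hQ.clm_comp hK

theorem contDiffAt_clm {Q : E → V} {y : E} {k : WithTop ℕ∞} (L : V →L[ℝ] W)
    (hQ : ContDiffAt ℝ k Q y) : ContDiffAt ℝ k (fun x => L (Q x)) y :=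
  L.contDiff.comp_contDiffAt y hQ

theorem contDiffAt_add {P Q : E → V} {y : E} {k : WithTop ℕ∞}
    (hP : ContDiffAt ℝ k P y) (hQ : ContDiffAt ℝ k Q y) :
    ContDiffAt ℝ k (fun x => P x + Q x) y :=
  hP.add hQ

theorem continuousAt_apply₂ {Q : E → E →L[ℝ] V} {y w : E} (hQ : ContinuousAt Q y) :
    ContinuousAt (fun z : E × E => Q z.1 z.2) (y, w) :=
  (ContinuousAt.comp (f := Prod.fst) (x := (y, w)) hQ continuousAt_fst).clm_apply continuousAt_snd

theorem contDiffAt_of_le {Q : E → V} {y : E} {k m : WithTop ℕ∞} (hQ : ContDiffAt ℝ m Q y)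
    (hkm : k ≤ m) : ContDiffAt ℝ k Q y :=
  hQ.of_le hkm

theorem eventually_norm_le {E V : Type*} [TopologicalSpace E] [NormedAddCommGroup V] {Q : E → V}
    {y : E} (hQ : ContinuousAt Q y) :
    ∃ C, ∀ᶠ x in 𝓝 y, ‖Q x‖ ≤ C :=
  ⟨‖Q y‖ + 1, (hQ.norm.eventually_lt continuousAt_const (lt_add_one _)).mono fun _ h => h.le⟩

theorem differentiableAt_of_contDiffAt {Q : E → V} {y : E} {k : WithTop ℕ∞}
    (hQ : ContDiffAt ℝ k Q y) (hk : k ≠ 0) : DifferentiableAt ℝ Q y :=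
  hQ.differentiableAt hk

variable (E) in
/-- Exchange of the arguments of a bilinear form. -/
noncomputable def flipForm : (E →L[ℝ] E →L[ℝ] ℝ) →L[ℝ] E →L[ℝ] E →L[ℝ] ℝ :=
  (ContinuousLinearMap.flipₗᵢ ℝ E E ℝ : (E →L[ℝ] E →L[ℝ] ℝ) ≃L[ℝ] E →L[ℝ] E →L[ℝ] ℝ)

theorem flipForm_apply (q : E →L[ℝ] E →L[ℝ] ℝ) (v w : E) : flipForm E q v w = q w v :=
  rfl

/-- The derivative of the bilinear form `Q` along the flow of `u`, on vectors dragged by `K`. -/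
noncomputable def dragForm (Q : E → E →L[ℝ] E →L[ℝ] ℝ) (u : E → E) (K : E → E →L[ℝ] E) (y : E) :
    E →L[ℝ] E →L[ℝ] ℝ :=
  fderiv ℝ Q y (u y) + ((Q y).comp (K y) + flipForm E ((flipForm E (Q y)).comp (K y)))

-- Each drag costs one derivative of Q. A C² metric can therefore be dragged twice with a continuous
-- result, exactly what G'' requires.
set_option synthInstance.maxHeartbeats 400000 in
theorem contDiffAt_dragForm {Q : E → E →L[ℝ] E →L[ℝ] ℝ} {u : E → E} {K : E → E →L[ℝ] E} {y : E}
    {k m : WithTop ℕ∞} (hkm : k + 1 ≤ m)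
    (hQ : ContDiffAt ℝ m Q y) (hu : ContDiffAt ℝ k u y) (hK : ContDiffAt ℝ k K y) :
    ContDiffAt ℝ k (dragForm Q u K) y := by
  have hQk : ContDiffAt ℝ k Q y :=
    contDiffAt_of_le (V := E →L[ℝ] E →L[ℝ] ℝ) hQ (le_self_add.trans hkm)
  have h1 := contDiffAt_fderiv_apply (V := E →L[ℝ] E →L[ℝ] ℝ) hkm hQ hu
  have h2 := contDiffAt_compL (V := E →L[ℝ] ℝ) hQk hK
  have h3 := contDiffAt_clm (V := E →L[ℝ] E →L[ℝ] ℝ) (W := E →L[ℝ] E →L[ℝ] ℝ) (flipForm E) hQk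
  have h4 := contDiffAt_compL (V := E →L[ℝ] ℝ) h3 hK
  have h5 := contDiffAt_clm (V := E →L[ℝ] E →L[ℝ] ℝ) (W := E →L[ℝ] E →L[ℝ] ℝ) (flipForm E) h4
  exact contDiffAt_add (V := E →L[ℝ] E →L[ℝ] ℝ) h1
    (contDiffAt_add (V := E →L[ℝ] E →L[ℝ] ℝ) h2 h5)

/-- Leibniz rule, with K inserted in each slot in turn. The outcome is again a form depending on the
position only, evaluated on (w, w), so the lemma can be iterated: it gives G' from G and then G''
from G'. -/
theorem hasDerivAt_dragForm {Q : E → E →L[ℝ] E →L[ℝ] ℝ} {u : E → E} {K : E → E →L[ℝ] E}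
    {y w : ℝ → E} {s : ℝ} (hQ : DifferentiableAt ℝ Q (y s)) (hy : HasDerivAt y (u (y s)) s)
    (hw : HasDerivAt w (K (y s) (w s)) s) :
    HasDerivAt (fun s => Q (y s) (w s) (w s)) (dragForm Q u K (y s) (w s) (w s)) s := by
  have h1 := hasDerivAt_comp_flow (V := E →L[ℝ] E →L[ℝ] ℝ) hQ hy
  refine (hasDerivAt_apply (V := ℝ) (hasDerivAt_apply (V := E →L[ℝ] ℝ) h1 hw) hw).congr_deriv ?_
  simp only [dragForm, add_apply, ContinuousLinearMap.comp_apply, flipForm_apply]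
  ring

/-- The acceleration one-form of `u` for the metric `g`. -/
noncomputable def accelForm (g : E → E →L[ℝ] E →L[ℝ] ℝ) (u : E → E) (y : E) : E →L[ℝ] ℝ :=
  fderiv ℝ g y (u y) (u y) + (g y (fderiv ℝ u y (u y)) + (g y (u y)).comp (fderiv ℝ u y))

/-- The generator of the evolution of comoving vectors orthogonal to `u`. -/
noncomputable def comovingGen (g : E → E →L[ℝ] E →L[ℝ] ℝ) (u : E → E) (y : E) : E →L[ℝ] E :=
  fderiv ℝ u y + (accelForm g u y).smulRight (u y)

theorem contDiffAt_comovingGen {g : E → E →L[ℝ] E →L[ℝ] ℝ} {u : E → E} {y : E}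
    (hg : ContDiffAt ℝ 2 g y) (hu : ContDiffAt ℝ 2 u y) :
    ContDiffAt ℝ 1 (comovingGen g u) y := by
  have h12 : (1 : WithTop ℕ∞) + 1 ≤ 2 := by norm_num
  have hg1 : ContDiffAt ℝ 1 g y :=
    contDiffAt_of_le (V := E →L[ℝ] E →L[ℝ] ℝ) hg (by norm_num)
  have hu1 : ContDiffAt ℝ 1 u y := hu.of_le (by norm_num)
  have hdu : ContDiffAt ℝ 1 (fderiv ℝ u) y := hu.fderiv_right h12
  have hB : ContDiffAt ℝ 1 (accelForm g u) y :=
    contDiffAt_add (V := E →L[ℝ] ℝ)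
      (contDiffAt_apply (V := E →L[ℝ] ℝ)
        (contDiffAt_fderiv_apply (V := E →L[ℝ] E →L[ℝ] ℝ) h12 hg hu1) hu1)
      (contDiffAt_add (V := E →L[ℝ] ℝ)
        (contDiffAt_apply (V := E →L[ℝ] ℝ) hg1 (contDiffAt_fderiv_apply h12 hu hu1))
        (contDiffAt_compL (contDiffAt_apply (V := E →L[ℝ] ℝ) hg1 hu1) hdu))
  exact contDiffAt_add hdu (hB.smulRight hu1)

/-- The coefficient β involves the derivative of log Ω and could blow up at T = 0. Differentiating
g(u, w) = 0 along the curve and using g(u, u) = -1 shows that β is the acceleration form applied to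
w, which is regular there. -/
theorem hasDerivAt_comovingGen {g : E → E →L[ℝ] E →L[ℝ] ℝ} {u : E → E} {y w : ℝ → E} {s β : ℝ}
    (hg : DifferentiableAt ℝ g (y s)) (hu : DifferentiableAt ℝ u (y s))
    (hy : HasDerivAt y (u (y s)) s) (hw : HasDerivAt w (fderiv ℝ u (y s) (w s) + β • u (y s)) s)
    (hunit : g (y s) (u (y s)) (u (y s)) = -1)
    (horth : ∀ᶠ r in 𝓝 s, g (y r) (u (y r)) (w r) = 0) :
    HasDerivAt w (comovingGen g u (y s) (w s)) s := by
  have h1 := hasDerivAt_comp_flow (V := E →L[ℝ] E →L[ℝ] ℝ) hg hy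
  have h2 := hasDerivAt_comp_flow hu hy
  have h3 := (hasDerivAt_apply (V := ℝ) (hasDerivAt_apply (V := E →L[ℝ] ℝ) h1 h2) hw).unique
    ((hasDerivAt_const s (0 : ℝ)).congr_of_eventuallyEq horth)
  have hβ : β = accelForm g u (y s) (w s) := by
    simp only [map_add, map_smul, hunit, add_apply, smul_eq_mul] at h3
    simp only [accelForm, add_apply, ContinuousLinearMap.comp_apply]
    linarith
  refine hw.congr_deriv ?_
  simp [comovingGen, hβ]

/-- The orthogonal complement of a unit timelike vector field is uniformly positive definite. -/
theorem eventually_le_of_orthogonal [FiniteDimensional ℝ E] {g : E → E →L[ℝ] E →L[ℝ] ℝ}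
    {u : E → E} {y₀ : E}
    (hg : ContinuousAt g y₀) (hu : ContinuousAt u y₀) (hsymm : ∀ v w, g y₀ v w = g y₀ w v)
    (hunit : g y₀ (u y₀) (u y₀) = -1)
    (hpos : ∀ w, g y₀ (u y₀) w = 0 → w ≠ 0 → 0 < g y₀ w w) :
    ∃ c > 0, ∀ᶠ y in 𝓝 y₀, ∀ w, g y (u y) w = 0 → c * ‖w‖ ^ 2 ≤ g y w w := by
  -- The form q reverses the sign of g along u: writing w = w⊥ - a u with a = g(u, w) gives g(w, w)
  -- + 2a² = g(w⊥, w⊥) + a². It is positive definite at y₀ and agrees with g on the complement of u.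
  set q : E × E → ℝ := fun z => g z.1 z.2 z.2 + 2 * (g z.1 (u z.1) z.2) ^ 2 with hq
  have hqc : ∀ w, ContinuousAt q (y₀, w) := by
    intro w
    have h1 : ContinuousAt (fun z : E × E => g z.1 z.2 z.2) (y₀, w) :=
      (continuousAt_apply₂ (V := E →L[ℝ] ℝ) hg).clm_apply continuousAt_snd
    have h2 : ContinuousAt (fun z : E × E => g z.1 (u z.1)) (y₀, w) :=
      ContinuousAt.comp (f := fun z : E × E => (z.1, u z.1)) (x := (y₀, w))
        (continuousAt_apply₂ (V := E →L[ℝ] ℝ) hg)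
        (continuousAt_fst.prodMk (ContinuousAt.comp (x := (y₀, w)) hu continuousAt_fst))
    exact h1.add (((h2.clm_apply continuousAt_snd).pow 2).const_mul 2)
  have hqpos : ∀ w, w ≠ 0 → 0 < q (y₀, w) := by
    intro w hw
    simp only [hq]
    set a := g y₀ (u y₀) w with ha
    have h1 : g y₀ (u y₀) (w + a • u y₀) = 0 := by
      simp [hunit, ← ha]
    have h2 : g y₀ (w + a • u y₀) (w + a • u y₀) = g y₀ w w + a * a := by
      simp only [map_add, map_smul, add_apply, smul_apply,
        hunit, ← ha, hsymm w (u y₀), smul_eq_mul]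
      ring
    by_cases ha0 : a = 0
    · rw [ha0]; simpa using hpos w ha0 hw
    · by_cases hz : w + a • u y₀ = 0
      · rw [hz, map_zero] at h2
        nlinarith [mul_self_pos.2 ha0]
      · have := hpos _ h1 hz
        nlinarith [mul_self_pos.2 ha0]
  have hu0 : u y₀ ≠ 0 := fun h => by simp [h] at hunit
  have : Nontrivial E := ⟨u y₀, 0, hu0⟩
  obtain ⟨x, hx, hmin⟩ := (isCompact_sphere (0 : E) 1).exists_isMinOn
    (NormedSpace.sphere_nonempty.2 zero_le_one) (f := fun w => q (y₀, w))
    (fun w _ => (ContinuousAt.comp (f := fun w => (y₀, w)) (x := w) (hqc w)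
      (by fun_prop)).continuousWithinAt)
  have hx0 : x ≠ 0 := by rintro rfl; simp at hx
  set c := q (y₀, x) with hc
  have hc0 : 0 < c := hqpos x hx0
  refine ⟨c / 2, by positivity, ?_⟩
  -- Compactness of the unit sphere makes the neighbourhood of y₀ independent of the direction w;
  -- halving the minimum leaves room for continuity.
  have := (isCompact_sphere (0 : E) 1).eventually_forall_of_forall_eventually
    (x₀ := y₀) (P := fun y w => c / 2 < q (y, w)) fun w hw =>
      (hqc w).eventually_const_lt ((half_lt_self hc0).trans_le (hmin hw))
  filter_upwards [this] with y hy w hw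
  by_cases hw0 : w = 0
  · simp [hw0]
  have hn : 0 < ‖w‖ := norm_pos_iff.2 hw0
  have h1 := hy (‖w‖⁻¹ • w) (by simp [norm_smul, hn.ne'])
  simp only [hq, map_smul, smul_apply, smul_eq_mul, hw] at h1
  calc c / 2 * ‖w‖ ^ 2 ≤ (‖w‖⁻¹ * (‖w‖⁻¹ * g y w w) + 2 * (‖w‖⁻¹ * 0) ^ 2) * ‖w‖ ^ 2 := by gcongr
    _ = g y w w := by field_simp; ring

set_option synthInstance.maxHeartbeats 400000 in
theorem eventually_abs_le {Q : E → E →L[ℝ] E →L[ℝ] ℝ} {y₀ : E} (hQ : ContinuousAt Q y₀) :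
    ∃ C, ∀ᶠ y in 𝓝 y₀, ∀ w, |Q y w w| ≤ C * ‖w‖ ^ 2 := by
  obtain ⟨C, hC⟩ := eventually_norm_le (V := E →L[ℝ] E →L[ℝ] ℝ) hQ
  refine ⟨C, hC.mono fun y hy w => ?_⟩
  have h0 : |Q y w w| ≤ ‖Q y‖ * ‖w‖ * ‖w‖ := ContinuousLinearMap.le_opNorm₂ (Q y) w w
  calc |Q y w w| ≤ ‖Q y‖ * ‖w‖ * ‖w‖ := h0
    _ ≤ C * ‖w‖ * ‖w‖ := by
      exact mul_le_mul_of_nonneg_right (mul_le_mul_of_nonneg_right hy (norm_nonneg w))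
        (norm_nonneg w)
    _ = _ := by ring

end Drag

section Drag
variable {E : Type*} [NormedAddCommGroup E] [NormedSpace ℝ E]

set_option synthInstance.maxHeartbeats 400000 in
theorem eventually_differentiableAt_form {Q : E → E →L[ℝ] E →L[ℝ] ℝ} {y₀ : E}
    (hQ : ContDiffAt ℝ 1 Q y₀) : ∀ᶠ y in 𝓝 y₀, DifferentiableAt ℝ Q y := by
  have h := ContDiffAt.eventually (F := E →L[ℝ] E →L[ℝ] ℝ) hQ (by simp)
  exact h.mono fun y hy => differentiableAt_of_contDiffAt (V := E →L[ℝ] E →L[ℝ] ℝ) hy (by simp)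

set_option synthInstance.maxHeartbeats 400000 in
theorem continuousAt_of_contDiffAt_form {Q : E → E →L[ℝ] E →L[ℝ] ℝ} {y₀ : E} {k : WithTop ℕ∞}
    (hQ : ContDiffAt ℝ k Q y₀) : ContinuousAt Q y₀ :=
  ContDiffAt.continuousAt (F := E →L[ℝ] E →L[ℝ] ℝ) hQ

set_option synthInstance.maxHeartbeats 400000 in
/-- The behaviour of the scale factor along the fluid line through a regular point `y₀` of the
hypersurface `T = 0`, in a coordinate chart. -/
theorem FutureFactor.tendsto_along_fluid [FiniteDimensional ℝ E] {Ω : ℝ → ℝ}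
    (hΩ : FutureFactor Ω ⊤) {I : Set ℝ}
    (hI : IsOpen I) {a : ℝ → ℝ} (ha : ContDiffOn ℝ 2 a I) (ha0 : ∀ t ∈ I, 0 < a t)
    {g : E → E →L[ℝ] E →L[ℝ] ℝ} {u : E → E} {T : E → ℝ} {y₀ : E}
    (hg : ContDiffAt ℝ 2 g y₀) (hu : ContDiffAt ℝ 2 u y₀) (hT : ContDiffAt ℝ 2 T y₀)
    (hT0 : T y₀ = 0) (hTu : 0 < fderiv ℝ T y₀ (u y₀)) (hsymm : ∀ v w, g y₀ v w = g y₀ w v)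
    (hunit : ∀ᶠ y in 𝓝 y₀, g y (u y) (u y) = -1)
    (hpos : ∀ w, g y₀ (u y₀) w = 0 → w ≠ 0 → 0 < g y₀ w w)
    {y w : ℝ → E} {t β : ℝ → ℝ} {ε c : ℝ} (hε : ε < 0) (hc : 0 < c) (hy0 : y 0 = y₀)
    (hy : ∀ᶠ s in 𝓝 0, HasDerivAt y (u (y s)) s) (hTy : ∀ s ∈ Ioo ε 0, T (y s) < 0)
    (htI : ∀ s ∈ Ioo ε 0, t s ∈ I) (ht : ∀ s ∈ Ioo ε 0, HasDerivAt t (Ω (T (y s))) s)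
    (hw : ∀ s ∈ Ioo ε 0, HasDerivAt w (fderiv ℝ u (y s) (w s) + β s • u (y s)) s)
    (hw0 : ∀ s ∈ Ioo ε 0, w s ≠ 0) (horth : ∀ s ∈ Ioo ε 0, g (y s) (u (y s)) (w s) = 0)
    (hrel : ∀ s ∈ Ioo ε 0, Ω (T (y s)) ^ 2 * g (y s) (w s) (w s) = c * a (t s) ^ 2) :
    Tendsto (fun s => a (t s)) (𝓝[<] 0) atTop ∧
      Tendsto (fun s => deriv (deriv a) (t s) * a (t s) / deriv a (t s) ^ 2) (𝓝[<] 0) atTop := by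
  have hu1 : ContDiffAt ℝ 1 u y₀ := hu.of_le (by norm_num)
  have hg1 : ContDiffAt ℝ 1 g y₀ :=
    contDiffAt_of_le (V := E →L[ℝ] E →L[ℝ] ℝ) hg (by norm_num)
  have hgc : ContinuousAt g y₀ := continuousAt_of_contDiffAt_form hg
  -- Below, q and r are the forms with G' = q(w, w) and G'' = r(w, w); p and p' are dT(u) and its
  -- derivative along the flow. From C² data, q and p are C¹ while r and p' are continuous.
  set K := comovingGen g u with hK
  have hK1 : ContDiffAt ℝ 1 K y₀ := contDiffAt_comovingGen hg hu
  set q := dragForm g u K with hq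
  have hq1 : ContDiffAt ℝ 1 q y₀ := contDiffAt_dragForm (by norm_num) hg hu1 hK1
  set r := dragForm q u K with hr
  have hr0 : ContDiffAt ℝ 0 r y₀ := contDiffAt_dragForm (m := 1) (by norm_num) hq1
    (hu1.of_le (by norm_num)) (hK1.of_le (by norm_num))
  set p : E → ℝ := fun x => fderiv ℝ T x (u x) with hp
  have hp1 : ContDiffAt ℝ 1 p y₀ := contDiffAt_fderiv_apply (by norm_num) hT hu1
  set p' : E → ℝ := fun x => fderiv ℝ p x (u x) with hp'
  have hp0 : ContDiffAt ℝ 0 p' y₀ :=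
    contDiffAt_fderiv_apply (m := 1) (by norm_num) hp1 (hu1.of_le (by norm_num))
  obtain ⟨c₀, hc₀, hlow⟩ := eventually_le_of_orthogonal hgc hu.continuousAt hsymm
    hunit.self_of_nhds hpos
  obtain ⟨C₁, hC₁⟩ := eventually_abs_le (continuousAt_of_contDiffAt_form hq1)
  obtain ⟨C₂, hC₂⟩ := eventually_abs_le (continuousAt_of_contDiffAt_form hr0)
  obtain ⟨C₃, hC₃⟩ := eventually_norm_le hp0.continuousAt
  have hyc : ContinuousAt y 0 := hy.self_of_nhds.continuousAt
  have hyt : Tendsto y (𝓝[<] 0) (𝓝 y₀) := hy0 ▸ hyc.tendsto.mono_left nhdsWithin_le_nhds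
  have hplow : ∀ᶠ y in 𝓝 y₀, p y₀ / 2 < p y :=
    hp1.continuousAt.eventually_const_lt (half_lt_self hTu)
  have hev := hyt.eventually ((((((((hlow.and hC₁).and hC₂).and hC₃).and hplow).and
    (eventually_differentiableAt_form hg1)).and (eventually_differentiableAt_form hq1)).and
    ((hu1.eventually (by simp)).and ((hT.eventually (by simp)).and
      (hp1.eventually (by simp))))).and hunit)
  obtain ⟨e, he, hsub⟩ := mem_nhdsLT_iff_exists_Ioo_subset.1
    ((hev.and (hy.filter_mono nhdsWithin_le_nhds)).and (Ioo_mem_nhdsLT hε))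
  have hall : ∀ s ∈ Ioo e 0, _ := fun s hs => hsub hs
  clear hev hsub
  set C := max (max (C₁ / c₀) (C₂ / c₀)) C₃ with hC
  have hw' : ∀ s ∈ Ioo e 0, HasDerivAt w (K (y s) (w s)) s := by
    intro s hs
    obtain ⟨⟨⟨⟨⟨⟨-, h1⟩, -⟩, h2, -⟩, h3⟩, h4⟩, h5⟩ := hall s hs
    refine hasDerivAt_comovingGen h1 (h2.differentiableAt (by simp)) h4 (hw s h5) h3 ?_
    filter_upwards [Ioo_mem_nhds h5.1 h5.2] with r hr using horth r hr
  -- The size of w is not controlled, but G ≥ c₀ ‖w‖² converts a bound by D ‖w‖² into one by (D/c₀)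
  -- G; only ratios to G matter.
  have hbound : ∀ {D n A G : ℝ} {B : ℝ}, |B| ≤ D * n ^ 2 → c₀ * n ^ 2 ≤ G → D / c₀ ≤ A →
      0 ≤ A → |B| ≤ A * G := by
    intro D n A G B h1 h2 h3 h4
    have : D ≤ A * c₀ := (div_le_iff₀ hc₀).1 h3
    calc |B| ≤ D * n ^ 2 := h1
      _ ≤ A * c₀ * n ^ 2 := by gcongr
      _ = A * (c₀ * n ^ 2) := by ring
      _ ≤ A * G := by gcongr
  have hC0 : 0 ≤ C := by
    obtain ⟨s, hs⟩ := nonempty_Ioo.2 (mem_Iio.1 he)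
    obtain ⟨⟨⟨⟨⟨⟨⟨⟨⟨-, -⟩, h3⟩, -⟩, -⟩, -⟩, -⟩, -⟩, -⟩, -⟩ := hall s hs
    exact ((norm_nonneg _).trans h3).trans (le_max_right _ _)
  refine hΩ.tendsto_along_curve hI ha ha0 (t := t) (x := fun s => T (y s)) (P := fun s => p (y s))
    (P' := fun s => p' (y s)) (G := fun s => g (y s) (w s) (w s))
    (G' := fun s => q (y s) (w s) (w s)) (G'' := fun s => r (y s) (w s) (w s)) (C := C)
    (p₀ := p y₀ / 2) he hc (half_pos hTu) (fun s hs => htI s (hall s hs).2)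
    (fun s hs => ht s (hall s hs).2) (fun s hs => ?_) (fun s hs => hTy s (hall s hs).2)
    ?_ (fun s hs => ?_) (fun s hs => ?_) (fun s hs => ?_) (fun s hs => ?_) (fun s hs => ?_)
    (fun s hs => ?_) (fun s hs => ?_) (fun s hs => ?_) (fun s hs => hrel s (hall s hs).2)
  · obtain ⟨⟨⟨⟨-, -, h1, -⟩, -⟩, h2⟩, -⟩ := hall s hs
    exact hasDerivAt_comp_flow (h1.differentiableAt (by simp)) h2
  · have := hT.continuousAt.tendsto.comp hyt
    rwa [hT0] at this
  · obtain ⟨⟨⟨⟨-, -, -, h1⟩, -⟩, h2⟩, -⟩ := hall s hs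
    exact hasDerivAt_comp_flow (h1.differentiableAt (by simp)) h2
  · obtain ⟨⟨⟨⟨⟨⟨⟨-, h⟩, -⟩, -⟩, -⟩, -⟩, -⟩, -⟩ := hall s hs
    exact h.le
  · obtain ⟨⟨⟨⟨⟨⟨⟨⟨-, h⟩, -⟩, -⟩, -⟩, -⟩, -⟩, -⟩, -⟩ := hall s hs
    exact h.trans (le_max_right _ _)
  · obtain ⟨⟨⟨⟨⟨⟨-, h1⟩, -⟩, -⟩, -⟩, h2⟩, -⟩ := hall s hs
    exact hasDerivAt_dragForm h1 h2 (hw' s hs)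
  · obtain ⟨⟨⟨⟨⟨-, h1⟩, -⟩, -⟩, h2⟩, -⟩ := hall s hs
    exact hasDerivAt_dragForm h1 h2 (hw' s hs)
  · obtain ⟨⟨⟨⟨⟨⟨⟨⟨⟨⟨h1, -⟩, -⟩, -⟩, -⟩, -⟩, -⟩, -⟩, -⟩, -⟩, h2⟩ := hall s hs
    have := norm_pos_iff.2 (hw0 s h2)
    exact lt_of_lt_of_le (by positivity) (h1 (w s) (horth s h2))
  · obtain ⟨⟨⟨⟨⟨⟨⟨⟨⟨⟨h1, h3⟩, -⟩, -⟩, -⟩, -⟩, -⟩, -⟩, -⟩, -⟩, h2⟩ := hall s hs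
    exact hbound (h3 (w s)) (h1 (w s) (horth s h2))
      ((le_max_left _ _).trans (le_max_left _ _)) hC0
  · obtain ⟨⟨⟨⟨⟨⟨⟨⟨⟨⟨h1, -⟩, h3⟩, -⟩, -⟩, -⟩, -⟩, -⟩, -⟩, -⟩, h2⟩ := hall s hs
    exact hbound (h3 (w s)) (h1 (w s) (horth s h2))
      ((le_max_right _ _).trans (le_max_left _ _)) hC0

end Drag

/-! ### Curves, vector fields and forms in coordinate charts -/

/-- The derivative of a vector-valued function along a curve in a manifold. -/
theorem hasDerivAt_comp_curve {E H V : Type*} [NormedAddCommGroup E] [NormedSpace ℝ E]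
    [TopologicalSpace H] {J : ModelWithCorners ℝ E H} {M : Type*} [TopologicalSpace M]
    [ChartedSpace H M] [NormedAddCommGroup V] [NormedSpace ℝ V] {f : M → V} {γ : ℝ → M} {s : ℝ}
    {γ' : TangentSpace 𝓘(ℝ, ℝ) s →L[ℝ] TangentSpace J (γ s)}
    (hf : MDifferentiableAt J 𝓘(ℝ, V) f (γ s)) (hγ : HasMFDerivAt 𝓘(ℝ, ℝ) J γ s γ') :
    HasDerivAt (fun r => f (γ r)) (mfderiv J 𝓘(ℝ, V) f (γ s) (γ' (1 : ℝ))) s := by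
  let A : ℝ →L[ℝ] V := (mfderiv J 𝓘(ℝ, V) f (γ s)).comp γ'
  have h : HasFDerivAt (f ∘ γ) A s :=
    hasMFDerivAt_iff_hasFDerivAt.1 (hf.hasMFDerivAt.comp s hγ)
  exact h.hasDerivAt

section Coordinates

variable {E : Type*} [NormedAddCommGroup E] [NormedSpace ℝ E] {M : Type*} [TopologicalSpace M]
  [ChartedSpace E M]

theorem contDiffAt_comp_extChartAt_symm {V : Type*} [NormedAddCommGroup V] [NormedSpace ℝ V]
    {f : M → V} {p : M} {k : WithTop ℕ∞}
    (hf : ContMDiffAt 𝓘(ℝ, E) 𝓘(ℝ, V) k f p) :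
    ContDiffAt ℝ k (f ∘ (extChartAt 𝓘(ℝ, E) p).symm) (extChartAt 𝓘(ℝ, E) p p) := by
  have := (contMDiffAt_iff.1 hf).2
  simpa [contDiffWithinAt_univ, chartAt_self_eq] using this

theorem hasMFDerivAt_extChartAt_symm [IsManifold 𝓘(ℝ, E) ∞ M] {p : M} {y : E}
    (hy : y ∈ (extChartAt 𝓘(ℝ, E) p).target) :
    HasMFDerivAt 𝓘(ℝ, E) 𝓘(ℝ, E) (extChartAt 𝓘(ℝ, E) p).symm y
      (mfderiv 𝓘(ℝ, E) 𝓘(ℝ, E) (extChartAt 𝓘(ℝ, E) p).symm y) := by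
  have : IsManifold 𝓘(ℝ, E) 1 M := IsManifold.of_le (n := ∞) (by norm_num)
  have h := mdifferentiableWithinAt_extChartAt_symm (I := 𝓘(ℝ, E)) hy
  simp only [modelWithCornersSelf_coe, range_id, mdifferentiableWithinAt_univ] at h
  exact h.hasMFDerivAt

theorem trivializationAt_tangent_apply [IsManifold 𝓘(ℝ, E) ∞ M] {p q : M}
    (hq : q ∈ (chartAt E p).source) (v : TangentSpace 𝓘(ℝ, E) q) :
    (trivializationAt E (TangentSpace 𝓘(ℝ, E)) p ⟨q, v⟩).2 =
      mfderiv 𝓘(ℝ, E) 𝓘(ℝ, E) (extChartAt 𝓘(ℝ, E) p) q v := by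
  have : IsManifold 𝓘(ℝ, E) 1 M := IsManifold.of_le (n := ∞) (by norm_num)
  have h1 : (trivializationAt E (TangentSpace 𝓘(ℝ, E)) p ⟨q, v⟩).2 =
      (trivializationAt E (TangentSpace 𝓘(ℝ, E)) p).continuousLinearMapAt ℝ q v := by
    rw [Bundle.Trivialization.continuousLinearMapAt_apply,
      Bundle.Trivialization.coe_linearMapAt_of_mem]
    simpa using hq
  exact h1.trans (DFunLike.congr_fun
    (TangentBundle.continuousLinearMapAt_trivializationAt (I := 𝓘(ℝ, E)) hq) v)

/-- Coordinate expression of a vector field. -/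
theorem exists_coord_vectorField [IsManifold 𝓘(ℝ, E) ∞ M]
    {v : ∀ p : M, TangentSpace 𝓘(ℝ, E) p} {p : M} {k : WithTop ℕ∞}
    (hv : ContMDiffAt 𝓘(ℝ, E) (𝓘(ℝ, E).prod 𝓘(ℝ, E)) k
      (fun p : M => TotalSpace.mk' E (E := fun p : M => TangentSpace 𝓘(ℝ, E) p) p (v p)) p) :
    ∃ v' : E → E, ContDiffAt ℝ k v' (extChartAt 𝓘(ℝ, E) p p) ∧
      ∀ q ∈ (chartAt E p).source,
        v' (extChartAt 𝓘(ℝ, E) p q) = mfderiv 𝓘(ℝ, E) 𝓘(ℝ, E) (extChartAt 𝓘(ℝ, E) p) q (v q) := by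
  have : IsManifold 𝓘(ℝ, E) 1 M := IsManifold.of_le (n := ∞) (by norm_num)
  rw [contMDiffAt_section] at hv
  refine ⟨_, contDiffAt_comp_extChartAt_symm hv, fun q hq => ?_⟩
  have hq' : q ∈ (extChartAt 𝓘(ℝ, E) p).source := by rwa [extChartAt_source]
  rw [Function.comp_apply, (extChartAt 𝓘(ℝ, E) p).left_inv hq']
  exact trivializationAt_tangent_apply hq (v q)

/-- Coordinate expression of a field of bilinear forms. -/
theorem exists_coord_form [IsManifold 𝓘(ℝ, E) ∞ M]
    {g : ∀ p : M, TangentSpace 𝓘(ℝ, E) p →L[ℝ] TangentSpace 𝓘(ℝ, E) p →L[ℝ] ℝ}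
    {p : M} {k : WithTop ℕ∞}
    (hg : ContMDiffAt 𝓘(ℝ, E) (𝓘(ℝ, E).prod 𝓘(ℝ, E →L[ℝ] E →L[ℝ] ℝ)) k
      (fun p : M => TotalSpace.mk' (E →L[ℝ] E →L[ℝ] ℝ)
        (E := fun p : M => TangentSpace 𝓘(ℝ, E) p →L[ℝ] TangentSpace 𝓘(ℝ, E) p →L[ℝ] ℝ)
        p (g p)) p) :
    ∃ g' : E → E →L[ℝ] E →L[ℝ] ℝ, ContDiffAt ℝ k g' (extChartAt 𝓘(ℝ, E) p p) ∧
      ∀ q ∈ (chartAt E p).source, ∀ v w : TangentSpace 𝓘(ℝ, E) q,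
        g' (extChartAt 𝓘(ℝ, E) p q) (mfderiv 𝓘(ℝ, E) 𝓘(ℝ, E) (extChartAt 𝓘(ℝ, E) p) q v)
          (mfderiv 𝓘(ℝ, E) 𝓘(ℝ, E) (extChartAt 𝓘(ℝ, E) p) q w) = g q v w := by
  have : IsManifold 𝓘(ℝ, E) 1 M := IsManifold.of_le (n := ∞) (by norm_num)
  rw [contMDiffAt_hom_bundle] at hg
  refine ⟨_, contDiffAt_comp_extChartAt_symm hg.2, fun q hq v w => ?_⟩
  have hq' : q ∈ (extChartAt 𝓘(ℝ, E) p).source := by rwa [extChartAt_source]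
  rw [Function.comp_apply, (extChartAt 𝓘(ℝ, E) p).left_inv hq']
  have hb : q ∈ (trivializationAt E (TangentSpace 𝓘(ℝ, E)) p).baseSet := by simpa using hq
  refine (inCoordinates_apply_eq₂ (F₃ := ℝ) (E₃ := Bundle.Trivial M ℝ) hb hb (by simp)).trans ?_
  have h1 : ∀ v : TangentSpace 𝓘(ℝ, E) q,
      (trivializationAt E (TangentSpace 𝓘(ℝ, E)) p).symm q
        (mfderiv 𝓘(ℝ, E) 𝓘(ℝ, E) (extChartAt 𝓘(ℝ, E) p) q v) = v := fun v => by
    rw [← trivializationAt_tangent_apply hq]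
    exact (trivializationAt E (TangentSpace 𝓘(ℝ, E)) p).symm_apply_apply_mk hb v
  have h4 := congrArg₂ (fun a b => g q a b) (h1 v) (h1 w)
  simpa using h4

/-- A curve with vanishing derivative on an interval is constant. -/
theorem eq_of_hasMFDerivAt_zero [IsManifold 𝓘(ℝ, E) ∞ M] {σ : ℝ → M} {a b : ℝ}
    (h : ∀ s ∈ Ioo a b, HasMFDerivAt 𝓘(ℝ, ℝ) 𝓘(ℝ, E) σ s 0) :
    ∀ s ∈ Ioo a b, ∀ r ∈ Ioo a b, σ s = σ r := by
  have : IsManifold 𝓘(ℝ, E) 1 M := IsManifold.of_le (n := ∞) (by norm_num)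
  intro s hs r hr
  -- It suffices to show local constancy, which is checked in a chart around σ x; connectedness of
  -- the interval does the rest.
  refine isPreconnected_Ioo.induction₂ (fun x y => σ x = σ y) (fun x hx => ?_)
    (fun x y z _ _ _ => Eq.trans) (fun x y _ _ => Eq.symm) hs hr
  have hnhds : ∀ᶠ y in 𝓝 x, y ∈ Ioo a b ∧ σ y ∈ (chartAt E (σ x)).source :=
    (isOpen_Ioo.eventually_mem hx).and
      ((h x hx).continuousAt.eventually (chart_source_mem_nhds E (σ x)))
  obtain ⟨δ, hδ, hball⟩ := Metric.eventually_nhds_iff_ball.1 hnhds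
  have hder : ∀ y ∈ Metric.ball x δ,
      HasDerivAt (fun y => extChartAt 𝓘(ℝ, E) (σ x) (σ y)) 0 y := by
    intro y hy
    have h1 := hasDerivAt_comp_curve
      (mdifferentiableAt_extChartAt (I := 𝓘(ℝ, E)) (hball y hy).2) (h y (hball y hy).1)
    exact h1.congr_deriv (map_zero _)
  refine mem_nhdsWithin_of_mem_nhds (Filter.mem_of_superset (Metric.ball_mem_nhds x hδ) ?_)
  intro y hy
  have h3 := Metric.isOpen_ball.is_const_of_deriv_eq_zero (convex_ball x δ).isPreconnected
    (fun z hz => (hder z hz).differentiableAt.differentiableWithinAt)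
    (fun z hz => (hder z hz).deriv) (Metric.mem_ball_self hδ) hy
  refine (extChartAt 𝓘(ℝ, E) (σ x)).injOn ?_ ?_ h3
  · simp
  · rw [extChartAt_source]; exact (hball y hy).2

end Coordinates

/-- The evolution of a comoving vector `∂Ψ/∂x` along a fluid line `t ↦ Ψ (t, x)`. -/
theorem hasDerivAt_comoving {E F : Type*} [NormedAddCommGroup E] [NormedSpace ℝ E]
    [NormedAddCommGroup F] [NormedSpace ℝ F] {Ψ : ℝ × F → E} {u : E → E} {f : E → ℝ}
    {t : ℝ → ℝ} {s : ℝ} {x : F} (hΨ : ContDiffAt ℝ 2 Ψ (t s, x))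
    (hu : DifferentiableAt ℝ u (Ψ (t s, x))) (hf : DifferentiableAt ℝ f (Ψ (t s, x)))
    (hf0 : f (Ψ (t s, x)) ≠ 0)
    (hev : ∀ᶠ z in 𝓝 (t s, x), fderiv ℝ Ψ z (1, 0) = (f (Ψ z))⁻¹ • u (Ψ z))
    (ht : HasDerivAt t (f (Ψ (t s, x))) s) (w : F) :
    ∃ β : ℝ, HasDerivAt (fun r => fderiv ℝ Ψ (t r, x) (0, w))
      (fderiv ℝ u (Ψ (t s, x)) (fderiv ℝ Ψ (t s, x) (0, w)) + β • u (Ψ (t s, x))) s := by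
  set z := (t s, x) with hz
  have hd : DifferentiableAt ℝ (fderiv ℝ Ψ) z :=
    (hΨ.fderiv_right (m := 1) (by norm_num)).differentiableAt (by norm_num)
  have hΨd : HasFDerivAt Ψ (fderiv ℝ Ψ z) z := (hΨ.differentiableAt (by norm_num)).hasFDerivAt
  have h1 : HasDerivAt (fun r => fderiv ℝ Ψ (t r, x) (0, w))
      (fderiv ℝ (fderiv ℝ Ψ) z (f (Ψ z), 0) (0, w)) s := by
    have h2 : HasDerivAt (fun r => (t r, x)) (f (Ψ z), (0 : F)) s :=
      ht.prodMk (hasDerivAt_const s x)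
    have h3 := hd.hasFDerivAt.comp_hasDerivAt s h2
    refine (h3.clm_apply (hasDerivAt_const s ((0 : ℝ), w))).congr_deriv ?_
    simp
  -- Symmetry of the second derivative: ∂_t ∂_w Ψ = ∂_w ∂_t Ψ = ∂_w (f⁻¹ u). The factor dt/ds = f
  -- cancels f⁻¹ in front of Du, and differentiating f⁻¹ itself contributes only a multiple of u,
  -- which is β.
  have h4 := hΨ.isSymmSndFDerivAt (by simp) (1, 0) (0, w)
  have h5 : HasFDerivAt (fun z => fderiv ℝ Ψ z (1, 0))
      ((ContinuousLinearMap.apply ℝ E ((1 : ℝ), (0 : F))).comp (fderiv ℝ (fderiv ℝ Ψ) z)) z :=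
    (ContinuousLinearMap.apply ℝ E ((1 : ℝ), (0 : F))).hasFDerivAt.comp z hd.hasFDerivAt
  have h6 := ((hasDerivAt_inv hf0).comp_hasFDerivAt z (hf.hasFDerivAt.comp z hΨd)).smul
    (hu.hasFDerivAt.comp z hΨd)
  have h7 := congrArg (fun L => L (0, w)) (h5.unique (h6.congr_of_eventuallyEq hev))
  refine ⟨-((f (Ψ z))⁻¹ * fderiv ℝ f (Ψ z) (fderiv ℝ Ψ z (0, w))), h1.congr_deriv ?_⟩
  have h8 : ((f (Ψ z), 0) : ℝ × F) = f (Ψ z) • ((1 : ℝ), (0 : F)) := by simp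
  rw [h8, map_smul, smul_apply, h4]
  simp only [ContinuousLinearMap.comp_apply, ContinuousLinearMap.apply_apply, add_apply,
    smul_apply, ContinuousLinearMap.smulRight_apply, Function.comp_apply, smul_eq_mul] at h7
  rw [h7]
  match_scalars <;> field_simp

/-! ### Lorentzian linear algebra -/

/-- Timelike vectors of a Lorentzian form are never orthogonal. -/
theorem lorentz_ne_zero {V : Type*} [AddCommGroup V] [Module ℝ V] {g : V → V → ℝ}
    (hadd : ∀ a b v w z, g (a • v + b • w) z = a * g v z + b * g w z)
    (hsymm : ∀ v w, g v w = g w v)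
    {z : V} (hpos : ∀ w, g z w = 0 → w ≠ 0 → 0 < g w w)
    {v w : V} (hv : g v v < 0) (hw : g w w < 0) : g v w ≠ 0 := by
  intro hvw
  have hzero : g 0 0 = 0 := by simpa using hadd 0 0 v v 0
  have hnn : ∀ x, g z x = 0 → 0 ≤ g x x := fun x hx => by
    by_cases h : x = 0
    · rw [h, hzero]
    · exact (hpos x hx h).le
  have hgv : g z v ≠ 0 := fun h => absurd (hnn v h) (not_le.2 hv)
  -- This combination is orthogonal to z, so g is nonnegative on it. For orthogonal v, w its square
  -- is g(z,w)² g(v,v) + g(z,v)² g(w,w), negative since g(z,v) ≠ 0.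
  have h1 : g z (g z w • v + (-g z v) • w) = 0 := by
    rw [hsymm, hadd, hsymm v z, hsymm w z]; ring
  have h2 := hnn _ h1
  rw [hadd, hsymm v, hsymm w, hadd, hadd, hsymm w v, hvw] at h2
  nlinarith [mul_self_pos.2 hgv, mul_self_nonneg (g z w)]

/-- Same combination as for `lorentz_ne_zero`: 0 ≤ g(z,w)² g(v,v) + g(z,v)² g(w,w). If g(z,w) ≠ 0
the first term is negative, which forces g(w,w) > 0; if g(z,w) = 0 the hypothesis on z applies
directly. -/
theorem lorentz_pos {V : Type*} [AddCommGroup V] [Module ℝ V] {g : V → V → ℝ}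
    (hadd : ∀ a b v w z, g (a • v + b • w) z = a * g v z + b * g w z)
    (hsymm : ∀ v w, g v w = g w v)
    {z : V} (hpos : ∀ w, g z w = 0 → w ≠ 0 → 0 < g w w)
    {v w : V} (hv : g v v < 0) (hvw : g v w = 0) (hw : w ≠ 0) : 0 < g w w := by
  have hzero : ∀ y, g 0 y = 0 := fun y => by simpa using hadd 0 0 v v y
  have hnn : ∀ x, g z x = 0 → 0 ≤ g x x := fun x hx => by
    by_cases h : x = 0
    · rw [h, hzero]
    · exact (hpos x hx h).le
  have hgv : g z v ≠ 0 := fun h => absurd (hnn v h) (not_le.2 hv)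
  have h1 : g z (g z w • v + (-g z v) • w) = 0 := by
    rw [hsymm, hadd, hsymm v z, hsymm w z]; ring
  have h2 : g (g z w • v + (-g z v) • w) (g z w • v + (-g z v) • w) =
      g z w ^ 2 * g v v + g z v ^ 2 * g w w := by
    rw [hadd, hsymm v, hsymm w, hadd, hadd, hsymm w v, hvw]; ring
  by_cases hzw : g z w = 0
  · exact hpos w hzw hw
  · have h3 := hnn _ h1
    rw [h2] at h3
    have h4 : 0 < g z w ^ 2 := by positivity
    have h5 : 0 < g z v ^ 2 := by positivity
    by_contra! h6
    nlinarith

section Coordinates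

variable {E : Type*} [NormedAddCommGroup E] [NormedSpace ℝ E] {M : Type*} [TopologicalSpace M]
  [ChartedSpace E M]

theorem mfderiv_extChartAt_base [IsManifold 𝓘(ℝ, E) ∞ M] (p : M) (v : TangentSpace 𝓘(ℝ, E) p) :
    mfderiv 𝓘(ℝ, E) 𝓘(ℝ, E) (extChartAt 𝓘(ℝ, E) p) p v = v := by
  have : IsManifold 𝓘(ℝ, E) 1 M := IsManifold.of_le (n := ∞) (by norm_num)
  exact DFunLike.congr_fun (mfderiv_extChartAt_self (I := 𝓘(ℝ, E)) (x := p)) v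

/-- The differential of a scalar function. -/
noncomputable def differential (T : M → ℝ) (p : M) : TangentSpace 𝓘(ℝ, E) p →L[ℝ] ℝ :=
  mfderiv 𝓘(ℝ, E) 𝓘(ℝ, ℝ) T p

theorem hasDerivAt_comp_velocity {V : Type*} [NormedAddCommGroup V] [NormedSpace ℝ V] {f : M → V}
    {γ : ℝ → M} {s : ℝ} {v : TangentSpace 𝓘(ℝ, E) (γ s)}
    (hf : MDifferentiableAt 𝓘(ℝ, E) 𝓘(ℝ, V) f (γ s))
    (hγ : HasMFDerivAt 𝓘(ℝ, ℝ) 𝓘(ℝ, E) γ s ((1 : ℝ →L[ℝ] ℝ).smulRight v)) :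
    HasDerivAt (fun r => f (γ r)) (mfderiv 𝓘(ℝ, E) 𝓘(ℝ, V) f (γ s) v) s :=
  (hasDerivAt_comp_curve hf hγ).congr_deriv
    (congrArg (mfderiv 𝓘(ℝ, E) 𝓘(ℝ, V) f (γ s)) (one_smul ℝ v))

/-- The derivative of a scalar function in coordinates. -/
theorem fderiv_comp_extChartAt_symm [IsManifold 𝓘(ℝ, E) ∞ M] {T : M → ℝ} {p q : M}
    (hT : MDifferentiableAt 𝓘(ℝ, E) 𝓘(ℝ, ℝ) T q) (hq : q ∈ (chartAt E p).source)
    (v : TangentSpace 𝓘(ℝ, E) q) :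
    fderiv ℝ (T ∘ (extChartAt 𝓘(ℝ, E) p).symm) (extChartAt 𝓘(ℝ, E) p q)
      (mfderiv 𝓘(ℝ, E) 𝓘(ℝ, E) (extChartAt 𝓘(ℝ, E) p) q v) = differential T q v := by
  have : IsManifold 𝓘(ℝ, E) 1 M := IsManifold.of_le (n := ∞) (by norm_num)
  set κ := extChartAt 𝓘(ℝ, E) p with hκ
  have hq' : q ∈ κ.source := by rwa [hκ, extChartAt_source]
  have h1 : MDifferentiableAt 𝓘(ℝ, E) 𝓘(ℝ, E) κ q := mdifferentiableAt_extChartAt hq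
  have h2 : MDifferentiableAt 𝓘(ℝ, E) 𝓘(ℝ, ℝ) (T ∘ κ.symm) (κ q) := by
    refine MDifferentiableAt.comp (I' := 𝓘(ℝ, E)) (κ q) (by rwa [κ.left_inv hq']) ?_
    exact (hasMFDerivAt_extChartAt_symm (κ.map_source hq')).mdifferentiableAt
  have h3 : mfderiv 𝓘(ℝ, E) 𝓘(ℝ, ℝ) T q = mfderiv 𝓘(ℝ, E) 𝓘(ℝ, ℝ) ((T ∘ κ.symm) ∘ κ) q := by
    refine Filter.EventuallyEq.mfderiv_eq ?_
    filter_upwards [(isOpen_extChartAt_source (I := 𝓘(ℝ, E)) p).mem_nhds hq'] with x hx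
    simp [Function.comp_apply, κ.left_inv hx]
  rw [differential, h3, mfderiv_comp q h2 h1, ← mfderiv_eq_fderiv]
  rfl

/-- The straight lines of a coordinate chart. -/
theorem hasMFDerivAt_chart_line [IsManifold 𝓘(ℝ, E) ∞ M] {p : M} {v : E} {s : ℝ}
    (hs : extChartAt 𝓘(ℝ, E) p p + s • v ∈ (extChartAt 𝓘(ℝ, E) p).target) :
    ∃ c' : TangentSpace 𝓘(ℝ, E) ((extChartAt 𝓘(ℝ, E) p).symm (extChartAt 𝓘(ℝ, E) p p + s • v)),
      HasMFDerivAt 𝓘(ℝ, ℝ) 𝓘(ℝ, E)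
        (fun s : ℝ => (extChartAt 𝓘(ℝ, E) p).symm (extChartAt 𝓘(ℝ, E) p p + s • v)) s
        ((1 : ℝ →L[ℝ] ℝ).smulRight c') ∧
      mfderiv 𝓘(ℝ, E) 𝓘(ℝ, E) (extChartAt 𝓘(ℝ, E) p)
        ((extChartAt 𝓘(ℝ, E) p).symm (extChartAt 𝓘(ℝ, E) p p + s • v)) c' = v := by
  have : IsManifold 𝓘(ℝ, E) 1 M := IsManifold.of_le (n := ∞) (by norm_num)
  set κ := extChartAt 𝓘(ℝ, E) p with hκ
  set y := κ p + s • v with hy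
  have h1 := hasMFDerivAt_extChartAt_symm hs
  have h2 : HasDerivAt (fun s : ℝ => κ p + s • v) v s := by
    simpa using ((hasDerivAt_id s).smul_const v).const_add (κ p)
  refine ⟨mfderiv 𝓘(ℝ, E) 𝓘(ℝ, E) κ.symm y v, ?_, ?_⟩
  · have h3 := h1.comp s h2.hasFDerivAt.hasMFDerivAt
    refine h3.congr_mfderiv (ContinuousLinearMap.ext fun r => ?_)
    let A : E →L[ℝ] TangentSpace 𝓘(ℝ, E) (κ.symm y) := mfderiv 𝓘(ℝ, E) 𝓘(ℝ, E) κ.symm y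
    let r' : ℝ := r
    exact A.map_smul r' v
  · have h4 : κ.symm y ∈ (chartAt E p).source := by
      rw [← extChartAt_source 𝓘(ℝ, E)]; exact κ.map_target hs
    have h5 := mfderiv_extChartAt_comp_mfderivWithin_extChartAt_symm (I := 𝓘(ℝ, E)) hs
    simp only [modelWithCornersSelf_coe, range_id, mfderivWithin_univ] at h5
    exact DFunLike.congr_fun h5 v

end Coordinates

/-! ### Cosmic time functions in timelike directions -/

namespace Spacetime

variable {X : Type*} [TopologicalSpace X] [ChartedSpace E4 X] [IsManifold 𝓘(ℝ, E4) ∞ X]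

theorem ne_zero_of_timelike (G : Spacetime X) {p : X} {v w : TangentSpace 𝓘(ℝ, E4) p}
    (hv : G.g p v v < 0) (hw : G.g p w w < 0) : G.g p v w ≠ 0 := by
  obtain ⟨z, -, hz⟩ := G.lorentzian p
  exact lorentz_ne_zero (g := fun v w => G.g p v w) (fun a b v w z => by simp)
    (fun v w => G.symm p v w) hz hv hw

theorem pos_of_orthogonal (G : Spacetime X) {p : X} {v w : TangentSpace 𝓘(ℝ, E4) p}
    (hv : G.g p v v < 0) (hvw : G.g p v w = 0) (hw : w ≠ 0) : 0 < G.g p w w := by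
  obtain ⟨z, -, hz⟩ := G.lorentzian p
  exact lorentz_pos (g := fun v w => G.g p v w) (fun a b v w z => by simp)
    (fun v w => G.symm p v w) hz hv hvw hw

/-- A cosmic time function does not decrease in future timelike directions. -/
theorem IsSmoothCosmicTime.mfderiv_nonneg {G : Spacetime X} {T : X → ℝ}
    (hT : G.IsSmoothCosmicTime T) {p : X} {v : TangentSpace 𝓘(ℝ, E4) p} (hv : G.g p v v < 0)
    (hv' : G.g p v (G.timeDir p) < 0) : 0 ≤ differential T p v := by
  obtain ⟨g', hg', hgc⟩ := exists_coord_form (G.continuous_g p)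
  obtain ⟨τ, hτ, hτc⟩ := exists_coord_vectorField (G.continuous_timeDir p)
  set κ := extChartAt 𝓘(ℝ, E4) p with hκ
  -- The test curve is the straight line in the chart with velocity v at p. Being timelike and
  -- future-directed is an open condition, so the line stays a future causal curve for a short time
  -- and T increases along it.
  let e : E4 := v
  set c : ℝ → X := fun s => κ.symm (κ p + s • e) with hc
  have hgcont := continuousAt_of_contDiffAt_form hg'
  have hp : p ∈ (chartAt E4 p).source := mem_chart_source E4 p
  have hline : ContinuousAt (fun s : ℝ => κ p + s • e) 0 := by fun_prop
  have hline0 : κ p + (0 : ℝ) • e = κ p := by simp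
  have h1 : ∀ᶠ y in 𝓝 (κ p), g' y e e < 0 := by
    have h2 : ContinuousAt (fun y => g' y e e) (κ p) :=
      (hgcont.clm_apply continuousAt_const).clm_apply continuousAt_const
    refine h2.eventually_lt_const ?_
    have := hgc p hp v v
    rw [mfderiv_extChartAt_base] at this
    exact this.trans_lt hv
  have h3 : ∀ᶠ y in 𝓝 (κ p), g' y e (τ y) < 0 := by
    have h2 : ContinuousAt (fun y => g' y e (τ y)) (κ p) :=
      (hgcont.clm_apply continuousAt_const).clm_apply hτ.continuousAt
    refine h2.eventually_lt_const ?_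
    have := hgc p hp v (G.timeDir p)
    rw [mfderiv_extChartAt_base, ← hτc p hp] at this
    exact this.trans_lt hv'
  have h4 : ∀ᶠ s : ℝ in 𝓝 0, (g' (κ p + s • e) e e < 0 ∧
      g' (κ p + s • e) e (τ (κ p + s • e)) < 0) ∧
      κ p + s • e ∈ κ.target := by
    have := hline.tendsto
    rw [hline0] at this
    exact this.eventually ((h1.and h3).and (extChartAt_target_mem_nhds p))
  obtain ⟨δ, hδ, hball⟩ := Metric.eventually_nhds_iff_ball.1 h4
  rw [Real.ball_eq_Ioo, zero_sub, zero_add] at hball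
  have hder : ∀ s ∈ Ioo (-δ) δ, ∃ c' : TangentSpace 𝓘(ℝ, E4) (c s),
      HasMFDerivAt 𝓘(ℝ, ℝ) 𝓘(ℝ, E4) c s ((1 : ℝ →L[ℝ] ℝ).smulRight c') ∧
      mfderiv 𝓘(ℝ, E4) 𝓘(ℝ, E4) κ (c s) c' = e :=
    fun s hs => hasMFDerivAt_chart_line (hball s hs).2
  have hcurve : G.IsFutureCausalCurve c (-δ) δ := by
    constructor
    · have h5 : ContMDiffOn 𝓘(ℝ, E4) 𝓘(ℝ, E4) 1 κ.symm κ.target := by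
        have : IsManifold 𝓘(ℝ, E4) 1 X := IsManifold.of_le (n := ∞) (by norm_num)
        exact contMDiffOn_extChartAt_symm p
      refine h5.comp (t := κ.target) ?_ fun s hs => (hball s hs).2
      refine ContDiffOn.contMDiffOn ?_
      fun_prop
    · intro s hs
      obtain ⟨c', hc', hκc⟩ := hder s hs
      have h6 : mfderiv 𝓘(ℝ, ℝ) 𝓘(ℝ, E4) c s (1 : ℝ) = c' := by
        rw [hc'.mfderiv]
        exact one_smul ℝ c'
      have h7 : c s ∈ (chartAt E4 p).source := by
        rw [← extChartAt_source 𝓘(ℝ, E4)]; exact κ.map_target (hball s hs).2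
      have h8 : κ (c s) = κ p + s • e := κ.right_inv (hball s hs).2
      rw [h6]
      have h9 := hgc (c s) h7 c' c'
      have h10 := hgc (c s) h7 c' (G.timeDir (c s))
      rw [hκc, h8] at h9
      rw [hκc, ← hτc _ h7, h8] at h10
      have h11 : G.g (c s) c' c' < 0 := h9 ▸ (hball s hs).1.1
      refine ⟨fun h => ?_, h11.le, h10 ▸ (hball s hs).1.2⟩
      rw [h, map_zero] at h11
      exact lt_irrefl _ h11
  have hmono := hT.2 c (-δ) δ hcurve
  have h0 : (0 : ℝ) ∈ Ioo (-δ) δ := ⟨by linarith, hδ⟩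
  obtain ⟨c', hc', hκc⟩ := hder 0 h0
  have hTd : MDifferentiableAt 𝓘(ℝ, E4) 𝓘(ℝ, ℝ) T (c 0) := (hT.1 (c 0)).mdifferentiableAt (by simp)
  have hd : HasDerivAt (fun r => T (c r)) (differential T (c 0) c') 0 :=
    hasDerivAt_comp_velocity hTd hc'
  have h12 : 0 ≤ differential T (c 0) c' := by
    have h13 := hd.hasDerivWithinAt (s := Ioo (-δ) δ)
    have h14 := hmono.monotoneOn.derivWithin_nonneg (x := 0)
    have h15 := h13.derivWithin (isOpen_Ioo.uniqueDiffWithinAt h0)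
    have h16 : derivWithin (T ∘ c) (Ioo (-δ) δ) 0 = _ := h15
    rw [h16] at h14
    exact h14
  have hc0 : c 0 = p := by simp [hc, κ]
  have h17 := fderiv_comp_extChartAt_symm (p := p) hTd (by rw [hc0]; exact hp) c'
  have h18 := fderiv_comp_extChartAt_symm (p := p) (hc0 ▸ hTd) hp v
  rw [← h18, mfderiv_extChartAt_base]
  rw [← h17, hκc, hc0] at h12
  exact h12

/-- A cosmic time function increases in future timelike directions where it is regular. -/
theorem IsSmoothCosmicTime.mfderiv_pos {G : Spacetime X} {T : X → ℝ}
    (hT : G.IsSmoothCosmicTime T) {p : X} (hreg : mfderiv 𝓘(ℝ, E4) 𝓘(ℝ, ℝ) T p ≠ 0)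
    {v : TangentSpace 𝓘(ℝ, E4) p} (hv : G.g p v v < 0)
    (hv' : G.g p v (G.timeDir p) < 0) : 0 < differential T p v := by
  refine lt_of_le_of_ne (hT.mfderiv_nonneg hv hv') fun h0 => hreg ?_
  change differential T p = 0
  ext w
  -- If dT(v) = 0, perturb v inside the open future cone: v + δ w is future timelike for small δ >
  -- 0, hence dT(w) ≥ 0. Applied to w and -w this makes dT vanish.
  have key : ∀ w : TangentSpace 𝓘(ℝ, E4) p, 0 ≤ differential T p w := by
    intro w
    have h1 : ∀ᶠ δ : ℝ in 𝓝 0, G.g p (v + δ • w) (v + δ • w) < 0 := by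
      have h2 : Continuous fun δ : ℝ =>
          G.g p v v + δ * G.g p v w + δ * (G.g p w v + δ * G.g p w w) := by fun_prop
      refine ((h2.tendsto 0).eventually_lt_const (by simpa using hv)).mono fun δ hδ => ?_
      simpa [mul_add, add_assoc] using hδ
    have h3 : ∀ᶠ δ : ℝ in 𝓝 0, G.g p (v + δ • w) (G.timeDir p) < 0 := by
      have h2 : Continuous fun δ : ℝ =>
          G.g p v (G.timeDir p) + δ * G.g p w (G.timeDir p) := by fun_prop
      refine ((h2.tendsto 0).eventually_lt_const (by simpa using hv')).mono fun δ hδ => ?_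
      simpa using hδ
    obtain ⟨δ, ⟨h4, h5⟩, h6⟩ := (((h1.and h3).filter_mono nhdsWithin_le_nhds).and
      (self_mem_nhdsWithin : Ioi (0 : ℝ) ∈ 𝓝[>] 0)).exists
    have h7 := hT.mfderiv_nonneg h4 h5
    rw [map_add, ← h0, zero_add, map_smul] at h7
    exact nonneg_of_mul_nonneg_right h7 h6
  have h9 := key (-w)
  rw [map_neg] at h9
  exact le_antisymm (neg_nonneg.1 h9) (key w)

end Spacetime
-- The fluid line that reaches the hypersurface T = 0
namespace ConformalExtension

variable {n : ℕ∞} {S : Type*} [TopologicalSpace S] [ChartedSpace E3 S]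
  [IsManifold 𝓘(ℝ, E3) ∞ S] {F : Model n S} {D : Set ℝ} {X : Type*} [TopologicalSpace X]
  [ChartedSpace E4 X] [IsManifold 𝓘(ℝ, E4) ∞ X]

theorem succ_ne_zero : ((n + 1 : ℕ∞) : WithTop ℕ∞) ≠ 0 := by
  exact_mod_cast (by simp : (n + 1 : ℕ∞) ≠ 0)

theorem mdifferentiable_φ (C : ConformalExtension F D X) :
    C.φ.MDifferentiable (𝓘(ℝ, ℝ).prod 𝓘(ℝ, E3)) 𝓘(ℝ, E4) :=
  ⟨C.contMDiffOn_φ.mdifferentiableOn succ_ne_zero,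
    C.contMDiffOn_φ_symm.mdifferentiableOn succ_ne_zero⟩

theorem exists_φ_eq (C : ConformalExtension F D X) {q : X} (hq : C.T q ∈ D) :
    ∃ r ∈ C.φ.source, C.φ r = q := by
  have h : q ∈ C.φ.target := by rw [C.target_φ]; exact hq
  exact ⟨C.φ.symm q, C.φ.map_target h, C.φ.right_inv h⟩

theorem T_φ_mem (C : ConformalExtension F D X) {r : ℝ × S} (hr : r ∈ C.φ.source) :
    C.T (C.φ r) ∈ D := by
  have h := C.φ.map_source hr
  rwa [C.target_φ] at h

/-- Near a point of the hypersurface `T = 0` there are points with `T < 0`. -/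
theorem frequently_T_neg (C : ConformalExtension F D X) {p : X} (hp : C.T p = 0) :
    ∃ᶠ y in 𝓝 (extChartAt 𝓘(ℝ, E4) p p), C.T ((extChartAt 𝓘(ℝ, E4) p).symm y) < 0 := by
  intro hcon
  refine C.regular_zero p hp ?_
  -- Otherwise p would be a local minimum of T, contradicting dT ≠ 0.
  have hmin : IsLocalMin (C.T ∘ (extChartAt 𝓘(ℝ, E4) p).symm) (extChartAt 𝓘(ℝ, E4) p p) := by
    filter_upwards [hcon] with y hy
    simpa [hp] using hy
  have h0 := hmin.fderiv_eq_zero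
  change differential C.T p = 0
  ext v
  rw [← fderiv_comp_extChartAt_symm (p := p) ((C.cosmicTime.1 p).mdifferentiableAt (by simp))
    (mem_chart_source E4 p), h0]
  rfl

/-- The limit of the fluid flow on the hypersurface `T = 0` is future-directed. -/
theorem future_of_regular (C : ConformalExtension F (Iio 0) X)
    {ubar : ∀ p : X, TangentSpace 𝓘(ℝ, E4) p} (hunit : ∀ p, C.g p (ubar p) (ubar p) = -1)
    (hfl : ∀ p ∈ C.φ.source, ubar (C.φ p) = C.Ω (C.T (C.φ p)) •
      mfderiv (𝓘(ℝ, ℝ).prod 𝓘(ℝ, E3)) 𝓘(ℝ, E4) C.φ p (Model.fluid p)) {p : X}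
    (hp : C.T p = 0)
    (hu : ContMDiffAt 𝓘(ℝ, E4) (𝓘(ℝ, E4).prod 𝓘(ℝ, E4)) 2
      (fun p : X => TotalSpace.mk' E4 (E := fun p : X => TangentSpace 𝓘(ℝ, E4) p) p (ubar p)) p) :
    C.g p (ubar p) (C.timeDir p) < 0 := by
  have hne := C.ne_zero_of_timelike (p := p) (v := ubar p) (w := C.timeDir p)
    (by rw [hunit]; norm_num) (C.timelike_timeDir p)
  -- Two timelike vectors are not orthogonal, so only the wrong sign has to be excluded. It would
  -- persist near p, in particular at points with T < 0, where ū is a positive multiple of the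
  -- future-directed u.
  refine lt_of_le_of_ne (not_lt.1 fun hpos => ?_) hne
  obtain ⟨g', hg', hgc⟩ := exists_coord_form (C.continuous_g p)
  obtain ⟨τ, hτ, hτc⟩ := exists_coord_vectorField (C.continuous_timeDir p)
  obtain ⟨u', hu', huc⟩ := exists_coord_vectorField hu
  set κ := extChartAt 𝓘(ℝ, E4) p with hκ
  have hcoord : ∀ q ∈ (chartAt E4 p).source,
      g' (κ q) (u' (κ q)) (τ (κ q)) = C.g q (ubar q) (C.timeDir q) := fun q hq => by
    rw [huc q hq, hτc q hq]
    exact hgc q hq _ _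
  have h1 : ContinuousAt (fun y => g' y (u' y) (τ y)) (κ p) :=
    ((continuousAt_of_contDiffAt_form hg').clm_apply hu'.continuousAt).clm_apply hτ.continuousAt
  have h2 : ∀ᶠ y in 𝓝 (κ p), 0 < g' y (u' y) (τ y) :=
    h1.eventually_const_lt (lt_of_lt_of_eq hpos (hcoord p (mem_chart_source E4 p)).symm)
  obtain ⟨y, hy, hy1, hy2⟩ :=
    ((C.frequently_T_neg hp).and_eventually (h2.and (extChartAt_target_mem_nhds p))).exists
  have hq : κ.symm y ∈ (chartAt E4 p).source := by
    rw [← extChartAt_source 𝓘(ℝ, E4)]; exact κ.map_target hy2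
  have h3 := hcoord _ hq
  rw [κ.right_inv hy2] at h3
  rw [h3] at hy1
  obtain ⟨r, hr, hrq⟩ := C.exists_φ_eq (q := κ.symm y) hy
  rw [← hrq, hfl r hr, map_smul, smul_apply, smul_eq_mul] at hy1
  have h4 := (C.future_φ r hr).2.2
  have h5 := C.Ω_pos _ (C.T_φ_mem hr)
  nlinarith

/-- In the coordinates of the model an integral curve of `ū` is a fluid line. -/
theorem hasMFDerivAt_φ_symm_comp (C : ConformalExtension F D X)
    {ubar : ∀ p : X, TangentSpace 𝓘(ℝ, E4) p}
    (hfl : ∀ p ∈ C.φ.source, ubar (C.φ p) = C.Ω (C.T (C.φ p)) •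
      mfderiv (𝓘(ℝ, ℝ).prod 𝓘(ℝ, E3)) 𝓘(ℝ, E4) C.φ p (Model.fluid p)) {γ : ℝ → X} {s : ℝ}
    (hγ : HasMFDerivAt 𝓘(ℝ, ℝ) 𝓘(ℝ, E4) γ s ((1 : ℝ →L[ℝ] ℝ).smulRight (ubar (γ s))))
    (hs : C.T (γ s) ∈ D) :
    HasDerivAt (fun s => (C.φ.symm (γ s)).1) (C.Ω (C.T (γ s))) s ∧
    HasMFDerivAt 𝓘(ℝ, ℝ) 𝓘(ℝ, E3) (fun s => (C.φ.symm (γ s)).2) s 0 := by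
  have ht : γ s ∈ C.φ.target := by rw [C.target_φ]; exact hs
  have hd := (C.mdifferentiable_φ.mdifferentiableAt_symm ht).hasMFDerivAt
  have hv : mfderiv 𝓘(ℝ, E4) (𝓘(ℝ, ℝ).prod 𝓘(ℝ, E3)) C.φ.symm (γ s) (ubar (γ s)) =
      C.Ω (C.T (γ s)) • Model.fluid (C.φ.symm (γ s)) := by
    obtain ⟨r, hr, hrq⟩ := C.exists_φ_eq hs
    rw [← hrq, hfl r hr, map_smul, C.φ.left_inv hr]
    congr 1
    exact DFunLike.congr_fun (C.mdifferentiable_φ.symm_comp_deriv hr) (Model.fluid r)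
  have hμ := hd.comp s hγ
  constructor
  · have h1 := hasDerivAt_comp_curve (f := Prod.fst) mdifferentiableAt_fst hμ
    refine h1.congr_deriv ?_
    rw [mfderiv_fst]
    let A : E4 →L[ℝ] ℝ × E3 := mfderiv 𝓘(ℝ, E4) (𝓘(ℝ, ℝ).prod 𝓘(ℝ, E3)) C.φ.symm (γ s)
    let e : E4 := ubar (γ s)
    have hA : A e = (C.Ω (C.T (γ s)) * 1, C.Ω (C.T (γ s)) • (0 : E3)) := hv
    change (A ((1 : ℝ) • e)).1 = C.Ω (C.T (γ s))
    rw [one_smul, hA, mul_one]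
  · have h1 := (hasMFDerivAt_snd (I := 𝓘(ℝ, ℝ)) (I' := 𝓘(ℝ, E3)) (C.φ.symm (γ s))).comp s hμ
    refine h1.congr_mfderiv (ContinuousLinearMap.ext fun r => ?_)
    let A : E4 →L[ℝ] ℝ × E3 := mfderiv 𝓘(ℝ, E4) (𝓘(ℝ, ℝ).prod 𝓘(ℝ, E3)) C.φ.symm (γ s)
    let e : E4 := ubar (γ s)
    let r' : ℝ := r
    have hA : A e = (C.Ω (C.T (γ s)) * 1, C.Ω (C.T (γ s)) • (0 : E3)) := hv
    change (A (r' • e)).2 = (0 : E3)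
    rw [A.map_smul, hA, smul_zero, Prod.smul_mk, smul_zero]

end ConformalExtension
namespace ConformalExtension

variable {n : ℕ∞} {S : Type*} [TopologicalSpace S] [ChartedSpace E3 S]
  [IsManifold 𝓘(ℝ, E3) ∞ S] {F : Model n S} {D : Set ℝ} {X : Type*} [TopologicalSpace X]
  [ChartedSpace E4 X] [IsManifold 𝓘(ℝ, E4) ∞ X]

/-- The identification of the model with a part of the unphysical spacetime, in coordinates
around `p` and `s₀`. -/
noncomputable def coordMap (C : ConformalExtension F D X) (p : X) (s₀ : S) (z : ℝ × E3) : E4 :=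
  extChartAt 𝓘(ℝ, E4) p (C.φ (z.1, (extChartAt 𝓘(ℝ, E3) s₀).symm z.2))

/-- The differential of the identification, in coordinates of the model. -/
noncomputable def pushCoord (C : ConformalExtension F D X) (s₀ : S) (z : ℝ × E3) :
    ℝ × E3 →L[ℝ] TangentSpace 𝓘(ℝ, E4) (C.φ (z.1, (extChartAt 𝓘(ℝ, E3) s₀).symm z.2)) :=
  (mfderiv (𝓘(ℝ, ℝ).prod 𝓘(ℝ, E3)) 𝓘(ℝ, E4) C.φ
    (z.1, (extChartAt 𝓘(ℝ, E3) s₀).symm z.2)).comp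
    ((ContinuousLinearMap.fst ℝ ℝ E3).prod
      ((mfderiv 𝓘(ℝ, E3) 𝓘(ℝ, E3) (extChartAt 𝓘(ℝ, E3) s₀).symm z.2).comp
        (ContinuousLinearMap.snd ℝ ℝ E3)))

theorem fderiv_coordMap (C : ConformalExtension F D X) {p : X} {s₀ : S} {z : ℝ × E3}
    (h1 : z.1 ∈ F.I) (h2 : z.2 ∈ (extChartAt 𝓘(ℝ, E3) s₀).target)
    (h3 : C.φ (z.1, (extChartAt 𝓘(ℝ, E3) s₀).symm z.2) ∈ (chartAt E4 p).source) (v : ℝ × E3) :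
    fderiv ℝ (C.coordMap p s₀) z v =
      mfderiv 𝓘(ℝ, E4) 𝓘(ℝ, E4) (extChartAt 𝓘(ℝ, E4) p) _ (C.pushCoord s₀ z v) := by
  have : IsManifold 𝓘(ℝ, E4) 1 X := IsManifold.of_le (n := ∞) (by norm_num)
  have hr : (z.1, (extChartAt 𝓘(ℝ, E3) s₀).symm z.2) ∈ C.φ.source := by
    rw [C.source_φ]; exact ⟨h1, mem_univ _⟩
  have e1 : HasMFDerivAt 𝓘(ℝ, ℝ × E3) 𝓘(ℝ, ℝ) (fun z : ℝ × E3 => z.1) z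
      (ContinuousLinearMap.fst ℝ ℝ E3) := hasFDerivAt_fst.hasMFDerivAt
  have e2 : HasMFDerivAt 𝓘(ℝ, ℝ × E3) 𝓘(ℝ, E3) (fun z : ℝ × E3 => z.2) z
      (ContinuousLinearMap.snd ℝ ℝ E3) := hasFDerivAt_snd.hasMFDerivAt
  have e3 := e1.prodMk ((hasMFDerivAt_extChartAt_symm h2).comp z e2)
  have e4 := (C.mdifferentiable_φ.mdifferentiableAt hr).hasMFDerivAt.comp z e3
  have e5 := (mdifferentiableAt_extChartAt (I := 𝓘(ℝ, E4)) h3).hasMFDerivAt.comp z e4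
  let A : ℝ × E3 →L[ℝ] E4 := (mfderiv 𝓘(ℝ, E4) 𝓘(ℝ, E4) (extChartAt 𝓘(ℝ, E4) p) _).comp
    (C.pushCoord s₀ z)
  have e6 : HasFDerivAt (C.coordMap p s₀) A z := hasMFDerivAt_iff_hasFDerivAt.1 e5
  rw [e6.fderiv]
  rfl

/-- Second-order regularity of the identification is what the exchange of derivatives in
`hasDerivAt_comoving` requires. -/
theorem contDiffAt_coordMap (hn : 1 ≤ n) (C : ConformalExtension F D X) {p : X} {s₀ : S}
    {z : ℝ × E3}
    (h1 : z.1 ∈ F.I) (h2 : z.2 ∈ (extChartAt 𝓘(ℝ, E3) s₀).target)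
    (h3 : C.φ (z.1, (extChartAt 𝓘(ℝ, E3) s₀).symm z.2) ∈ (chartAt E4 p).source) :
    ContDiffAt ℝ 2 (C.coordMap p s₀) z := by
  have : IsManifold 𝓘(ℝ, E4) 2 X := IsManifold.of_le (n := ∞) (WithTop.coe_le_coe.2 le_top)
  have : IsManifold 𝓘(ℝ, E3) 2 S := IsManifold.of_le (n := ∞) (WithTop.coe_le_coe.2 le_top)
  have hr : (z.1, (extChartAt 𝓘(ℝ, E3) s₀).symm z.2) ∈ C.φ.source := by
    rw [C.source_φ]; exact ⟨h1, mem_univ _⟩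
  have e1 : ContMDiffAt 𝓘(ℝ, ℝ × E3) 𝓘(ℝ, ℝ) 2 (fun z : ℝ × E3 => z.1) z :=
    contDiffAt_fst.contMDiffAt
  have e2 : ContMDiffAt 𝓘(ℝ, ℝ × E3) 𝓘(ℝ, E3) 2 (fun z : ℝ × E3 => z.2) z :=
    contDiffAt_snd.contMDiffAt
  have e3 : ContMDiffAt 𝓘(ℝ, E3) 𝓘(ℝ, E3) 2 (extChartAt 𝓘(ℝ, E3) s₀).symm z.2 :=
    (contMDiffOn_extChartAt_symm s₀).contMDiffAt (extChartAt_target_mem_nhds' h2)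
  have e4 := e1.prodMk (e3.comp z e2)
  have h4 : (2 : WithTop ℕ∞) ≤ ((n + 1 : ℕ∞) : WithTop ℕ∞) := by
    have : (2 : ℕ∞) ≤ n + 1 := by
      rw [show (2 : ℕ∞) = 1 + 1 by norm_num]; gcongr
    exact WithTop.coe_le_coe.2 this
  have e5 := ((C.contMDiffOn_φ.contMDiffAt (C.φ.open_source.mem_nhds hr)).of_le h4).comp z e4
  have e6 := (contMDiffAt_extChartAt' (I := 𝓘(ℝ, E4)) (n := 2) h3).comp z e5
  exact contMDiffAt_iff_contDiffAt.1 e6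

end ConformalExtension
namespace ConformalExtension

variable {n : ℕ∞} {S : Type*} [TopologicalSpace S] [ChartedSpace E3 S]
  [IsManifold 𝓘(ℝ, E3) ∞ S] {F : Model n S} {D : Set ℝ} {X : Type*} [TopologicalSpace X]
  [ChartedSpace E4 X] [IsManifold 𝓘(ℝ, E4) ∞ X]

/-- The integral curve of a transversal vector field through a point of `T = 0` lies in `T < 0`
before it reaches that point. -/
theorem exists_integralCurve (C : ConformalExtension F D X) {p : X} (hp : C.T p = 0)
    {ubar : ∀ p : X, TangentSpace 𝓘(ℝ, E4) p}
    (hu : ContMDiffAt 𝓘(ℝ, E4) (𝓘(ℝ, E4).prod 𝓘(ℝ, E4)) 1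
      (fun p : X => TotalSpace.mk' E4 (E := fun p : X => TangentSpace 𝓘(ℝ, E4) p) p (ubar p)) p)
    (hT : 0 < differential C.T p (ubar p)) {N : Set X} (hN : N ∈ 𝓝 p) :
    ∃ γ : ℝ → X, γ 0 = p ∧ (∀ᶠ s in 𝓝 0, HasMFDerivAt 𝓘(ℝ, ℝ) 𝓘(ℝ, E4) γ s
      ((1 : ℝ →L[ℝ] ℝ).smulRight (ubar (γ s)))) ∧
      ∃ ε < 0, ∀ s ∈ Ioo ε 0, HasMFDerivAt 𝓘(ℝ, ℝ) 𝓘(ℝ, E4) γ s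
        ((1 : ℝ →L[ℝ] ℝ).smulRight (ubar (γ s))) ∧ C.T (γ s) < 0 ∧ γ s ∈ N := by
  have : IsManifold 𝓘(ℝ, E4) 1 X := IsManifold.of_le (n := ∞) (by norm_num)
  obtain ⟨γ, hγ0, hγ⟩ := exists_isMIntegralCurveAt_of_contMDiffAt_boundaryless (t₀ := 0) hu
  replace hγ : ∀ᶠ s in 𝓝 (0 : ℝ), HasMFDerivAt 𝓘(ℝ, ℝ) 𝓘(ℝ, E4) γ s
      ((1 : ℝ →L[ℝ] ℝ).smulRight (ubar (γ s))) := hγ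
  refine ⟨γ, hγ0, hγ, ?_⟩
  have h0 := hγ.self_of_nhds
  have h1 : HasDerivAt (fun s => C.T (γ s)) (differential C.T (γ 0) (ubar (γ 0))) 0 :=
    hasDerivAt_comp_velocity ((C.cosmicTime.1 _).mdifferentiableAt (by simp)) h0
  rw [hγ0] at h1
  have h2 : ∀ᶠ s in 𝓝[<] (0 : ℝ), C.T (γ s) < 0 := by
    have h3 := (hasDerivAt_iff_tendsto_slope.1 h1).mono_left
      (nhdsWithin_mono _ fun x hx => ne_of_lt hx : 𝓝[<] (0 : ℝ) ≤ 𝓝[≠] 0)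
    filter_upwards [h3.eventually_const_lt hT, self_mem_nhdsWithin] with s hs hs0
    rw [slope_def_field, hγ0, hp, sub_zero, sub_zero] at hs
    have hs0' : s < 0 := hs0
    by_contra! h4
    exact absurd hs (not_lt.2 (div_nonpos_of_nonneg_of_nonpos h4 hs0'.le))
  have h3 : ∀ᶠ s in 𝓝 (0 : ℝ), γ s ∈ N := by
    have := h0.continuousAt
    exact this.eventually_mem (by rwa [hγ0])
  obtain ⟨ε, hε, h⟩ := mem_nhdsLT_iff_exists_Ioo_subset.1
    ((hγ.filter_mono nhdsWithin_le_nhds).and (h2.and (h3.filter_mono nhdsWithin_le_nhds)))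
  exact ⟨ε, hε, h⟩

/-- Along a fluid line that reaches `T = 0`, the time of the model tends to `sup I`. -/
theorem exists_le_time [T2Space X] (C : ConformalExtension F (Iio 0) X) {γ : ℝ → X} {ε : ℝ}
    (hε : ε < 0)
    (hγ : ContinuousAt γ 0) (hγ0 : C.T (γ 0) = 0) (hT : ∀ s ∈ Ioo ε 0, C.T (γ s) < 0)
    (hmono : MonotoneOn (fun s => (C.φ.symm (γ s)).1) (Ioo ε 0)) {s₀ : S}
    (hs₀ : ∀ s ∈ Ioo ε 0, (C.φ.symm (γ s)).2 = s₀) :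
    ∀ r ∈ F.I, ∃ s ∈ Ioo ε 0, r ≤ (C.φ.symm (γ s)).1 := by
  intro r hr
  by_contra! hcon
  set t := fun s => (C.φ.symm (γ s)).1 with ht
  have htar : ∀ s ∈ Ioo ε 0, γ s ∈ C.φ.target := fun s hs => by
    rw [C.target_φ]; exact hT s hs
  have hI : ∀ s ∈ Ioo ε 0, t s ∈ F.I := fun s hs => by
    have := C.φ.map_target (htar s hs)
    rw [C.source_φ] at this
    exact this.1
  have hbdd : BddAbove (t '' Ioo ε 0) := ⟨r, by rintro _ ⟨s, hs, rfl⟩; exact (hcon s hs).le⟩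
  -- If t stayed below some r in I, it would converge to a time inside I. By uniqueness of limits
  -- the curve would then end at a point of the model, where T < 0, instead of at T = 0.
  have hlim := MonotoneOn.tendsto_nhdsWithin_Ioo_left (nonempty_Ioo.2 hε) hmono hbdd
  obtain ⟨s₁, hs₁⟩ := nonempty_Ioo.2 hε
  have htI : sSup (t '' Ioo ε 0) ∈ F.I :=
    F.ordConnected_I.out (hI s₁ hs₁) hr ⟨le_csSup hbdd ⟨s₁, hs₁, rfl⟩,
      csSup_le ⟨_, s₁, hs₁, rfl⟩ (by rintro _ ⟨s, hs, rfl⟩; exact (hcon s hs).le)⟩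
  have hsrc : (sSup (t '' Ioo ε 0), s₀) ∈ C.φ.source := by
    rw [C.source_φ]; exact ⟨htI, mem_univ _⟩
  have h1 : Tendsto (fun s => C.φ (t s, s₀)) (𝓝[<] 0) (𝓝 (C.φ (sSup (t '' Ioo ε 0), s₀))) :=
    (C.φ.continuousAt hsrc).tendsto.comp (hlim.prodMk_nhds tendsto_const_nhds)
  have h2 : Tendsto (fun s => C.φ (t s, s₀)) (𝓝[<] 0) (𝓝 (γ 0)) := by
    refine (hγ.tendsto.mono_left nhdsWithin_le_nhds).congr' ?_
    filter_upwards [Ioo_mem_nhdsLT hε] with s hs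
    rw [← hs₀ s hs]
    exact (C.φ.right_inv (htar s hs)).symm
  have h3 := C.T_φ_mem hsrc
  rw [tendsto_nhds_unique h1 h2, hγ0] at h3
  exact absurd (mem_Iio.1 h3) (lt_irrefl _)

theorem pushCoord_fluid (C : ConformalExtension F D X) (s₀ : S) (z : ℝ × E3) :
    C.pushCoord s₀ z (1, 0) = mfderiv (𝓘(ℝ, ℝ).prod 𝓘(ℝ, E3)) 𝓘(ℝ, E4) C.φ
      (z.1, (extChartAt 𝓘(ℝ, E3) s₀).symm z.2)
      (Model.fluid (z.1, (extChartAt 𝓘(ℝ, E3) s₀).symm z.2)) := by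
  let A : E3 →L[ℝ] E3 := mfderiv 𝓘(ℝ, E3) 𝓘(ℝ, E3) (extChartAt 𝓘(ℝ, E3) s₀).symm z.2
  let B : ℝ × E3 →L[ℝ] E4 := mfderiv (𝓘(ℝ, ℝ).prod 𝓘(ℝ, E3)) 𝓘(ℝ, E4) C.φ
      (z.1, (extChartAt 𝓘(ℝ, E3) s₀).symm z.2)
  change B (1, A 0) = B (1, 0)
  rw [map_zero]

theorem mfderiv_extChartAt_symm_base (s₀ : S) (w : E3) :
    mfderiv 𝓘(ℝ, E3) 𝓘(ℝ, E3) (extChartAt 𝓘(ℝ, E3) s₀).symm (extChartAt 𝓘(ℝ, E3) s₀ s₀) w =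
      w := by
  have : IsManifold 𝓘(ℝ, E3) 1 S := IsManifold.of_le (n := ∞) (by norm_num)
  have h := mfderivWithin_range_extChartAt_symm (I := 𝓘(ℝ, E3)) (x := s₀)
  simp only [modelWithCornersSelf_coe, range_id, mfderivWithin_univ] at h
  exact DFunLike.congr_fun h w

theorem pushCoord_space (C : ConformalExtension F D X) (s₀ : S) (t : ℝ) (w : E3) :
    C.pushCoord s₀ (t, extChartAt 𝓘(ℝ, E3) s₀ s₀) (0, w) =
      mfderiv (𝓘(ℝ, ℝ).prod 𝓘(ℝ, E3)) 𝓘(ℝ, E4) C.φ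
      (t, (extChartAt 𝓘(ℝ, E3) s₀).symm (extChartAt 𝓘(ℝ, E3) s₀ s₀)) ((0, w) : ℝ × E3) := by
  let B : ℝ × E3 →L[ℝ] E4 := mfderiv (𝓘(ℝ, ℝ).prod 𝓘(ℝ, E3)) 𝓘(ℝ, E4) C.φ
      (t, (extChartAt 𝓘(ℝ, E3) s₀).symm (extChartAt 𝓘(ℝ, E3) s₀ s₀))
  exact congrArg (fun w : E3 => B (0, w)) (mfderiv_extChartAt_symm_base s₀ w)

end ConformalExtension
namespace Model

variable {n : ℕ∞} {S : Type*} [TopologicalSpace S] [ChartedSpace E3 S]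
  [IsManifold 𝓘(ℝ, E3) ∞ S]

theorem metric_fluid_space (F : Model n S) (r : ℝ × S) (w : E3) :
    F.metric r (fluid r) ((0, w) : ℝ × E3) = 0 := by
  let A : E3 →L[ℝ] E3 →L[ℝ] ℝ := F.σ.inner r.2
  change F.a r.1 ^ 2 * A 0 w - 1 * 0 = 0
  simp

theorem metric_space_space (F : Model n S) (r : ℝ × S) (w : E3) :
    F.metric r ((0, w) : ℝ × E3) ((0, w) : ℝ × E3) = F.σ.inner r.2 w w * F.a r.1 ^ 2 := by
  change F.a r.1 ^ 2 * F.σ.inner r.2 w w - 0 * 0 = _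
  ring

end Model

namespace ConformalExtension

variable {n : ℕ∞} {S : Type*} [TopologicalSpace S] [ChartedSpace E3 S]
  [IsManifold 𝓘(ℝ, E3) ∞ S] {F : Model n S} {D : Set ℝ} {X : Type*} [TopologicalSpace X]
  [ChartedSpace E4 X] [IsManifold 𝓘(ℝ, E4) ∞ X]

/-- A single point of T = 0 suffices: its fluid line sees all late times, and a depends on no other
coordinate. -/
theorem tendsto_of_fluidRegular (hn : 2 ≤ n) [T2Space X] (C : ConformalExtension F (Iio 0) X)
    (hΩ : FutureFactor C.Ω ⊤) (hC : C.FluidRegular) :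
    Tendsto (fun t : F.I => F.ratio t) atTop atTop ∧
      Tendsto (fun t : F.I => F.a t) atTop atTop := by
  obtain ⟨ubar, hunit, hfl, U', hU', hUT', hu⟩ := hC
  obtain ⟨U, hU, hUT, hg⟩ := C.regular_g
  obtain ⟨p, hp⟩ := C.nonempty_zero
  have hgp := hg.contMDiffAt (hU.mem_nhds (hUT hp))
  have hup := hu.contMDiffAt (hU'.mem_nhds (hUT' hp))
  have hfut := C.future_of_regular hunit hfl hp hup
  have hdT : 0 < differential C.T p (ubar p) :=
    C.cosmicTime.mfderiv_pos (C.regular_zero p hp) (by rw [hunit]; norm_num) hfut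
  obtain ⟨g', hg', hgc⟩ := exists_coord_form hgp
  obtain ⟨u', hu', huc⟩ := exists_coord_vectorField hup
  set κ := extChartAt 𝓘(ℝ, E4) p with hκ
  have hpκ : p ∈ (chartAt E4 p).source := mem_chart_source E4 p
  have hκs : κ.source = (chartAt E4 p).source := extChartAt_source 𝓘(ℝ, E4) p
  obtain ⟨c, hc0, hreg⟩ := hΩ.regular
  -- the neighbourhood of `p` in which the fluid line is followed
  have hκp : ContinuousAt κ p := continuousAt_extChartAt p
  have hu'd : ∀ᶠ y in 𝓝 (κ p), DifferentiableAt ℝ u' y :=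
    (hu'.eventually (by simp)).mono fun y hy => hy.differentiableAt (by norm_num)
  have hN : ∀ᶠ q in 𝓝 p, q ∈ (chartAt E4 p).source ∧ DifferentiableAt ℝ u' (κ q) ∧ c < C.T q :=
    (show ∀ᶠ q in 𝓝 p, q ∈ (chartAt E4 p).source from chart_source_mem_nhds E4 p).and
      ((hκp.eventually hu'd).and
      (C.cosmicTime.1.continuous.continuousAt.eventually_const_lt (by rwa [hp])))
  obtain ⟨γ, hγ0, hγ, ε, hε, hγε⟩ := C.exists_integralCurve hp (hup.of_le (by norm_num)) hdT hN
  have hline := fun s hs => C.hasMFDerivAt_φ_symm_comp hfl (hγε s hs).1 (hγε s hs).2.1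
  obtain ⟨s₁, hs₁⟩ := nonempty_Ioo.2 hε
  set t : ℝ → ℝ := fun s => (C.φ.symm (γ s)).1 with ht
  set s₀ : S := (C.φ.symm (γ s₁)).2 with hs₀
  have hs₀' : ∀ s ∈ Ioo ε 0, (C.φ.symm (γ s)).2 = s₀ := fun s hs =>
    eq_of_hasMFDerivAt_zero (fun s hs => (hline s hs).2) s hs s₁ hs₁
  have htar : ∀ s ∈ Ioo ε 0, γ s ∈ C.φ.target := fun s hs => by
    rw [C.target_φ]; exact (hγε s hs).2.1
  have htI : ∀ s ∈ Ioo ε 0, t s ∈ F.I := fun s hs => by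
    have := C.φ.map_target (htar s hs)
    rw [C.source_φ] at this
    exact this.1
  have hΩpos : ∀ s ∈ Ioo ε 0, 0 < C.Ω (C.T (γ s)) := fun s hs => C.Ω_pos _ (hγε s hs).2.1
  have htc : ContinuousOn t (Ioo ε 0) := fun s hs => (hline s hs).1.continuousAt.continuousWithinAt
  have htm : MonotoneOn t (Ioo ε 0) := by
    refine monotoneOn_of_deriv_nonneg (convex_Ioo _ _) htc ?_ ?_ <;> rw [interior_Ioo]
    · exact fun s hs => (hline s hs).1.differentiableAt.differentiableWithinAt
    · exact fun s hs => by rw [(hline s hs).1.deriv]; exact (hΩpos s hs).le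
  have hub := C.exists_le_time hε hγ.self_of_nhds.continuousAt (by rw [hγ0, hp])
    (fun s hs => (hγε s hs).2.1) htm hs₀'
  -- the comoving coordinates
  set e := extChartAt 𝓘(ℝ, E3) s₀ with he
  have hes : e.symm (e s₀) = s₀ := extChartAt_to_inv s₀
  have hpt : ∀ s ∈ Ioo ε 0, C.φ (t s, e.symm (e s₀)) = γ s := fun s hs => by
    rw [hes, ← hs₀' s hs]; exact C.φ.right_inv (htar s hs)
  have hsrc : ∀ s ∈ Ioo ε 0, (t s, e.symm (e s₀)) ∈ C.φ.source := fun s hs => by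
    rw [C.source_φ]; exact ⟨htI s hs, mem_univ _⟩
  set Ψ := C.coordMap p s₀ with hΨ
  have hΨγ : ∀ s ∈ Ioo ε 0, Ψ (t s, e s₀) = κ (γ s) := fun s hs => congrArg κ (hpt s hs)
  have hfluid : ∀ z : ℝ × E3, z.1 ∈ F.I → z.2 ∈ e.target →
      C.φ (z.1, e.symm z.2) ∈ (chartAt E4 p).source →
      fderiv ℝ Ψ z (1, 0) = (C.Ω (C.T (κ.symm (Ψ z))))⁻¹ • u' (Ψ z) := by
    intro z h1 h2 h3
    have hz : (z.1, e.symm z.2) ∈ C.φ.source := by rw [C.source_φ]; exact ⟨h1, mem_univ _⟩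
    have h4 : κ.symm (Ψ z) = C.φ (z.1, e.symm z.2) := κ.left_inv (by rwa [hκs])
    rw [C.fderiv_coordMap h1 h2 h3, C.pushCoord_fluid, h4]
    have h5 : ∀ (c : ℝ) (_ : c ≠ 0) (x y : E4), y = c • x → x = c⁻¹ • y := by
      rintro c hc x y rfl
      rw [inv_smul_smul₀ hc]
    refine h5 _ (C.Ω_pos _ (C.T_φ_mem hz)).ne' _ _ ((huc _ h3).trans ?_)
    rw [hfl _ hz, map_smul]
    rfl
  -- Any nonzero spatial vector will do. Constant in comoving coordinates, it has fixed length σ(w,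
  -- w), which is the constant c in Ω² G = c a².
  obtain ⟨w, hw⟩ := exists_ne (0 : E3)
  have hW : ∀ s ∈ Ioo ε 0, fderiv ℝ Ψ (t s, e s₀) (0, w) =
      mfderiv 𝓘(ℝ, E4) 𝓘(ℝ, E4) κ (C.φ (t s, e.symm (e s₀)))
        (mfderiv (𝓘(ℝ, ℝ).prod 𝓘(ℝ, E3)) 𝓘(ℝ, E4) C.φ (t s, e.symm (e s₀))
          ((0, w) : ℝ × E3)) := fun s hs => by
    rw [← C.pushCoord_space]
    exact C.fderiv_coordMap (htI s hs) (mem_extChartAt_target s₀)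
      (by rw [hpt s hs]; exact (hγε s hs).2.2.1) _
  have hqs : ∀ s ∈ Ioo ε 0, C.φ (t s, e.symm (e s₀)) ∈ (chartAt E4 p).source := fun s hs => by
    rw [hpt s hs]; exact (hγε s hs).2.2.1
  have horth : ∀ s ∈ Ioo ε 0,
      g' (κ (γ s)) (u' (κ (γ s))) (fderiv ℝ Ψ (t s, e s₀) (0, w)) = 0 := fun s hs => by
    rw [hW s hs, ← hpt s hs, huc _ (hqs s hs), hgc _ (hqs s hs), hfl _ (hsrc s hs), map_smul]
    have h1 := C.conformal _ (hsrc s hs) (Model.fluid _) ((0, w) : ℝ × E3)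
    rw [F.metric_fluid_space] at h1
    have h2 := C.Ω_pos _ (C.T_φ_mem (hsrc s hs))
    rw [smul_apply, smul_eq_mul, mul_eq_zero]
    right
    rcases mul_eq_zero.1 h1.symm with h3 | h3
    · exact absurd h3 (by positivity)
    · exact h3
  have hrel : ∀ s ∈ Ioo ε 0, C.Ω (C.T (κ.symm (κ (γ s)))) ^ 2 *
      g' (κ (γ s)) (fderiv ℝ Ψ (t s, e s₀) (0, w)) (fderiv ℝ Ψ (t s, e s₀) (0, w)) =
      F.σ.inner (e.symm (e s₀)) w w * F.a (t s) ^ 2 := fun s hs => by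
    rw [κ.left_inv (by rw [hκs]; exact (hγε s hs).2.2.1)]
    rw [hW s hs, ← hpt s hs, hgc _ (hqs s hs)]
    exact (C.conformal _ (hsrc s hs) _ _).symm.trans (F.metric_space_space _ w)
  have hcpos : 0 < F.σ.inner (e.symm (e s₀)) w w := F.σ.pos _ _ hw
  have hw0 : ∀ s ∈ Ioo ε 0, fderiv ℝ Ψ (t s, e s₀) (0, w) ≠ 0 := fun s hs h0 => by
    have h1 := hrel s hs
    rw [h0, map_zero, mul_zero] at h1
    have := F.a_pos _ (htI s hs)
    have : 0 < F.σ.inner (e.symm (e s₀)) w w * F.a (t s) ^ 2 := by positivity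
    linarith
  have hβ : ∀ s ∈ Ioo ε 0, ∃ β : ℝ, HasDerivAt (fun r => fderiv ℝ Ψ (t r, e s₀) (0, w))
      (fderiv ℝ u' (κ (γ s)) (fderiv ℝ Ψ (t s, e s₀) (0, w)) + β • u' (κ (γ s))) s := by
    intro s hs
    have hT2 : ContMDiffAt 𝓘(ℝ, E4) 𝓘(ℝ, E4) ∞ κ.symm (κ (γ s)) :=
      (contMDiffOn_extChartAt_symm p).contMDiffAt (extChartAt_target_mem_nhds'
        (κ.map_source (by rw [hκs]; exact (hγε s hs).2.2.1)))
    have hl : κ.symm (κ (γ s)) = γ s := κ.left_inv (by rw [hκs]; exact (hγε s hs).2.2.1)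
    -- Differentiability of Ω is available only close to T = 0; hence the condition c < T on the
    -- neighbourhood of p.
    have h3 : DifferentiableAt ℝ (fun y => C.Ω (C.T (κ.symm y))) (κ (γ s)) := by
      have h4 : DifferentiableAt ℝ (fun y => C.T (κ.symm y)) (κ (γ s)) :=
        (contMDiffAt_iff_contDiffAt.1 ((C.cosmicTime.1 _).comp _ hT2)).differentiableAt (by simp)
      refine DifferentiableAt.comp (g := C.Ω) (κ (γ s)) ?_ h4
      rw [hl]
      exact ((hreg _ ⟨(hγε s hs).2.2.2.2, (hγε s hs).2.1⟩).1).differentiableAt (by norm_num)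
    have h5 := hasDerivAt_comoving (Ψ := Ψ) (u := u') (f := fun y => C.Ω (C.T (κ.symm y)))
      (t := t) (s := s) (x := e s₀)
      (C.contDiffAt_coordMap (by exact le_trans (by norm_num) hn) (htI s hs)
        (mem_extChartAt_target s₀) (hqs s hs))
      (by rw [hΨγ s hs]; exact (hγε s hs).2.2.2.1) (by rw [hΨγ s hs]; exact h3)
      (by simp only [hΨγ s hs, hl]; exact (hΩpos s hs).ne') ?_
      (by simp only [hΨγ s hs, hl]; exact (hline s hs).1) w
    · simpa only [hΨγ s hs] using h5
    · have h6 : ContinuousAt (fun z : ℝ × E3 => C.φ (z.1, e.symm z.2)) (t s, e s₀) := by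
        refine ContinuousAt.comp (g := C.φ) (C.φ.continuousAt (hsrc s hs)) ?_
        refine continuousAt_fst.prodMk (ContinuousAt.comp (g := e.symm) ?_ continuousAt_snd)
        exact continuousAt_extChartAt_symm s₀
      filter_upwards [continuousAt_fst.eventually_mem (F.isOpen_I.mem_nhds (htI s hs)),
        continuousAt_snd.eventually_mem
          (show e.target ∈ 𝓝 (e s₀) from extChartAt_target_mem_nhds s₀),
        h6.eventually_mem ((chartAt E4 p).open_source.mem_nhds (hqs s hs))] with z h7 h8 h9
      exact hfluid z h7 h8 h9
  choose! β hβ using hβ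
  have hbase : ∀ v : TangentSpace 𝓘(ℝ, E4) p, mfderiv 𝓘(ℝ, E4) 𝓘(ℝ, E4) κ p v = v :=
    mfderiv_extChartAt_base p
  have hup' : u' (κ p) = ubar p := (huc p hpκ).trans (hbase _)
  have hgp' : ∀ v w : TangentSpace 𝓘(ℝ, E4) p, g' (κ p) v w = C.g p v w := fun v w => by
    have h1 := hgc p hpκ v w
    rw [hbase, hbase] at h1
    exact h1
  have hmain := hΩ.tendsto_along_fluid F.isOpen_I
    (F.contDiffOn_a.of_le (WithTop.coe_le_coe.2 hn)) F.a_pos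
    (T := C.T ∘ κ.symm) (y := fun s => κ (γ s)) hg' hu'
    (contDiffAt_comp_extChartAt_symm ((C.cosmicTime.1 p).of_le (WithTop.coe_le_coe.2 le_top)))
    (by simp [hκ, hp])
    (by rw [huc p hpκ, fderiv_comp_extChartAt_symm ((C.cosmicTime.1 p).mdifferentiableAt
          (by simp)) hpκ]; exact hdT)
    (fun v w => (hgp' v w).trans ((C.symm p v w).trans (hgp' w v).symm))
    (by
      filter_upwards [extChartAt_target_mem_nhds p] with y hy
      have hq : κ.symm y ∈ (chartAt E4 p).source := by
        rw [← hκs]; exact κ.map_target hy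
      have h1 := hgc _ hq (ubar _) (ubar _)
      rw [← huc _ hq, κ.right_inv hy, hunit] at h1
      exact h1)
    (fun w hw hw0 => by
      rw [hup'] at hw
      exact (C.pos_of_orthogonal (by rw [hunit]; norm_num) ((hgp' _ w).symm.trans hw)
        hw0).trans_eq (hgp' w w).symm)
    hε hcpos (by rw [hγ0])
    (by
      have h1 : ContinuousAt γ 0 := hγ.self_of_nhds.continuousAt
      filter_upwards [hγ, h1.eventually_mem (by rw [hγ0]; exact chart_source_mem_nhds E4 p)]
        with s hs hs1
      rw [huc _ hs1]
      exact hasDerivAt_comp_velocity (mdifferentiableAt_extChartAt hs1) hs)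
    (fun s hs => by
      simp only [Function.comp_apply]
      rw [κ.left_inv (by rw [hκs]; exact (hγε s hs).2.2.1)]
      exact (hγε s hs).2.1) htI
    (fun s hs => by
      simp only [Function.comp_apply]
      rw [κ.left_inv (by rw [hκs]; exact (hγε s hs).2.2.1)]
      exact (hline s hs).1)
    hβ hw0 horth hrel
  exact ⟨tendsto_atTop_of_tendsto_comp hε htI htc htm hub hmain.2,
    tendsto_atTop_of_tendsto_comp hε htI htc htm hub hmain.1⟩

end ConformalExtension
-- Time reversal
theorem deriv_deriv_comp_neg (f : ℝ → ℝ) (x : ℝ) :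
    deriv (deriv fun y => f (-y)) x = deriv (deriv f) (-x) := by
  have h : (deriv fun y => f (-y)) = fun y => -deriv f (-y) := funext fun y => deriv_comp_neg f y
  rw [h, deriv.fun_neg, deriv_comp_neg (deriv f), neg_neg]

theorem bigL_comp_neg (Ω : ℝ → ℝ) (T : ℝ) : bigL (fun x => Ω (-x)) T = bigL Ω (-T) := by
  rw [bigL, bigL, deriv_deriv_comp_neg, deriv_comp_neg, div_neg, neg_sq]

theorem PastFactor.comp_neg {Ω : ℝ → ℝ} {lam : EReal} (h : PastFactor Ω lam) :
    FutureFactor (fun x => Ω (-x)) lam := by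
  obtain ⟨h1, ⟨c, hc, h2, h3, h4, h5, h6⟩, h7, h8⟩ := h
  have hn : Tendsto (fun x : ℝ => -x) (𝓝[<] 0) (𝓝[>] 0) := by
    simpa using tendsto_neg_nhdsLT (a := (0 : ℝ))
  have hm : ∀ T ∈ Ico (-c) 0, -T ∈ Ioc 0 c := fun T hT =>
    ⟨by linarith [hT.2], by linarith [hT.1]⟩
  refine ⟨h1.comp hn, ⟨c, hc, h2.comp contDiff_neg.contDiffOn hm, fun x hx y hy hxy => ?_,
    fun T hT => h4 _ (hm T hT), fun T hT => ?_, ?_⟩, ?_, h8⟩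
  · exact h3 (hm y hy) (hm x hx) (neg_lt_neg hxy)
  · rw [deriv_comp_neg]
    exact neg_ne_zero.2 (h5 _ (hm T hT))
  · exact (h6.comp continuousOn_neg hm).congr fun T _ => bigL_comp_neg Ω T
  · simp only [bigL_comp_neg]
    exact h7.comp hn

theorem FutureFactor.comp_neg {Ω : ℝ → ℝ} {lam : EReal} (h : FutureFactor Ω lam) :
    PastFactor (fun x => Ω (-x)) lam := by
  obtain ⟨h1, ⟨c, hc, h2, h3, h4, h5, h6⟩, h7, h8⟩ := h
  have hn : Tendsto (fun x : ℝ => -x) (𝓝[>] 0) (𝓝[<] 0) := by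
    simpa using tendsto_neg_nhdsGT (a := (0 : ℝ))
  have hm : ∀ T ∈ Ioc 0 c, -T ∈ Ico (-c) 0 := fun T hT =>
    ⟨by linarith [hT.2], by linarith [hT.1]⟩
  refine ⟨h1.comp hn, ⟨c, hc, h2.comp contDiff_neg.contDiffOn hm, fun x hx y hy hxy => ?_,
    fun T hT => h4 _ (hm T hT), fun T hT => ?_, ?_⟩, ?_, h8⟩
  · exact h3 (hm y hy) (hm x hx) (neg_lt_neg hxy)
  · rw [deriv_comp_neg]
    exact neg_ne_zero.2 (h5 _ (hm T hT))
  · exact (h6.comp continuousOn_neg hm).congr fun T _ => bigL_comp_neg Ω T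
  · simp only [bigL_comp_neg]
    exact h7.comp hn

namespace Model

variable {n : ℕ∞} {S : Type*} [TopologicalSpace S] [ChartedSpace E3 S]
  [IsManifold 𝓘(ℝ, E3) ∞ S]

/-- The time-reversed model. -/
noncomputable def rev (F : Model n S) : Model n S where
  I := Neg.neg ⁻¹' F.I
  isOpen_I := F.isOpen_I.preimage continuous_neg
  ordConnected_I := by
    refine ⟨fun x hx y hy z hz => ?_⟩
    exact F.ordConnected_I.out hy hx ⟨neg_le_neg hz.2, neg_le_neg hz.1⟩
  nonempty_I := by
    obtain ⟨t, ht⟩ := F.nonempty_I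
    exact ⟨-t, by simpa using ht⟩
  a := fun t => F.a (-t)
  contDiffOn_a := F.contDiffOn_a.comp contDiff_neg.contDiffOn fun _ => id
  a_pos := fun t ht => F.a_pos _ ht
  k := F.k
  k_mem := F.k_mem
  σ := F.σ
  curvature := F.curvature

theorem rev_rev (F : Model n S) : F.rev.rev = F := by
  cases F
  simp [rev]

theorem ratio_rev (F : Model n S) (t : ℝ) : F.rev.ratio t = F.ratio (-t) := by
  change deriv (deriv fun t => F.a (-t)) t * F.a (-t) / (deriv (fun t => F.a (-t)) t) ^ 2 = _
  rw [deriv_deriv_comp_neg, deriv_comp_neg, neg_sq]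
  rfl

/-- Negation is an order isomorphism of the reversed interval onto the order dual of I, so it
carries one end filter to the other. -/
theorem tendsto_rev_iff (F : Model n S) {f : ℝ → ℝ} {l : Filter ℝ} :
    Tendsto (fun t : F.rev.I => f (-t)) atTop l ↔ Tendsto (fun t : F.I => f t) atBot l := by
  let e : F.rev.I ≃o (F.I)ᵒᵈ :=
    { toFun := fun t => OrderDual.toDual ⟨-t, t.2⟩
      invFun := fun t => ⟨-(OrderDual.ofDual t : F.I), by
        change - -((OrderDual.ofDual t : F.I) : ℝ) ∈ F.I
        rw [neg_neg]; exact (OrderDual.ofDual t).2⟩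
      left_inv := fun t => Subtype.ext (neg_neg _)
      right_inv := fun t => congrArg OrderDual.toDual (Subtype.ext (neg_neg _))
      map_rel_iff' := fun {x y} => by
        change -(y : ℝ) ≤ -(x : ℝ) ↔ (x : ℝ) ≤ y
        exact neg_le_neg_iff }
  have h : map e atTop = atTop := e.map_atTop
  have h' : Tendsto (fun t : (F.I)ᵒᵈ => f (OrderDual.ofDual t : F.I)) atTop l ↔
      Tendsto (fun t : F.rev.I => f (-t)) atTop l := by
    rw [← h, tendsto_map'_iff]
    rfl
  exact h'.symm

end Model

section Flip

variable {S : Type*} [TopologicalSpace S]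

/-- Reflection of the time coordinate. -/
def flip : ℝ × S ≃ₜ ℝ × S := (Homeomorph.neg ℝ).prodCongr (Homeomorph.refl S)

variable [ChartedSpace E3 S]

theorem contMDiff_flip {k : WithTop ℕ∞} :
    ContMDiff (𝓘(ℝ, ℝ).prod 𝓘(ℝ, E3)) (𝓘(ℝ, ℝ).prod 𝓘(ℝ, E3)) k (flip : ℝ × S → ℝ × S) :=
  (contDiff_neg.contMDiff.comp contMDiff_fst).prodMk contMDiff_snd

/-- The tangent vector of the reflected time. -/
def flipVec {p : ℝ × S} (v : TanProd p) : TanProd (flip p) :=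
  let v' : ℝ × E3 := v
  ((-v'.1, v'.2) : ℝ × E3)

theorem mfderiv_flip (p : ℝ × S) (v : TanProd p) :
    mfderiv (𝓘(ℝ, ℝ).prod 𝓘(ℝ, E3)) (𝓘(ℝ, ℝ).prod 𝓘(ℝ, E3)) flip p v = flipVec v := by
  have h1 : HasMFDerivAt (𝓘(ℝ, ℝ).prod 𝓘(ℝ, E3)) 𝓘(ℝ, ℝ) (fun p : ℝ × S => -p.1) p
      (-ContinuousLinearMap.fst ℝ ℝ E3 : ℝ × E3 →L[ℝ] ℝ) :=
    (hasMFDerivAt_fst (I := 𝓘(ℝ, ℝ)) (I' := 𝓘(ℝ, E3)) p).neg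
  have h2 := h1.prodMk (hasMFDerivAt_snd (I := 𝓘(ℝ, ℝ)) (I' := 𝓘(ℝ, E3)) p)
  exact DFunLike.congr_fun h2.mfderiv v

theorem flipVec_fluid (p : ℝ × S) :
    flipVec (Model.fluid p) = -Model.fluid (flip p) := by
  change ((-1, 0) : ℝ × E3) = -((1, 0) : ℝ × E3)
  simp

theorem Model.metric_rev [IsManifold 𝓘(ℝ, E3) ∞ S] {n : ℕ∞} (F : Model n S)
    (p : ℝ × S) (v w : TanProd p) :
    F.rev.metric p v w = F.metric (flip p) (flipVec v) (flipVec w) := by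
  let v' : ℝ × E3 := v
  let w' : ℝ × E3 := w
  change F.a (-p.1) ^ 2 * F.σ.inner p.2 v'.2 w'.2 - v'.1 * w'.1 =
    F.a (-p.1) ^ 2 * F.σ.inner p.2 v'.2 w'.2 - (-v'.1) * (-w'.1)
  ring

end Flip

section

variable {X : Type*} [TopologicalSpace X] [ChartedSpace E4 X] [IsManifold 𝓘(ℝ, E4) ∞ X]

/-- The spacetime with the opposite time orientation. -/
noncomputable def Spacetime.rev (G : Spacetime X) : Spacetime X where
  g := G.g
  symm := G.symm
  lorentzian := G.lorentzian
  continuous_g := G.continuous_g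
  timeDir := fun p => -G.timeDir p
  continuous_timeDir := G.continuous_timeDir.neg_section
  timelike_timeDir := fun p => by simpa using G.timelike_timeDir p

theorem Spacetime.FutureCausal.rev {G : Spacetime X} {p : X} {v : TangentSpace 𝓘(ℝ, E4) p}
    (h : G.FutureCausal p v) : G.rev.FutureCausal p (-v) := by
  refine ⟨neg_ne_zero.2 h.1, ?_, ?_⟩
  · change G.g p (-v) (-v) ≤ 0
    simpa using h.2.1
  · change G.g p (-v) (-G.timeDir p) < 0
    simpa using h.2.2

theorem Spacetime.futureCausal_neg_of_rev {G : Spacetime X} {p : X} {v : TangentSpace 𝓘(ℝ, E4) p}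
    (h : G.rev.FutureCausal p v) : G.FutureCausal p (-v) := by
  refine ⟨neg_ne_zero.2 h.1, ?_, ?_⟩
  · have : G.g p v v ≤ 0 := h.2.1
    simpa using this
  · have : G.g p v (-G.timeDir p) < 0 := h.2.2
    simpa using this

theorem Spacetime.IsFutureCausalCurve.comp_neg {G : Spacetime X} {γ : ℝ → X} {α β : ℝ}
    (h : G.rev.IsFutureCausalCurve γ α β) :
    G.IsFutureCausalCurve (fun s => γ (-s)) (-β) (-α) := by
  have hm : ∀ s ∈ Ioo (-β) (-α), -s ∈ Ioo α β := fun s hs =>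
    ⟨by linarith [hs.2], by linarith [hs.1]⟩
  refine ⟨h.1.comp contDiff_neg.contMDiff.contMDiffOn hm, fun s hs => ?_⟩
  have h1 : MDifferentiableAt 𝓘(ℝ, ℝ) 𝓘(ℝ, E4) γ (-s) :=
    (h.1.contMDiffAt (Ioo_mem_nhds (hm s hs).1 (hm s hs).2)).mdifferentiableAt (by norm_num)
  have h2 : HasMFDerivAt 𝓘(ℝ, ℝ) 𝓘(ℝ, ℝ) (fun s : ℝ => -s) s (-ContinuousLinearMap.id ℝ ℝ) :=
    (hasFDerivAt_id s).neg.hasMFDerivAt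
  have h3 := (h1.hasMFDerivAt.comp s h2).mfderiv
  have h4 : mfderiv 𝓘(ℝ, ℝ) 𝓘(ℝ, E4) (fun s => γ (-s)) s (1 : ℝ) =
      -mfderiv 𝓘(ℝ, ℝ) 𝓘(ℝ, E4) γ (-s) (1 : ℝ) := by
    let A : ℝ →L[ℝ] E4 := mfderiv 𝓘(ℝ, ℝ) 𝓘(ℝ, E4) γ (-s)
    exact (DFunLike.congr_fun h3 (1 : ℝ)).trans (A.map_neg 1)
  rw [h4]
  exact futureCausal_neg_of_rev (h.2 _ (hm s hs))

theorem Spacetime.IsSmoothCosmicTime.rev {G : Spacetime X} {T : X → ℝ}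
    (hT : G.IsSmoothCosmicTime T) : G.rev.IsSmoothCosmicTime (fun p => -T p) := by
  refine ⟨contDiff_neg.contMDiff.comp hT.1, fun γ α β h x hx y hy hxy => ?_⟩
  have h0 := hT.2 _ _ _ h.comp_neg
  have h1 := h0 ⟨neg_lt_neg hy.2, neg_lt_neg hy.1⟩ ⟨neg_lt_neg hx.2, neg_lt_neg hx.1⟩
    (neg_lt_neg hxy)
  simp only [Function.comp_apply, neg_neg] at h1
  exact neg_lt_neg h1

end

section

variable {n : ℕ∞} {S : Type*} [TopologicalSpace S] [ChartedSpace E3 S]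
  [IsManifold 𝓘(ℝ, E3) ∞ S] {F : Model n S} {D D' : Set ℝ} {X : Type*} [TopologicalSpace X]
  [ChartedSpace E4 X] [IsManifold 𝓘(ℝ, E4) ∞ X]

theorem ConformalExtension.mfderiv_flip_trans (C : ConformalExtension F D X) {p : ℝ × S}
    (hp : flip p ∈ C.φ.source) (v : TanProd p) :
    mfderiv (𝓘(ℝ, ℝ).prod 𝓘(ℝ, E3)) 𝓘(ℝ, E4) (flip.transOpenPartialHomeomorph C.φ) p v =
      mfderiv (𝓘(ℝ, ℝ).prod 𝓘(ℝ, E3)) 𝓘(ℝ, E4) C.φ (flip p) (flipVec v) := by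
  have h := (C.mdifferentiable_φ.mdifferentiableAt hp).hasMFDerivAt.comp p
    ((contMDiff_flip (k := 1) p).mdifferentiableAt (by norm_num)).hasMFDerivAt
  rw [← mfderiv_flip]
  exact DFunLike.congr_fun h.mfderiv v

/-- The time-reversed extension. -/
noncomputable def ConformalExtension.rev (C : ConformalExtension F D X)
    (hD : ∀ x, x ∈ D' ↔ -x ∈ D) : ConformalExtension F.rev D' X where
  toSpacetime := C.toSpacetime.rev
  T := fun p => -C.T p
  cosmicTime := C.cosmicTime.rev
  nonempty_zero := by
    obtain ⟨p, hp⟩ := C.nonempty_zero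
    exact ⟨p, by simp [hp]⟩
  regular_zero := fun p hp h => by
    refine C.regular_zero p (neg_eq_zero.1 hp) ?_
    have h1 : mfderiv 𝓘(ℝ, E4) 𝓘(ℝ, ℝ) (-C.T) p = -mfderiv 𝓘(ℝ, E4) 𝓘(ℝ, ℝ) C.T p :=
      mfderiv_neg
    exact neg_eq_zero.1 (h1.symm.trans h)
  φ := flip.transOpenPartialHomeomorph C.φ
  source_φ := by
    change flip ⁻¹' C.φ.source = (Neg.neg ⁻¹' F.I) ×ˢ univ
    rw [C.source_φ]
    rfl
  target_φ := by
    change C.φ.target = _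
    rw [C.target_φ]
    ext p
    simp [hD]
  contMDiffOn_φ := C.contMDiffOn_φ.comp contMDiff_flip.contMDiffOn fun _ => id
  contMDiffOn_φ_symm := contMDiff_flip.comp_contMDiffOn C.contMDiffOn_φ_symm
  future_φ := fun p hp => by
    rw [C.mfderiv_flip_trans hp, flipVec_fluid, map_neg]
    exact (C.future_φ (flip p) hp).rev
  Ω := fun x => C.Ω (-x)
  Ω_pos := fun p hp => by
    have h1 := (hD _).1 hp
    rw [neg_neg] at h1 ⊢
    exact C.Ω_pos p h1
  conformal := fun p hp v w => by
    rw [C.mfderiv_flip_trans hp, C.mfderiv_flip_trans hp, F.metric_rev]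
    refine (C.conformal (flip p) hp _ _).trans ?_
    simp only [neg_neg]
    rfl
  regular_g := by
    obtain ⟨U, hU, h1, h2⟩ := C.regular_g
    exact ⟨U, hU, fun p hp => h1 (neg_eq_zero.1 hp), h2⟩

/-- Reflection sends ∂/∂t to its negative, so -ū is the field that equals Ω u for the reversed
model. -/
theorem ConformalExtension.FluidRegular.rev {C : ConformalExtension F D X}
    (hC : C.FluidRegular) (hD : ∀ x, x ∈ D' ↔ -x ∈ D) : (C.rev hD).FluidRegular := by
  obtain ⟨ubar, h1, h2, U, hU, h3, h4⟩ := hC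
  refine ⟨fun p => -ubar p, fun p => ?_, fun p hp => ?_, U, hU,
    fun p hp => h3 (neg_eq_zero.1 hp), h4.neg_section⟩
  · change C.g p (-ubar p) (-ubar p) = -1
    simpa using h1 p
  · have h5 := C.mfderiv_flip_trans hp (Model.fluid p)
    rw [flipVec_fluid, map_neg] at h5
    have h6 := h2 (flip p) hp
    change -ubar (C.φ (flip p)) = C.Ω (- -C.T (C.φ (flip p))) •
      mfderiv (𝓘(ℝ, ℝ).prod 𝓘(ℝ, E3)) 𝓘(ℝ, E4) (flip.transOpenPartialHomeomorph C.φ) p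
        (Model.fluid p)
    rw [neg_neg]
    refine (congrArg Neg.neg h6).trans (Eq.trans ?_
      (congrArg (fun v : E4 => C.Ω (C.T (C.φ (flip p))) • v) h5).symm)
    exact (smul_neg (M := ℝ) (A := E4) _ _).symm

end

section

variable {n : ℕ∞} {S : Type u} [TopologicalSpace S] [ChartedSpace E3 S]
  [IsManifold 𝓘(ℝ, E3) ∞ S]

/-- Reversing t, T, the time orientation and ū together exchanges T > 0 with T < 0. Since reversing
the model twice restores it, one construction serves both implications. -/
theorem Model.admitsPIU_iff_rev (F : Model n S) (lam : EReal) :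
    F.AdmitsPIU lam ↔ F.rev.AdmitsFIU lam := by
  constructor
  · rintro ⟨X, i1, i2, i3, i4, i5, i6, C, h1, h2⟩
    exact ⟨X, i1, i2, i3, i4, i5, i6, C.rev (D' := Iio 0) fun x => by simp, h1.comp_neg, h2.rev _⟩
  · rintro ⟨X, i1, i2, i3, i4, i5, i6, C, h1, h2⟩
    rw [← F.rev_rev]
    exact ⟨X, i1, i2, i3, i4, i5, i6, C.rev (D' := Ioi 0) fun x => by simp, h1.comp_neg, h2.rev _⟩

end

/-! ### Conformal time -/

/-- A function with positive derivative on an open interval, as a partial homeomorphism. -/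
theorem exists_openPartialHomeomorph_of_deriv_pos {f : ℝ → ℝ} {I : Set ℝ} {k : WithTop ℕ∞}
    (hI : IsOpen I) (hI' : I.OrdConnected) (hk : 1 ≤ k) (hf : ContDiffOn ℝ k f I)
    (hpos : ∀ t ∈ I, 0 < deriv f t) :
    ∃ e : OpenPartialHomeomorph ℝ ℝ, ⇑e = f ∧ e.source = I ∧ e.target = f '' I ∧
      ContDiffOn ℝ k e.symm e.target ∧
      ∀ t ∈ I, HasDerivAt e.symm (deriv f t)⁻¹ (f t) := by
  have hk0 : k ≠ 0 := fun h => by simp [h] at hk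
  have hat : ∀ t ∈ I, ContDiffAt ℝ k f t := fun t ht => hf.contDiffAt (hI.mem_nhds ht)
  have hmono : StrictMonoOn f I :=
    strictMonoOn_of_deriv_pos hI'.convex hf.continuousOn (by rwa [hI.interior_eq])
  have hstrict : ∀ t ∈ I, HasStrictDerivAt f (deriv f t) t := fun t ht =>
    (hat t ht).hasStrictDerivAt hk0
  have hopen : IsOpenMap ((hmono.injOn.toPartialEquiv f I).source.domRestrict
      (hmono.injOn.toPartialEquiv f I)) := by
    refine isOpenMap_iff_nhds_le.2 fun x => ?_
    have h1 := (hstrict x x.2).map_nhds_eq (hpos x x.2).ne'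
    have h2 : map ((↑) : I → ℝ) (𝓝 x) = 𝓝 (x : ℝ) :=
      (map_nhds_subtype_val _).trans (hI.nhdsWithin_eq x.2)
    change 𝓝 (f x) ≤ map (f ∘ ((↑) : I → ℝ)) (𝓝 x)
    rw [← Filter.map_map, h2, h1]
  let e := OpenPartialHomeomorph.ofContinuousOpenRestrict (hmono.injOn.toPartialEquiv f I)
    hf.continuousOn hopen hI
  have hinv : ∀ t ∈ I, e.symm (f t) = t := fun t ht => e.left_inv ht
  have htar : ∀ t ∈ I, f t ∈ e.target := fun t ht => e.map_source ht
  refine ⟨e, rfl, rfl, rfl, ?_, fun t ht => ?_⟩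
  · rintro _ ⟨t, ht, rfl⟩
    refine (e.contDiffAt_symm_deriv (f₀' := deriv f t) (hpos t ht).ne' (htar t ht) ?_
      ?_).contDiffWithinAt
    · rw [hinv t ht]; exact (hstrict t ht).hasDerivAt
    · rw [hinv t ht]; exact hat t ht
  · refine e.hasDerivAt_symm (htar t ht) (hpos t ht).ne' ?_
    rw [hinv t ht]; exact (hstrict t ht).hasDerivAt

/-- An interval of negative numbers with supremum `0` is the image of the negative numbers under
a diffeomorphism of `ℝ` onto its image that fixes `0`. -/
theorem exists_reparametrization {J : Set ℝ} (hJ : IsOpen J) (hJ' : J.OrdConnected)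
    (hneg : J ⊆ Iio 0) (hsup : ∀ x < 0, ∃ y ∈ J, x < y) :
    ∃ h : ℝ → ℝ, ContDiff ℝ ∞ h ∧ h 0 = 0 ∧ (∀ y, 0 < deriv h y) ∧ h '' Iio 0 = J := by
  have hup : ∀ y ∈ J, ∀ x < 0, y ≤ x → x ∈ J := fun y hy x hx hyx => by
    obtain ⟨z, hz, hxz⟩ := hsup x hx
    exact hJ'.out hy hz ⟨hyx, hxz.le⟩
  obtain ⟨y₀, hy₀, -⟩ := hsup (-1) (by norm_num)
  -- J is either (m, 0) or all of (-∞, 0). In the first case y ↦ -m (exp y - 1) maps ℝ onto (m, ∞)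
  -- and fixes 0; in the second the identity works.
  by_cases hb : BddBelow J
  · set m := sInf J with hm
    have hm0 : m < 0 := (csInf_le hb hy₀).trans_lt (hneg hy₀)
    have hmem : ∀ x, x ∈ J ↔ m < x ∧ x < 0 := by
      refine fun x => ⟨fun hx => ⟨?_, hneg hx⟩, fun hx => ?_⟩
      · obtain ⟨z, hz, hzx⟩ := (hJ.mem_nhds hx |> mem_nhds_iff_exists_Ioo_subset.1)
        obtain ⟨v, hv⟩ := exists_between hzx.1.1
        exact (csInf_le hb (hzx.2 ⟨hv.1, hv.2.trans hzx.1.2⟩)).trans_lt hv.2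
      · obtain ⟨y, hy, hyx⟩ := exists_lt_of_csInf_lt ⟨y₀, hy₀⟩ hx.1
        exact hup y hy x hx.2 hyx.le
    have hd : ∀ y, HasDerivAt (fun y => -m * (Real.exp y - 1)) (-m * Real.exp y) y := fun y =>
      ((Real.hasDerivAt_exp y).sub_const 1).const_mul (-m)
    refine ⟨fun y => -m * (Real.exp y - 1), ?_, by simp, fun y => ?_, ?_⟩
    · exact contDiff_const.mul (Real.contDiff_exp.sub contDiff_const)
    · rw [(hd y).deriv]
      exact mul_pos (neg_pos.2 hm0) (Real.exp_pos y)
    · ext x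
      rw [hmem]
      constructor
      · rintro ⟨y, hy, rfl⟩
        have h1 := Real.exp_pos y
        have h2 : Real.exp y < 1 := by simpa using hy
        constructor <;> nlinarith
      · rintro ⟨h1, h2⟩
        have h3 : 0 < 1 - x / m := by
          rw [sub_pos, div_lt_one_of_neg hm0]; exact h1
        have h4 : 1 - x / m < 1 := by
          have := div_pos_of_neg_of_neg h2 hm0
          linarith
        refine ⟨Real.log (1 - x / m), Real.log_neg h3 h4, ?_⟩
        simp only [Real.exp_log h3]
        have := hm0.ne
        field_simp
        ring
  · refine ⟨fun y => y, contDiff_id, rfl, fun y => by simp, ?_⟩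
    rw [image_id']
    refine Subset.antisymm (fun x hx => ?_) hneg
    rw [not_bddBelow_iff] at hb
    obtain ⟨y, hy, hyx⟩ := hb x
    exact hup y hy x hx hyx.le

/-- A primitive on an open interval. -/
theorem exists_primitive {f : ℝ → ℝ} {I : Set ℝ} (hI : IsOpen I) (hI' : I.OrdConnected)
    (hne : I.Nonempty) (hf : ContinuousOn f I) :
    ∃ η : ℝ → ℝ, ∀ t ∈ I, HasDerivAt η (f t) t := by
  obtain ⟨t₀, ht₀⟩ := hne
  refine ⟨fun t => ∫ x in t₀..t, f x, fun t ht => ?_⟩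
  refine intervalIntegral.integral_hasDerivAt_right ?_ ?_ (hf.continuousAt (hI.mem_nhds ht))
  · exact (hf.mono (hI'.uIcc_subset ht₀ ht)).intervalIntegrable
  · exact hf.stronglyMeasurableAtFilter hI t ht

section

variable {I : Set ℝ} {a : ℝ → ℝ}

theorem exists_forall_ge_of_eventually_atTop (hne : I.Nonempty) {P : ℝ → Prop}
    (h : ∀ᶠ t : I in atTop, P t) : ∃ t₁ ∈ I, ∀ t ∈ I, t₁ ≤ t → P t := by
  have : Nonempty I := hne.to_subtype
  obtain ⟨t₁, h1⟩ := eventually_atTop.1 h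
  exact ⟨t₁, t₁.2, fun t ht hle => h1 ⟨t, ht⟩ hle⟩

/-- The model is eventually expanding. -/
theorem exists_deriv_pos (hI : IsOpen I) (hI' : I.OrdConnected) (hne : I.Nonempty)
    (ha : ContDiffOn ℝ 2 a I)
    (hr : Tendsto (fun t : I => deriv (deriv a) t * a t / deriv a t ^ 2) atTop atTop)
    (hat : Tendsto (fun t : I => a t) atTop atTop) :
    ∃ t₁ ∈ I, ∀ t ∈ I, t₁ ≤ t →
      0 < deriv a t ∧ 1 ≤ deriv (deriv a) t * a t / deriv a t ^ 2 := by
  obtain ⟨t₁, ht₁, h1⟩ := exists_forall_ge_of_eventually_atTop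
    (P := fun t => 1 ≤ deriv (deriv a) t * a t / deriv a t ^ 2) hne (hr.eventually_ge_atTop 1)
  refine ⟨t₁, ht₁, fun t ht hle => ⟨?_, h1 t ht hle⟩⟩
  -- At a zero of ȧ the quotient takes the default value 0 of division by zero, which is below 1.
  have hne0 : ∀ s ∈ I, t₁ ≤ s → deriv a s ≠ 0 := fun s hs hts h0 => by
    have := h1 s hs hts
    rw [h0] at this
    norm_num at this
  by_contra! hneg
  have hlt : deriv a t < 0 := lt_of_le_of_ne hneg (hne0 t ht hle)
  have hc : ContinuousOn (deriv a) I := ha.continuousOn_deriv_of_isOpen hI (by norm_num)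
  -- Without zeros ȧ keeps its sign; a negative sign would make a decrease from t on, against a →
  -- +∞.
  have hall : ∀ s ∈ I, t ≤ s → deriv a s < 0 := fun s hs hts => by
    by_contra! h2
    have hsub : Icc t s ⊆ I := hI'.out ht hs
    obtain ⟨x, hx, hx0⟩ := intermediate_value_Icc hts (hc.mono hsub) ⟨hlt.le, h2⟩
    exact hne0 x (hsub hx) (hle.trans hx.1) hx0
  have hanti : StrictAntiOn a (I ∩ Ici t) :=
    strictAntiOn_of_deriv_neg (hI'.inter ordConnected_Ici).convex
      (ha.continuousOn.mono inter_subset_left)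
      fun x hx => hall x (interior_subset hx).1 (interior_subset hx).2
  obtain ⟨t₂, ht₂, h2⟩ := exists_forall_ge_of_eventually_atTop
    (P := fun s => a t + 1 ≤ a s) hne (hat.eventually_ge_atTop (a t + 1))
  have hmax : max t t₂ ∈ I := by
    rcases max_choice t t₂ with h | h <;> rw [h] <;> assumption
  have h3 := h2 _ hmax (le_max_right _ _)
  have h4 := hanti.antitoneOn ⟨ht, self_mem_Ici⟩ ⟨hmax, le_max_left t t₂⟩ (le_max_left t t₂)
  linarith

/-- Conformal time, normalized so that its supremum is `0`. -/
theorem exists_conformalTime (hI : IsOpen I) (hI' : I.OrdConnected) (hne : I.Nonempty)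
    (ha : ContDiffOn ℝ 2 a I) (ha0 : ∀ t ∈ I, 0 < a t)
    (hr : Tendsto (fun t : I => deriv (deriv a) t * a t / deriv a t ^ 2) atTop atTop)
    (hat : Tendsto (fun t : I => a t) atTop atTop) :
    ∃ η : ℝ → ℝ, (∀ t ∈ I, HasDerivAt η (a t)⁻¹ t) ∧ (∀ t ∈ I, η t < 0) ∧
      ∀ x < 0, ∃ t ∈ I, x < η t := by
  obtain ⟨η, hη⟩ := exists_primitive hI hI' hne (ha.continuousOn.inv₀ fun t ht => (ha0 t ht).ne')
  obtain ⟨t₁, ht₁, h1⟩ := exists_deriv_pos hI hI' hne ha hr hat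
  have hmono : StrictMonoOn η I :=
    strictMonoOn_of_deriv_pos hI'.convex (fun t ht => (hη t ht).continuousAt.continuousWithinAt)
      fun t ht => by
        rw [hI.interior_eq] at ht
        rw [(hη t ht).deriv]
        exact inv_pos.2 (ha0 t ht)
  -- The function η + 1/ȧ has derivative 1/a - ä/ȧ², nonpositive exactly because ä a/ȧ² ≥ 1. As 1/ȧ
  -- > 0, its value at t₁ bounds η from above.
  have hbdd : ∀ t ∈ I, η t ≤ η t₁ + (deriv a t₁)⁻¹ := by
    have hpos1 := inv_pos.2 (h1 t₁ ht₁ le_rfl).1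
    have hd : ∀ t ∈ I, t₁ ≤ t → HasDerivAt (fun t => η t + (deriv a t)⁻¹)
        ((a t)⁻¹ + -deriv (deriv a) t / deriv a t ^ 2) t := fun t ht hle => by
      have h2 : DifferentiableAt ℝ (deriv a) t :=
        ((contDiffOn_succ_iff_deriv_of_isOpen (n := 1) hI).1
          (by simpa using! ha)).2.2.differentiableOn (by norm_num)
          |>.differentiableAt (hI.mem_nhds ht)
      exact (hη t ht).add (h2.hasDerivAt.inv (h1 t ht hle).1.ne')
    have hanti : AntitoneOn (fun t => η t + (deriv a t)⁻¹) (I ∩ Ici t₁) := by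
      refine antitoneOn_of_deriv_nonpos (hI'.inter ordConnected_Ici).convex
        (fun t ht => (hd t ht.1 ht.2).continuousAt.continuousWithinAt)
        (fun t ht => (hd t (interior_subset ht).1
          (interior_subset ht).2).differentiableAt.differentiableWithinAt) fun t ht => ?_
      have ht' := interior_subset ht
      rw [(hd t ht'.1 ht'.2).deriv]
      obtain ⟨h3, h4⟩ := h1 t ht'.1 ht'.2
      have h5 := ha0 t ht'.1
      have h6 : (a t)⁻¹ ≤ deriv (deriv a) t / deriv a t ^ 2 := by
        rw [inv_le_iff_one_le_mul₀ h5]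
        calc 1 ≤ _ := h4
          _ = _ := by ring
      rw [neg_div]
      linarith
    intro t ht
    rcases le_total t t₁ with hle | hle
    · linarith [hmono.monotoneOn ht ht₁ hle]
    · have h2 := hanti ⟨ht₁, self_mem_Ici⟩ ⟨ht, hle⟩ hle
      have h3 := inv_pos.2 (h1 t ht hle).1
      simp only at h2
      linarith
  have hb : BddAbove (η '' I) := ⟨_, by rintro _ ⟨t, ht, rfl⟩; exact hbdd t ht⟩
  -- An open interval has no last point, so the strictly increasing η does not attain its supremum
  -- and the normalized time is strictly negative.
  have hmax : ∀ t ∈ I, ∃ s ∈ I, t < s := fun t ht => by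
    obtain ⟨s, hs⟩ := (mem_nhds_iff_exists_Ioo_subset.1 (hI.mem_nhds ht))
    obtain ⟨u, hsu, hu⟩ := hs
    obtain ⟨v, hv⟩ := exists_between hsu.2
    exact ⟨v, hu ⟨hsu.1.trans hv.1, hv.2⟩, hv.1⟩
  refine ⟨fun t => η t - sSup (η '' I), fun t ht => (hη t ht).sub_const _, fun t ht => ?_,
    fun x hx => ?_⟩
  · obtain ⟨s, hs, hts⟩ := hmax t ht
    have h2 := hmono ht hs hts
    have h3 := le_csSup hb (mem_image_of_mem η hs)
    linarith
  · obtain ⟨_, ⟨t, ht, rfl⟩, h2⟩ :=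
      exists_lt_of_lt_csSup (hne.image η) (show x + sSup (η '' I) < sSup (η '' I) by linarith)
    exact ⟨t, ht, by linarith⟩

/-- The scale factor as a function of conformal time is the conformal factor of a Future
Isotropic Universe. -/
theorem futureFactor_conformalTime (hI : IsOpen I) (hI' : I.OrdConnected) (hne : I.Nonempty)
    (ha : ContDiffOn ℝ 2 a I) (ha0 : ∀ t ∈ I, 0 < a t)
    (hr : Tendsto (fun t : I => deriv (deriv a) t * a t / deriv a t ^ 2) atTop atTop)
    (hat : Tendsto (fun t : I => a t) atTop atTop) {η τ : ℝ → ℝ}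
    (hη : ∀ t ∈ I, HasDerivAt η (a t)⁻¹ t) (hneg : ∀ t ∈ I, η t < 0)
    (hsup : ∀ x < 0, ∃ t ∈ I, x < η t) (hτ : ContDiffOn ℝ 2 τ (η '' I))
    (hτη : ∀ t ∈ I, τ (η t) = t) (hτd : ∀ t ∈ I, HasDerivAt τ (a t) (η t)) (hJ : IsOpen (η '' I)) :
    FutureFactor (a ∘ τ) ⊤ := by
  have hmono : StrictMonoOn η I :=
    strictMonoOn_of_deriv_pos hI'.convex (fun t ht => (hη t ht).continuousAt.continuousWithinAt)
      fun t ht => by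
        rw [hI.interior_eq] at ht
        rw [(hη t ht).deriv]
        exact inv_pos.2 (ha0 t ht)
  have hJ' : (η '' I).OrdConnected :=
    (hI'.isPreconnected.image η fun t ht =>
      (hη t ht).continuousAt.continuousWithinAt).ordConnected
  -- a property that holds for late times holds for small negative conformal times
  have hlate : ∀ t₁ ∈ I, ∀ T ∈ Ico (η t₁) 0, ∃ t ∈ I, t₁ ≤ t ∧ η t = T := fun t₁ ht₁ T hT => by
    obtain ⟨s, hs, hTs⟩ := hsup T hT.2
    obtain ⟨t, ht, rfl⟩ := hJ'.out (mem_image_of_mem η ht₁) (mem_image_of_mem η hs) ⟨hT.1, hTs.le⟩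
    exact ⟨t, ht, (hmono.le_iff_le ht₁ ht).1 hT.1, rfl⟩
  have hlim : ∀ f : ℝ → ℝ, Tendsto (fun t : I => f t) atTop atTop →
      Tendsto (fun T => f (τ T)) (𝓝[<] 0) atTop := fun f hf => by
    refine tendsto_atTop.2 fun M => ?_
    obtain ⟨t₁, ht₁, h1⟩ := exists_forall_ge_of_eventually_atTop
      (P := fun t => M ≤ f t) hne (hf.eventually_ge_atTop M)
    filter_upwards [Ico_mem_nhdsLT (hneg t₁ ht₁)] with T hT
    obtain ⟨t, ht, hle, rfl⟩ := hlate t₁ ht₁ T hT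
    rw [hτη t ht]
    exact h1 t ht hle
  have hda : ∀ t ∈ I, HasDerivAt a (deriv a t) t := fun t ht =>
    ((ha.contDiffAt (hI.mem_nhds ht)).differentiableAt (by norm_num)).hasDerivAt
  have hda' : ∀ t ∈ I, HasDerivAt (deriv a) (deriv (deriv a) t) t := fun t ht =>
    (((contDiffOn_succ_iff_deriv_of_isOpen (n := 1) hI).1
      (by simpa using! ha)).2.2.differentiableOn
      (by norm_num) |>.differentiableAt (hI.mem_nhds ht)).hasDerivAt
  have hΩ1 : ∀ t ∈ I, HasDerivAt (a ∘ τ) (deriv a t * a t) (η t) := fun t ht => by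
    refine HasDerivAt.comp (η t) ?_ (hτd t ht)
    rw [hτη t ht]
    exact hda t ht
  have hΩ2 : ∀ t ∈ I, HasDerivAt (deriv (a ∘ τ))
      ((deriv (deriv a) t * a t + deriv a t * deriv a t) * a t) (η t) := fun t ht => by
    have h1 : HasDerivAt ((fun t => deriv a t * a t) ∘ τ)
        ((deriv (deriv a) t * a t + deriv a t * deriv a t) * a t) (η t) := by
      refine HasDerivAt.comp (η t) ?_ (hτd t ht)
      rw [hτη t ht]
      exact (hda' t ht).mul (hda t ht)
    refine h1.congr_of_eventuallyEq ?_
    filter_upwards [hJ.mem_nhds (mem_image_of_mem η ht)] with T hT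
    obtain ⟨s, hs, rfl⟩ := hT
    rw [(hΩ1 s hs).deriv, Function.comp_apply, hτη s hs]
  -- With ' for d/dη: Ω' = ȧ a and Ω'' = (ä a + ȧ²) a, hence L = Ω'' Ω/Ω'² = ä a/ȧ² + 1.
  have hL : ∀ t ∈ I, deriv a t ≠ 0 → bigL (a ∘ τ) (η t) =
      deriv (deriv a) t * a t / deriv a t ^ 2 + 1 := fun t ht h0 => by
    have h1 := (ha0 t ht).ne'
    rw [bigL, (hΩ1 t ht).deriv, (hΩ2 t ht).deriv, Function.comp_apply, hτη t ht]
    field_simp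
  obtain ⟨t₁, ht₁, h1⟩ := exists_deriv_pos hI hI' hne ha hr hat
  have hC2 : ContDiffOn ℝ 2 (a ∘ τ) (η '' I) := ha.comp hτ fun T hT => by
    obtain ⟨t, ht, rfl⟩ := hT
    rw [hτη t ht]
    exact ht
  have hsub : Ico (η t₁) 0 ⊆ η '' I := fun T hT => by
    obtain ⟨t, ht, -, rfl⟩ := hlate t₁ ht₁ T hT
    exact mem_image_of_mem η ht
  have hpos : ∀ T ∈ Ico (η t₁) 0, 0 < (a ∘ τ) T := fun T hT => by
    obtain ⟨t, ht, -, rfl⟩ := hlate t₁ ht₁ T hT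
    rw [Function.comp_apply, hτη t ht]
    exact ha0 t ht
  have hdpos : ∀ T ∈ Ico (η t₁) 0, 0 < deriv (a ∘ τ) T := fun T hT => by
    obtain ⟨t, ht, hle, rfl⟩ := hlate t₁ ht₁ T hT
    rw [(hΩ1 t ht).deriv]
    exact mul_pos (h1 t ht hle).1 (ha0 t ht)
  refine ⟨hlim a hat, ⟨-η t₁, neg_pos.2 (hneg t₁ ht₁), ?_⟩, ?_, ?_, ?_⟩
  · rw [neg_neg]
    refine ⟨hC2.mono hsub, ?_, hpos, fun T hT => (hdpos T hT).ne', ?_⟩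
    · exact strictMonoOn_of_deriv_pos (convex_Ico _ _) (hC2.continuousOn.mono hsub)
        fun T hT => hdpos T (interior_subset hT)
    · have h2 := (contDiffOn_succ_iff_deriv_of_isOpen (n := 1) hJ).1 (by simpa using! hC2)
      have h3 : ContinuousOn (deriv (deriv (a ∘ τ))) (η '' I) :=
        h2.2.2.continuousOn_deriv_of_isOpen hJ (by norm_num)
      have h4 : ContinuousOn (a ∘ τ) (Ico (η t₁) 0) := hC2.continuousOn.mono hsub
      have h5 : ContinuousOn (deriv (a ∘ τ)) (Ico (η t₁) 0) := h2.2.2.continuousOn.mono hsub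
      exact ((h3.mono hsub).div h4 fun T hT => (hpos T hT).ne').mul
        ((h4.div h5 fun T hT => (hdpos T hT).ne').pow 2)
  · rw [EReal.tendsto_coe_nhds_top_iff]
    have h2 := tendsto_atTop_add_const_right _ 1
      (hlim (fun t => deriv (deriv a) t * a t / deriv a t ^ 2) hr)
    refine h2.congr' ?_
    filter_upwards [Ico_mem_nhdsLT (hneg t₁ ht₁)] with T hT
    obtain ⟨t, ht, hle, rfl⟩ := hlate t₁ ht₁ T hT
    rw [hL t ht (h1 t ht hle).1.ne', hτη t ht]
  · exact EReal.coe_ne_top 1 |>.symm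
  · exact EReal.coe_ne_top 2 |>.symm

end

/-- Conformal time may start at a finite value, whereas the model must fill the whole half-cylinder
y < 0. Hence η = h(y) with h defined on all of ℝ, and ρ = h⁻¹ ∘ η. The product identity is a dη/dt =
1 by the chain rule. -/
theorem Model.exists_conformal_reparametrization {n : ℕ∞} {S : Type*} [TopologicalSpace S]
    [ChartedSpace E3 S] [IsManifold 𝓘(ℝ, E3) ∞ S] (hn : 2 ≤ n) (F : Model n S)
    (hr : Tendsto (fun t : F.I => F.ratio t) atTop atTop)
    (hat : Tendsto (fun t : F.I => F.a t) atTop atTop) :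
    ∃ (h Ω : ℝ → ℝ) (ρ : OpenPartialHomeomorph ℝ ℝ),
      ContDiff ℝ ∞ h ∧ h 0 = 0 ∧ (∀ y, 0 < deriv h y) ∧ ρ.source = F.I ∧ ρ.target = Iio 0 ∧
      ContDiffOn ℝ ((n + 1 : ℕ∞) : WithTop ℕ∞) ρ ρ.source ∧
      ContDiffOn ℝ ((n + 1 : ℕ∞) : WithTop ℕ∞) ρ.symm ρ.target ∧
      (∀ t ∈ F.I, Ω (h (ρ t)) = F.a t) ∧
      (∀ t ∈ F.I, F.a t * (deriv h (ρ t) * deriv ρ t) = 1) ∧ FutureFactor Ω ⊤ := by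
  have ha : ContDiffOn ℝ 2 F.a F.I := F.contDiffOn_a.of_le (WithTop.coe_le_coe.2 hn)
  obtain ⟨η, hη, hneg, hsup⟩ := exists_conformalTime F.isOpen_I F.ordConnected_I F.nonempty_I ha
    F.a_pos hr hat
  have hk : (1 : WithTop ℕ∞) ≤ ((n + 1 : ℕ∞) : WithTop ℕ∞) :=
    WithTop.coe_le_coe.2 (le_add_self : (1 : ℕ∞) ≤ n + 1)
  -- One order is gained because the derivative of η is 1/a, which is C^n; this yields the C^(n+1)
  -- identification.
  have hηk : ContDiffOn ℝ ((n + 1 : ℕ∞) : WithTop ℕ∞) η F.I := by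
    refine (contDiffOn_succ_iff_deriv_of_isOpen (n := (n : WithTop ℕ∞)) F.isOpen_I).2
      ⟨fun t ht => (hη t ht).differentiableAt.differentiableWithinAt, fun h => ?_, ?_⟩
    · exact absurd h (WithTop.coe_ne_top)
    · exact (F.contDiffOn_a.inv fun t ht => (F.a_pos t ht).ne').congr fun t ht => (hη t ht).deriv
  have hηd : ∀ t ∈ F.I, 0 < deriv η t := fun t ht => by
    rw [(hη t ht).deriv]
    exact inv_pos.2 (F.a_pos t ht)
  obtain ⟨e, he, hes, het, hesymm, hed⟩ := exists_openPartialHomeomorph_of_deriv_pos F.isOpen_I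
    F.ordConnected_I hk hηk hηd
  have hJ : IsOpen (η '' F.I) := het ▸ e.open_target
  have hJ' : (η '' F.I).OrdConnected :=
    (F.ordConnected_I.isPreconnected.image η hηk.continuousOn).ordConnected
  obtain ⟨h, hh, hh0, hhd, hhJ⟩ := exists_reparametrization hJ hJ'
    (by rintro _ ⟨t, ht, rfl⟩; exact hneg t ht)
    (fun x hx => by
      obtain ⟨t, ht, hxt⟩ := hsup x hx
      exact ⟨_, mem_image_of_mem η ht, hxt⟩)
  have hhk : ContDiffOn ℝ ((n + 1 : ℕ∞) : WithTop ℕ∞) h (Iio 0) :=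
    (hh.of_le (WithTop.coe_le_coe.2 le_top)).contDiffOn
  obtain ⟨e', he', hes', het', hesymm', hed'⟩ := exists_openPartialHomeomorph_of_deriv_pos
    isOpen_Iio ordConnected_Iio hk hhk fun y _ => hhd y
  have heq : e.target = e'.symm.source := by
    rw [e'.symm_source, het, het', hhJ]
  set ρ := e.trans' e'.symm heq with hρ
  have hρt : ∀ t, ρ t = e'.symm (η t) := fun t => by rw [← he]; rfl
  have hρs : ρ.source = F.I := hes
  have hρη : ∀ t ∈ F.I, h (ρ t) = η t := fun t ht => by
    rw [hρt, ← he']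
    refine e'.right_inv ?_
    rw [← e'.symm_source, ← heq, het]
    exact mem_image_of_mem η ht
  have hτη : ∀ t ∈ F.I, e.symm (η t) = t := fun t ht => by
    rw [← he]; exact e.left_inv (hes ▸ ht)
  have hmaps : MapsTo e e.source e'.target := fun t ht => by
    rw [← e'.symm_source, ← heq]; exact e.map_source ht
  have hρk : ContDiffOn ℝ ((n + 1 : ℕ∞) : WithTop ℕ∞) ρ ρ.source := by
    refine hesymm'.comp (t := e'.target) ?_ hmaps
    have h1 : ContDiffOn ℝ ((n + 1 : ℕ∞) : WithTop ℕ∞) e F.I := by rwa [he]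
    rw [hρs]; exact h1
  refine ⟨h, F.a ∘ e.symm, ρ, hh, hh0, hhd, hρs, hes', hρk, ?_, fun t ht => ?_, fun t ht => ?_, ?_⟩
  · refine hesymm.comp (t := e.target) (f := e') ?_ ?_
    · rw [he']
      have : ρ.target = Iio 0 := hes'
      rw [this]
      exact hhk
    · intro y hy
      rw [heq]
      exact e'.map_source hy
  · rw [hρη t ht, Function.comp_apply, hτη t ht]
  · have h1 : DifferentiableAt ℝ ρ t :=
      (hρk.contDiffAt (ρ.open_source.mem_nhds (hρs ▸ ht))).differentiableAt
        (fun h => by simp [h] at hk)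
    have h2 : DifferentiableAt ℝ h (ρ t) := hh.differentiable (by simp) _
    have h3 := h2.hasDerivAt.comp t h1.hasDerivAt
    have h4 : h ∘ ρ =ᶠ[𝓝 t] η := by
      filter_upwards [F.isOpen_I.mem_nhds ht] with s hs using hρη s hs
    rw [(h3.congr_of_eventuallyEq h4.symm).unique (hη t ht)]
    exact mul_inv_cancel₀ (F.a_pos t ht).ne'
  · refine futureFactor_conformalTime F.isOpen_I F.ordConnected_I F.nonempty_I ha F.a_pos hr hat hη
      hneg hsup ?_ hτη (fun t ht => ?_) hJ
    · rw [← het]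
      exact hesymm.of_le (WithTop.coe_le_coe.2 (hn.trans le_self_add))
    · have := hed t ht
      rwa [(hη t ht).deriv, inv_inv] at this

/-! ### Regularity of fields and forms from their coordinate expressions -/

section Coordinates

variable {E : Type*} [NormedAddCommGroup E] [NormedSpace ℝ E] {M : Type*} [TopologicalSpace M]
  [ChartedSpace E M] [IsManifold 𝓘(ℝ, E) ∞ M]

/-- A vector field with smooth coordinate expression is smooth. -/
theorem contMDiffAt_vectorField_of_coord {v : ∀ p : M, TangentSpace 𝓘(ℝ, E) p} {p : M}
    {k : WithTop ℕ∞} (hk : k ≤ ∞) {v' : E → E}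
    (hv' : ContDiffAt ℝ k v' (extChartAt 𝓘(ℝ, E) p p))
    (hv : ∀ q ∈ (chartAt E p).source,
      mfderiv 𝓘(ℝ, E) 𝓘(ℝ, E) (extChartAt 𝓘(ℝ, E) p) q (v q) = v' (extChartAt 𝓘(ℝ, E) p q)) :
    ContMDiffAt 𝓘(ℝ, E) (𝓘(ℝ, E).prod 𝓘(ℝ, E)) k
      (fun p : M => TotalSpace.mk' E (E := fun p : M => TangentSpace 𝓘(ℝ, E) p) p (v p)) p := by
  have : IsManifold 𝓘(ℝ, E) 1 M := IsManifold.of_le (n := ∞) (by norm_num)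
  have : IsManifold 𝓘(ℝ, E) k M := IsManifold.of_le (n := ∞) hk
  rw [contMDiffAt_section]
  refine (hv'.contMDiffAt.comp p contMDiffAt_extChartAt).congr_of_eventuallyEq ?_
  filter_upwards [chart_source_mem_nhds E p] with q hq
  exact (trivializationAt_tangent_apply hq (v q)).trans (hv q hq)

/-- A field of bilinear forms with smooth coordinate expression is smooth. -/
theorem contMDiffAt_form_of_coord
    {g : ∀ p : M, TangentSpace 𝓘(ℝ, E) p →L[ℝ] TangentSpace 𝓘(ℝ, E) p →L[ℝ] ℝ}
    {p : M} {k : WithTop ℕ∞} (hk : k ≤ ∞) {g' : E → E →L[ℝ] E →L[ℝ] ℝ}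
    (hg' : ContDiffAt ℝ k g' (extChartAt 𝓘(ℝ, E) p p))
    (hg : ∀ q ∈ (chartAt E p).source, ∀ v w : TangentSpace 𝓘(ℝ, E) q,
        g q v w = g' (extChartAt 𝓘(ℝ, E) p q)
          (mfderiv 𝓘(ℝ, E) 𝓘(ℝ, E) (extChartAt 𝓘(ℝ, E) p) q v)
          (mfderiv 𝓘(ℝ, E) 𝓘(ℝ, E) (extChartAt 𝓘(ℝ, E) p) q w)) :
    ContMDiffAt 𝓘(ℝ, E) (𝓘(ℝ, E).prod 𝓘(ℝ, E →L[ℝ] E →L[ℝ] ℝ)) k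
      (fun p : M => TotalSpace.mk' (E →L[ℝ] E →L[ℝ] ℝ)
        (E := fun p : M => TangentSpace 𝓘(ℝ, E) p →L[ℝ] TangentSpace 𝓘(ℝ, E) p →L[ℝ] ℝ)
        p (g p)) p := by
  have : IsManifold 𝓘(ℝ, E) 1 M := IsManifold.of_le (n := ∞) (by norm_num)
  have : IsManifold 𝓘(ℝ, E) k M := IsManifold.of_le (n := ∞) hk
  rw [contMDiffAt_hom_bundle]
  refine ⟨contMDiffAt_id, ?_⟩
  refine ContMDiffAt.congr_of_eventuallyEq
    (f := fun q => g' (extChartAt 𝓘(ℝ, E) p q)) (hg'.contMDiffAt.comp p contMDiffAt_extChartAt) ?_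
  filter_upwards [chart_source_mem_nhds E p] with q hq
  have hb : q ∈ (trivializationAt E (TangentSpace 𝓘(ℝ, E)) p).baseSet := by simpa using hq
  have h1 : ∀ v : E, mfderiv 𝓘(ℝ, E) 𝓘(ℝ, E) (extChartAt 𝓘(ℝ, E) p) q
      ((trivializationAt E (TangentSpace 𝓘(ℝ, E)) p).symm q v) = v := by
    intro v
    rw [← trivializationAt_tangent_apply hq]
    exact congrArg Prod.snd ((trivializationAt E (TangentSpace 𝓘(ℝ, E)) p).apply_mk_symm hb v)
  ext v w
  refine (inCoordinates_apply_eq₂ (F₃ := ℝ) (E₃ := Bundle.Trivial M ℝ) hb hb (by simp)).trans ?_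
  have h2 := hg q hq ((trivializationAt E (TangentSpace 𝓘(ℝ, E)) p).symm q v)
    ((trivializationAt E (TangentSpace 𝓘(ℝ, E)) p).symm q w)
  rw [h1, h1] at h2
  simpa using h2

end Coordinates

section BlockForm

variable {E : Type*} [NormedAddCommGroup E] [NormedSpace ℝ E]

/-- The bilinear form `c dt² + B` on `ℝ × E`. -/
noncomputable def blockForm (c : ℝ) (B : E →L[ℝ] E →L[ℝ] ℝ) : ℝ × E →L[ℝ] ℝ × E →L[ℝ] ℝ :=
  (ContinuousLinearMap.fst ℝ ℝ E).smulRight (c • ContinuousLinearMap.fst ℝ ℝ E) +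
    ((ContinuousLinearMap.compL ℝ (ℝ × E) E ℝ).flip (ContinuousLinearMap.snd ℝ ℝ E)).comp
      (B.comp (ContinuousLinearMap.snd ℝ ℝ E))

theorem blockForm_apply (c : ℝ) (B : E →L[ℝ] E →L[ℝ] ℝ) (v w : ℝ × E) :
    blockForm c B v w = c * (v.1 * w.1) + B v.2 w.2 := by
  simp [blockForm]
  ring

theorem contDiffAt_blockForm {k : WithTop ℕ∞} {c : ℝ × E → ℝ} {B : E → E →L[ℝ] E →L[ℝ] ℝ}
    {z : ℝ × E} (hc : ContDiffAt ℝ k c z) (hB : ContDiffAt ℝ k B z.2) :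
    ContDiffAt ℝ k (fun z => blockForm (c z) (B z.2)) z := by
  have h1 : ContDiffAt ℝ k (fun z : ℝ × E => B z.2) z := hB.comp z contDiffAt_snd
  refine contDiffAt_add (V := ℝ × E →L[ℝ] ℝ × E →L[ℝ] ℝ) ?_ ?_
  · exact contDiffAt_const.smulRight (hc.smul contDiffAt_const)
  · exact ContDiffAt.clm_comp contDiffAt_const (h1.clm_comp contDiffAt_const)

end BlockForm

/-! ### The unphysical spacetime on the cylinder -/

/-- The cylinder `ℝ × S` as a 4-manifold modelled on `ℝ × ℝ³`. -/
def Cylinder (S : Type*) : Type _ := ℝ × S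

namespace Cylinder

variable {S : Type*} [TopologicalSpace S]

instance : TopologicalSpace (Cylinder S) := inferInstanceAs (TopologicalSpace (ℝ × S))

instance [T2Space S] : T2Space (Cylinder S) := inferInstanceAs (T2Space (ℝ × S))

instance [SecondCountableTopology S] : SecondCountableTopology (Cylinder S) :=
  inferInstanceAs (SecondCountableTopology (ℝ × S))

instance [ConnectedSpace S] : ConnectedSpace (Cylinder S) :=
  inferInstanceAs (ConnectedSpace (ℝ × S))

variable [ChartedSpace E3 S]

noncomputable instance : ChartedSpace E4 (Cylinder S) := prodChartedSpace ℝ ℝ E3 S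

/-- The self-model of ℝ × ℝ³ and the product of the two self-models are related by the equation
`modelWithCornersSelf_prod`. Keeping the model `I` a variable allows that equation to be
substituted; the transfer lemmas below have the same form. -/
theorem isManifold_of_eq {I : ModelWithCorners ℝ E4 E4} (h : I = 𝓘(ℝ, ℝ).prod 𝓘(ℝ, E3))
    [IsManifold 𝓘(ℝ, E3) ∞ S] : IsManifold I ∞ (Cylinder S) := by
  subst h
  exact inferInstanceAs (IsManifold (𝓘(ℝ, ℝ).prod 𝓘(ℝ, E3)) ∞ (ℝ × S))

instance [IsManifold 𝓘(ℝ, E3) ∞ S] : IsManifold 𝓘(ℝ, E4) ∞ (Cylinder S) :=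
  isManifold_of_eq modelWithCornersSelf_prod

theorem hasMFDerivAt_source_iff {E H M : Type*} [NormedAddCommGroup E] [NormedSpace ℝ E]
    [TopologicalSpace H] {J : ModelWithCorners ℝ E H} [TopologicalSpace M] [ChartedSpace H M]
    {f : Cylinder S → M} {p : Cylinder S} {A : E4 →L[ℝ] E} {I : ModelWithCorners ℝ E4 E4}
    (h : I = 𝓘(ℝ, ℝ).prod 𝓘(ℝ, E3)) :
    HasMFDerivAt I J f p A ↔
      HasMFDerivAt (M := ℝ × S) (𝓘(ℝ, ℝ).prod 𝓘(ℝ, E3)) J f p A := by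
  subst h
  rfl

theorem contMDiffOn_source_iff {E H M : Type*} [NormedAddCommGroup E] [NormedSpace ℝ E]
    [TopologicalSpace H] {J : ModelWithCorners ℝ E H} [TopologicalSpace M] [ChartedSpace H M]
    {f : Cylinder S → M} {s : Set (Cylinder S)} {k : WithTop ℕ∞} {I : ModelWithCorners ℝ E4 E4}
    (h : I = 𝓘(ℝ, ℝ).prod 𝓘(ℝ, E3)) :
    ContMDiffOn I J k f s ↔
      ContMDiffOn (M := ℝ × S) (𝓘(ℝ, ℝ).prod 𝓘(ℝ, E3)) J k f s := by
  subst h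
  rfl

theorem hasMFDerivAt_target_iff {E H M : Type*} [NormedAddCommGroup E] [NormedSpace ℝ E]
    [TopologicalSpace H] {J : ModelWithCorners ℝ E H} [TopologicalSpace M] [ChartedSpace H M]
    {f : M → Cylinder S} {p : M} {A : E →L[ℝ] E4} {I : ModelWithCorners ℝ E4 E4}
    (h : I = 𝓘(ℝ, ℝ).prod 𝓘(ℝ, E3)) :
    HasMFDerivAt J I f p A ↔
      HasMFDerivAt (M' := ℝ × S) J (𝓘(ℝ, ℝ).prod 𝓘(ℝ, E3)) f p A := by
  subst h
  rfl

theorem contMDiffOn_target_iff {E H M : Type*} [NormedAddCommGroup E] [NormedSpace ℝ E]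
    [TopologicalSpace H] {J : ModelWithCorners ℝ E H} [TopologicalSpace M] [ChartedSpace H M]
    {f : M → Cylinder S} {s : Set M} {k : WithTop ℕ∞} {I : ModelWithCorners ℝ E4 E4}
    (h : I = 𝓘(ℝ, ℝ).prod 𝓘(ℝ, E3)) :
    ContMDiffOn J I k f s ↔
      ContMDiffOn (M' := ℝ × S) J (𝓘(ℝ, ℝ).prod 𝓘(ℝ, E3)) k f s := by
  subst h
  rfl

theorem mem_chartAt_source {p q : Cylinder S} :
    q ∈ (chartAt E4 p).source ↔ q.2 ∈ (chartAt E3 p.2).source :=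
  and_iff_right (mem_univ _)

theorem hasMFDerivAt_time (p : Cylinder S) : HasMFDerivAt 𝓘(ℝ, E4) 𝓘(ℝ, ℝ)
    (fun q : Cylinder S => q.1) p (ContinuousLinearMap.fst ℝ ℝ E3) :=
  (hasMFDerivAt_source_iff modelWithCornersSelf_prod).2 (hasMFDerivAt_fst (M := ℝ) (M' := S) p)

theorem hasMFDerivAt_space (p : Cylinder S) : HasMFDerivAt 𝓘(ℝ, E4) 𝓘(ℝ, E3)
    (fun q : Cylinder S => q.2) p (ContinuousLinearMap.snd ℝ ℝ E3) :=
  (hasMFDerivAt_source_iff modelWithCornersSelf_prod).2 (hasMFDerivAt_snd (M := ℝ) (M' := S) p)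

theorem mfderiv_extChartAt [IsManifold 𝓘(ℝ, E3) ∞ S] {p q : Cylinder S}
    (hq : q ∈ (chartAt E4 p).source) (v : E4) :
    mfderiv 𝓘(ℝ, E4) 𝓘(ℝ, E4) (extChartAt 𝓘(ℝ, E4) p) q v =
      ((v.1, mfderiv 𝓘(ℝ, E3) 𝓘(ℝ, E3) (extChartAt 𝓘(ℝ, E3) p.2) q.2 v.2) : ℝ × E3) := by
  have : IsManifold 𝓘(ℝ, E3) 1 S := IsManifold.of_le (n := ∞) (by norm_num)
  have h1 := (mdifferentiableAt_extChartAt (I := 𝓘(ℝ, E3)) (mem_chartAt_source.1 hq)).hasMFDerivAt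
  have h2 : HasMFDerivAt 𝓘(ℝ, E4) 𝓘(ℝ, E4) (extChartAt 𝓘(ℝ, E4) p) q
      ((ContinuousLinearMap.fst ℝ ℝ E3).prod
        ((mfderiv 𝓘(ℝ, E3) 𝓘(ℝ, E3) (extChartAt 𝓘(ℝ, E3) p.2) q.2).comp
          (ContinuousLinearMap.snd ℝ ℝ E3)) : E4 →L[ℝ] E4) :=
    ⟨(hasMFDerivAt_time q).1.prodMk (h1.comp q (hasMFDerivAt_space q)).1,
      (hasMFDerivAt_time q).2.prodMk (h1.comp q (hasMFDerivAt_space q)).2⟩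
  exact DFunLike.congr_fun h2.mfderiv v

end Cylinder

namespace Cylinder

variable {S : Type*} [TopologicalSpace S] [ChartedSpace E3 S]

theorem hasMFDerivAt_comp_time {h : ℝ → ℝ} (hh : ContDiff ℝ ∞ h) (p : Cylinder S) :
    HasMFDerivAt 𝓘(ℝ, E4) 𝓘(ℝ, ℝ) (fun q : Cylinder S => h q.1) p
      ((ContinuousLinearMap.toSpanSingleton ℝ (deriv h p.1)).comp
        (ContinuousLinearMap.fst ℝ ℝ E3)) :=
  HasMFDerivAt.comp p
    ((hh.differentiable (by simp)) p.1).hasDerivAt.hasFDerivAt.hasMFDerivAt (hasMFDerivAt_time p)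

theorem contMDiff_comp_time {h : ℝ → ℝ} (hh : ContDiff ℝ ∞ h) :
    ContMDiff 𝓘(ℝ, E4) 𝓘(ℝ, ℝ) ∞ (fun q : Cylinder S => h q.1) := by
  refine hh.contMDiff.comp (contMDiffOn_univ.1 ?_)
  exact (contMDiffOn_source_iff modelWithCornersSelf_prod).2
    (contMDiff_fst (M := ℝ) (N := S)).contMDiffOn

variable [IsManifold 𝓘(ℝ, E3) ∞ S]

/-- The metric `-h'(y)² dy² + dσ²`. -/
noncomputable def form (h : ℝ → ℝ) (σ : RiemannMetric S) (p : Cylinder S) :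
    TangentSpace 𝓘(ℝ, E4) p →L[ℝ] TangentSpace 𝓘(ℝ, E4) p →L[ℝ] ℝ :=
  blockForm (-deriv h p.1 ^ 2) (σ.inner p.2 : E3 →L[ℝ] E3 →L[ℝ] ℝ)

theorem form_apply (h : ℝ → ℝ) (σ : RiemannMetric S) (p : Cylinder S) (v w : E4) :
    form h σ p v w = -deriv h p.1 ^ 2 * (v.1 * w.1) + σ.inner p.2 v.2 w.2 :=
  blockForm_apply _ _ v w

theorem form_time_left (h : ℝ → ℝ) (σ : RiemannMetric S) (p : Cylinder S) (c : ℝ) (w : E4) :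
    form h σ p ((c, 0) : ℝ × E3) w = -deriv h p.1 ^ 2 * (c * w.1) := by
  rw [form_apply]
  let B : E3 →L[ℝ] E3 →L[ℝ] ℝ := σ.inner p.2
  change _ + B 0 w.2 = _
  simp

theorem form_time_right (h : ℝ → ℝ) (σ : RiemannMetric S) (p : Cylinder S) (c : ℝ) (w : E4) :
    form h σ p w ((c, 0) : ℝ × E3) = -deriv h p.1 ^ 2 * (w.1 * c) := by
  rw [form_apply]
  let B : E3 →L[ℝ] E3 →L[ℝ] ℝ := σ.inner p.2
  change _ + B w.2 0 = _
  simp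

theorem contMDiff_form {h : ℝ → ℝ} (hh : ContDiff ℝ ∞ h) (σ : RiemannMetric S) :
    ContMDiff 𝓘(ℝ, E4) (𝓘(ℝ, E4).prod 𝓘(ℝ, E4 →L[ℝ] E4 →L[ℝ] ℝ)) ∞
      (fun p : Cylinder S => TotalSpace.mk' (E4 →L[ℝ] E4 →L[ℝ] ℝ)
        (E := fun p : Cylinder S =>
          TangentSpace 𝓘(ℝ, E4) p →L[ℝ] TangentSpace 𝓘(ℝ, E4) p →L[ℝ] ℝ) p (form h σ p)) := by
  intro p
  obtain ⟨σ', hσ', hσc⟩ := exists_coord_form (σ.contMDiff p.2)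
  have hd : ContDiff ℝ ∞ (deriv h) := (contDiff_infty_iff_deriv.1 hh).2
  refine contMDiffAt_form_of_coord le_rfl (g' := fun z => blockForm (-deriv h z.1 ^ 2) (σ' z.2))
    (contDiffAt_blockForm ?_ hσ') fun q hq v w => ?_
  · exact ((hd.comp contDiff_fst).pow 2).neg.contDiffAt
  · let v' : E4 := v
    let w' : E4 := w
    refine Eq.trans ?_ (congrArg₂ (fun a b : E4 => blockForm
      (-deriv h (extChartAt 𝓘(ℝ, E4) p q).1 ^ 2) (σ' (extChartAt 𝓘(ℝ, E4) p q).2) a b)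
      (mfderiv_extChartAt hq v') (mfderiv_extChartAt hq w')).symm
    refine (form_apply h σ q v' w').trans (Eq.trans ?_ (blockForm_apply _ _ _ _).symm)
    exact congrArg _ (hσc q.2 (mem_chartAt_source.1 hq) v'.2 w'.2).symm

theorem contMDiff_timeField {f : ℝ → ℝ} (hf : ContDiff ℝ ∞ f) :
    ContMDiff 𝓘(ℝ, E4) (𝓘(ℝ, E4).prod 𝓘(ℝ, E4)) ∞
      (fun p : Cylinder S => TotalSpace.mk' E4
        (E := fun p : Cylinder S => TangentSpace 𝓘(ℝ, E4) p) p ((f p.1, 0) : ℝ × E3)) := by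
  intro p
  refine contMDiffAt_vectorField_of_coord le_rfl (v' := fun z => (f z.1, (0 : E3)))
    ((hf.comp contDiff_fst).prodMk contDiff_const).contDiffAt fun q hq => ?_
  rw [mfderiv_extChartAt hq]
  let A : E3 →L[ℝ] E3 := mfderiv 𝓘(ℝ, E3) 𝓘(ℝ, E3) (extChartAt 𝓘(ℝ, E3) p.2) q.2
  change (f q.1, A 0) = (f q.1, 0)
  rw [map_zero]

/-- The spacetime `ℝ × S` with the metric `-h'(y)² dy² + dσ²`. -/
noncomputable def spacetime {h : ℝ → ℝ} (hh : ContDiff ℝ ∞ h) (hpos : ∀ y, 0 < deriv h y)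
    (σ : RiemannMetric S) : Spacetime (Cylinder S) where
  g := form h σ
  symm := fun p v w => by
    let v' : E4 := v
    let w' : E4 := w
    change form h σ p v' w' = form h σ p w' v'
    rw [form_apply, form_apply, mul_comm v'.1]
    exact congrArg _ (σ.symm p.2 v'.2 w'.2)
  lorentzian := fun p => by
    have h0 := pow_pos (hpos p.1) 2
    refine ⟨((1, 0) : ℝ × E3), ?_, fun w hw hw0 => ?_⟩
    · rw [form_time_left]
      simpa using h0
    · let w' : E4 := w
      have hw1 : w'.1 = 0 := by
        have h1 := (form_time_left h σ p 1 w').symm.trans hw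
        rw [one_mul] at h1
        exact (mul_eq_zero.1 h1).resolve_left (neg_ne_zero.2 h0.ne')
      change 0 < form h σ p w' w'
      rw [form_apply, hw1]
      have hw2 : w'.2 ≠ 0 := fun h2 => hw0 (Prod.ext hw1 h2 : w' = 0)
      simpa using σ.pos p.2 w'.2 hw2
  continuous_g := (contMDiff_form hh σ).of_le (by simp)
  timeDir := fun p => (((deriv h p.1)⁻¹, 0) : ℝ × E3)
  continuous_timeDir := (contMDiff_timeField
    ((contDiff_infty_iff_deriv.1 hh).2.inv fun y => (hpos y).ne')).of_le (by simp)
  timelike_timeDir := fun p => by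
    have h0 := hpos p.1
    rw [form_time_left]
    have : -deriv h p.1 ^ 2 * ((deriv h p.1)⁻¹ * (deriv h p.1)⁻¹) = -1 := by field_simp
    exact this.trans_lt (by norm_num)

/-- The chosen time direction is (1/h') ∂/∂y, so g(v, timeDir) = -h' v_y = -dT(v). The future
condition on a velocity thus says precisely that T increases. -/
theorem isSmoothCosmicTime {h : ℝ → ℝ} (hh : ContDiff ℝ ∞ h) (hpos : ∀ y, 0 < deriv h y)
    (σ : RiemannMetric S) : (spacetime hh hpos σ).IsSmoothCosmicTime (fun q => h q.1) := by
  refine ⟨contMDiff_comp_time hh, fun γ α β hγ => ?_⟩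
  have hd : ∀ s ∈ Ioo α β, ∃ c > 0, HasDerivAt (fun s => h (γ s).1) c s := fun s hs => by
    have h1 : HasMFDerivAt 𝓘(ℝ, ℝ) 𝓘(ℝ, E4) γ s (mfderiv 𝓘(ℝ, ℝ) 𝓘(ℝ, E4) γ s) :=
      ((hγ.1.contMDiffAt (Ioo_mem_nhds hs.1 hs.2)).mdifferentiableAt (by norm_num)).hasMFDerivAt
    have h2 := hasDerivAt_comp_curve (hasMFDerivAt_comp_time hh (γ s)).mdifferentiableAt h1
    refine ⟨_, ?_, h2⟩
    rw [(hasMFDerivAt_comp_time hh (γ s)).mfderiv]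
    have h3 := (hγ.2 s hs).2.2
    let v : E4 := mfderiv 𝓘(ℝ, ℝ) 𝓘(ℝ, E4) γ s (1 : ℝ)
    change form h σ (γ s) v (((deriv h (γ s).1)⁻¹, 0) : ℝ × E3) < 0 at h3
    rw [form_time_right] at h3
    have h4 := hpos (γ s).1
    have h5 : -deriv h (γ s).1 ^ 2 * (v.1 * (deriv h (γ s).1)⁻¹) = -(v.1 * deriv h (γ s).1) := by
      field_simp
    rw [h5] at h3
    change 0 < v.1 • deriv h (γ s).1
    rw [smul_eq_mul]
    linarith
  choose! c hc hd using hd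
  refine strictMonoOn_of_deriv_pos (convex_Ioo α β)
    (fun s hs => (hd s hs).continuousAt.continuousWithinAt) fun s hs => ?_
  rw [interior_Ioo] at hs
  rw [show deriv ((fun q : Cylinder S => h q.1) ∘ γ) s = c s from (hd s hs).deriv]
  exact hc s hs

end Cylinder

namespace Cylinder

section Embedding

variable {S : Type*} [TopologicalSpace S]

/-- The embedding `(t, s) ↦ (ρ t, s)`. -/
def embedding (ρ : OpenPartialHomeomorph ℝ ℝ) : OpenPartialHomeomorph (ℝ × S) (Cylinder S) :=
  ρ.prod (OpenPartialHomeomorph.refl S)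

variable [ChartedSpace E3 S] {ρ : OpenPartialHomeomorph ℝ ℝ} {k : WithTop ℕ∞}

theorem contMDiffOn_embedding (hρ : ContDiffOn ℝ k ρ ρ.source) :
    ContMDiffOn (𝓘(ℝ, ℝ).prod 𝓘(ℝ, E3)) 𝓘(ℝ, E4) k (embedding ρ : ℝ × S → Cylinder S)
      (embedding ρ).source := by
  refine (contMDiffOn_target_iff modelWithCornersSelf_prod).2 ?_
  exact (hρ.contMDiffOn.comp contMDiffOn_fst fun p hp => hp.1).prodMk contMDiffOn_snd

theorem contMDiffOn_embedding_symm (hρ : ContDiffOn ℝ k ρ.symm ρ.target) :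
    ContMDiffOn 𝓘(ℝ, E4) (𝓘(ℝ, ℝ).prod 𝓘(ℝ, E3)) k
      ((embedding ρ).symm : Cylinder S → ℝ × S) (embedding ρ).target := by
  refine (contMDiffOn_source_iff modelWithCornersSelf_prod).2 ?_
  exact (hρ.contMDiffOn.comp contMDiffOn_fst fun p hp => hp.1).prodMk contMDiffOn_snd

theorem mfderiv_embedding {p : ℝ × S} (hρ : DifferentiableAt ℝ ρ p.1) (v : ℝ × E3) :
    mfderiv (𝓘(ℝ, ℝ).prod 𝓘(ℝ, E3)) 𝓘(ℝ, E4) (embedding ρ : ℝ × S → Cylinder S) p v =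
      ((deriv ρ p.1 * v.1, v.2) : ℝ × E3) := by
  have h1 := HasMFDerivAt.comp p hρ.hasDerivAt.hasFDerivAt.hasMFDerivAt
    (hasMFDerivAt_fst (I := 𝓘(ℝ, ℝ)) (I' := 𝓘(ℝ, E3)) p)
  have h2 := h1.prodMk (hasMFDerivAt_snd (I := 𝓘(ℝ, ℝ)) (I' := 𝓘(ℝ, E3)) p)
  have h3 : HasMFDerivAt (𝓘(ℝ, ℝ).prod 𝓘(ℝ, E3)) 𝓘(ℝ, E4)
      (embedding ρ : ℝ × S → Cylinder S) p
      (((ContinuousLinearMap.toSpanSingleton ℝ (deriv ρ p.1)).comp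
        (ContinuousLinearMap.fst ℝ ℝ E3)).prod (ContinuousLinearMap.snd ℝ ℝ E3)) :=
    (hasMFDerivAt_target_iff modelWithCornersSelf_prod).2 h2
  refine (DFunLike.congr_fun h3.mfderiv v).trans ?_
  change (v.1 • deriv ρ p.1, v.2) = (deriv ρ p.1 * v.1, v.2)
  rw [smul_eq_mul, mul_comm]

end Embedding

variable {n : ℕ∞} {S : Type*} [TopologicalSpace S] [ChartedSpace E3 S] [IsManifold 𝓘(ℝ, E3) ∞ S]

/-- The conformal extension of the model given by a time function `h` and a reparametrization `ρ`
of time. -/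
noncomputable def extension [Nonempty S] (F : Model n S) {h Ω : ℝ → ℝ}
    {ρ : OpenPartialHomeomorph ℝ ℝ} (hh : ContDiff ℝ ∞ h) (h0 : h 0 = 0)
    (hpos : ∀ y, 0 < deriv h y) (hs : ρ.source = F.I) (ht : ρ.target = Iio 0)
    (hρ : ContDiffOn ℝ ((n + 1 : ℕ∞) : WithTop ℕ∞) ρ ρ.source)
    (hρ' : ContDiffOn ℝ ((n + 1 : ℕ∞) : WithTop ℕ∞) ρ.symm ρ.target)
    (hΩ : ∀ t ∈ F.I, Ω (h (ρ t)) = F.a t)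
    (hρd : ∀ t ∈ F.I, F.a t * (deriv h (ρ t) * deriv ρ t) = 1) :
    ConformalExtension F (Iio 0) (Cylinder S) where
  toSpacetime := spacetime hh hpos F.σ
  T := fun q => h q.1
  cosmicTime := isSmoothCosmicTime hh hpos F.σ
  nonempty_zero := ⟨(0, Classical.arbitrary S), h0⟩
  regular_zero := fun p _ hp => by
    rw [(hasMFDerivAt_comp_time hh p).mfderiv] at hp
    have h1 : (1 : ℝ) • deriv h p.1 = 0 := DFunLike.congr_fun hp ((1, 0) : ℝ × E3)
    rw [one_smul] at h1
    exact (hpos _).ne' h1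
  φ := embedding ρ
  source_φ := by
    rw [← hs]
    rfl
  target_φ := by
    have hmono : StrictMono h := strictMono_of_deriv_pos hpos
    ext p
    change p.1 ∈ ρ.target ∧ p.2 ∈ univ ↔ h p.1 < 0
    rw [ht, and_iff_left (mem_univ _), mem_Iio, ← hmono.lt_iff_lt, h0]
  contMDiffOn_φ := contMDiffOn_embedding hρ
  contMDiffOn_φ_symm := contMDiffOn_embedding_symm hρ'
  future_φ := fun p hp => by
    have hpI : p.1 ∈ F.I := hs ▸ hp.1
    have hd : DifferentiableAt ℝ ρ p.1 := (hρ.contDiffAt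
      (ρ.open_source.mem_nhds hp.1)).differentiableAt ConformalExtension.succ_ne_zero
    have h1 : mfderiv (𝓘(ℝ, ℝ).prod 𝓘(ℝ, E3)) 𝓘(ℝ, E4) (embedding ρ : ℝ × S → Cylinder S) p
        (Model.fluid p) = ((deriv ρ p.1, 0) : ℝ × E3) :=
      (mfderiv_embedding hd (1, 0)).trans (by rw [mul_one])
    have h2 := hpos (ρ p.1)
    -- Forced by a h'(ρ) ρ' = 1 with a and h' positive.
    have h3 : 0 < deriv ρ p.1 := by
      have h4 := F.a_pos _ hpI
      have h5 := hρd _ hpI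
      by_contra! h6
      have := mul_nonpos_of_nonneg_of_nonpos h4.le (mul_nonpos_of_nonneg_of_nonpos h2.le h6)
      linarith
    rw [h1]
    refine ⟨fun h4 => h3.ne' (congrArg Prod.fst h4), ?_, ?_⟩
    · change form h F.σ (embedding ρ p) ((deriv ρ p.1, 0) : ℝ × E3)
        ((deriv ρ p.1, 0) : ℝ × E3) ≤ 0
      rw [form_time_left]
      have := mul_nonneg (sq_nonneg (deriv h (embedding ρ p).1)) (mul_self_nonneg (deriv ρ p.1))
      linarith
    · change form h F.σ (embedding ρ p) ((deriv ρ p.1, 0) : ℝ × E3)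
        (((deriv h (ρ p.1))⁻¹, 0) : ℝ × E3) < 0
      rw [form_time_left]
      change -deriv h (ρ p.1) ^ 2 * (deriv ρ p.1 * (deriv h (ρ p.1))⁻¹) < 0
      have h4 : 0 < deriv h (ρ p.1) ^ 2 * (deriv ρ p.1 * (deriv h (ρ p.1))⁻¹) := by positivity
      linarith
  Ω := Ω
  Ω_pos := fun p hp => by
    have hmono : StrictMono h := strictMono_of_deriv_pos hpos
    have h1 : p.1 ∈ ρ.target := by
      rw [ht, mem_Iio, ← hmono.lt_iff_lt, h0]
      exact hp
    have h2 := ρ.map_target h1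
    rw [hs] at h2
    rw [← ρ.right_inv h1, hΩ _ h2]
    exact F.a_pos _ h2
  conformal := fun p hp v w => by
    have hpI : p.1 ∈ F.I := hs ▸ hp.1
    have hd : DifferentiableAt ℝ ρ p.1 := (hρ.contDiffAt
      (ρ.open_source.mem_nhds hp.1)).differentiableAt ConformalExtension.succ_ne_zero
    let v' : ℝ × E3 := v
    let w' : ℝ × E3 := w
    have h1 := congrArg₂ (fun a b : E4 => form h F.σ (embedding ρ p) a b)
      (mfderiv_embedding hd v') (mfderiv_embedding hd w')
    refine Eq.trans ?_ (congrArg (fun x => Ω (h (ρ p.1)) ^ 2 * x)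
      (h1.trans (form_apply h F.σ _ _ _))).symm
    rw [hΩ _ hpI]
    change F.a p.1 ^ 2 * F.σ.inner p.2 v'.2 w'.2 - v'.1 * w'.1 = F.a p.1 ^ 2 *
      (-deriv h (ρ p.1) ^ 2 * (deriv ρ p.1 * v'.1 * (deriv ρ p.1 * w'.1)) +
        F.σ.inner p.2 v'.2 w'.2)
    -- With x = a h'(ρ) ρ' the time components differ by (x² - 1) times v₀ w₀, and x² - 1 = (x +
    -- 1)(x - 1).
    linear_combination (v'.1 * w'.1) *
      (F.a p.1 * (deriv h (ρ p.1) * deriv ρ p.1) + 1) * hρd _ hpI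
  regular_g := ⟨univ, isOpen_univ, subset_univ _,
    ((contMDiff_form hh F.σ).of_le (WithTop.coe_le_coe.2 le_top)).contMDiffOn⟩

end Cylinder

/-- Take ū = (1/h') ∂/∂y, the unit normal of the slices. It is smooth on the whole cylinder, and it
equals Ω u on the model because a ρ' = 1/h'. -/
theorem Model.admitsFIU_of_tendsto {n : ℕ∞} (hn : 2 ≤ n) {S : Type u} [TopologicalSpace S]
    [T2Space S] [SecondCountableTopology S] [ConnectedSpace S] [ChartedSpace E3 S]
    [IsManifold 𝓘(ℝ, E3) ∞ S] (F : Model n S)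
    (hr : Tendsto (fun t : F.I => F.ratio t) atTop atTop)
    (ha : Tendsto (fun t : F.I => F.a t) atTop atTop) : F.AdmitsFIU ⊤ := by
  obtain ⟨h, Ω, ρ, hh, h0, hpos, hs, ht, hρ, hρ', hΩ, hρd, hF⟩ :=
    F.exists_conformal_reparametrization hn hr ha
  refine ⟨Cylinder S, inferInstance, inferInstance, inferInstance, inferInstance, inferInstance,
    inferInstance, Cylinder.extension F hh h0 hpos hs ht hρ hρ' hΩ hρd, hF,
    fun p => (((deriv h p.1)⁻¹, 0) : ℝ × E3), fun p => ?_, fun p hp => ?_, univ, isOpen_univ,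
    subset_univ _, ?_⟩
  · have h1 := hpos p.1
    refine (Cylinder.form_time_left h F.σ p _ _).trans ?_
    field_simp
  · have hpI : p.1 ∈ F.I := hs ▸ hp.1
    have hd : DifferentiableAt ℝ ρ p.1 := (hρ.contDiffAt
      (ρ.open_source.mem_nhds hp.1)).differentiableAt ConformalExtension.succ_ne_zero
    refine Eq.trans ?_ (congrArg (fun x : E4 => Ω (h (ρ p.1)) • x)
      (Cylinder.mfderiv_embedding hd (1, 0))).symm
    change ((deriv h (ρ p.1))⁻¹, (0 : E3)) = Ω (h (ρ p.1)) • (deriv ρ p.1 * 1, (0 : E3))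
    have h1 := hρd _ hpI
    have h2 := (hpos (ρ p.1)).ne'
    rw [hΩ _ hpI, Prod.smul_mk, smul_zero, mul_one, smul_eq_mul]
    congr 1
    field_simp
    linarith
  · exact ((Cylinder.contMDiff_timeField ((contDiff_infty_iff_deriv.1 hh).2.inv
      fun y => (hpos y).ne')).of_le (WithTop.coe_le_coe.2 le_top)).contMDiffOn

end FRW

theorem mainTheorem2 (n : ℕ∞) (hn : 2 ≤ n) {S : Type u} [TopologicalSpace S] [T2Space S]
    [SecondCountableTopology S] [ConnectedSpace S] [ChartedSpace FRW.E3 S]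
    [IsManifold 𝓘(ℝ, FRW.E3) ∞ S] (F : FRW.Model n S) :
    (F.AdmitsFIU ⊤ ↔
      Tendsto (fun t : F.I => F.ratio t) atTop atTop ∧
      Tendsto (fun t : F.I => F.a t) atTop atTop) ∧
    (F.AdmitsPIU ⊤ ↔
      Tendsto (fun t : F.I => F.ratio t) atBot atTop ∧
      Tendsto (fun t : F.I => F.a t) atBot atTop) := by
  have hfiu : ∀ F : FRW.Model n S, F.AdmitsFIU ⊤ ↔
      Tendsto (fun t : F.I => F.ratio t) atTop atTop ∧
      Tendsto (fun t : F.I => F.a t) atTop atTop := fun F => by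
    constructor
    · rintro ⟨X, _, _, _, _, _, _, C, hΩ, hC⟩
      exact C.tendsto_of_fluidRegular hn hΩ hC
    · rintro ⟨hr, ha⟩
      exact F.admitsFIU_of_tendsto hn hr ha
  refine ⟨hfiu F, ?_⟩
  rw [F.admitsPIU_iff_rev, hfiu F.rev]
  refine and_congr ?_ F.tendsto_rev_iff
  simp only [FRW.Model.ratio_rev]
  exact F.tendsto_rev_iff
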